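/- Let $\mathcal D$ be the collection of all dyadic intervals $[k2^n,(k+1)2^n)$, $n,k\in\mathbb Z$, and $\mathcal D\otimes\mathcal D$ the collection of all dyadic rectangles $R=I\times J$, $I,J\in\mathcal D$, in the plane. A dyadic distribution is a family $g=\{g_R\}_{R\in\mathcal D\otimes\mathcal D}$ of real numbers, written formally as $g=\sum_R g_Rh_R$, where $h_R=h_I\otimes h_J$ are the $L^2$-normalized Haar functions. Its square function is $$S_d(g)(x)=\Big(\sum_{R} g_R^2\,\frac{\chi_R(x)}{|R|}\Big)^{1/2},$$ and for $0<p<\infty$ put $\|g\|_{\dot H_d^p(\mathbb R\otimes\mathbb R)}=\|S_d(g)\|_{L^p(\mathbb R^2)}\in[0,\infty]$; moreover $$\|g\|_{BMO_d(\mathbb R\otimes\mathbb R)}=\sup_{\Omega}\Big(\frac1{|\Omega|}\sum_{R\subseteq\Omega}g_R^2\Big)^{1/2}\in[0,\infty],$$ the supremum being over all open sets $\Omega\subset\mathbb R^2$ of finite positive measure. For $f\in L^1_{\rm loc}(\mathbb R^2)$ let $\langle f\rangle_R=|R|^{-1}\int_R f$ and $M_d(f)(x)=\sup_{R\ni x}|\langle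 f\rangle_R|$, the supremum being over dyadic rectangles. For $0<p<\infty$, $H_d^p(\mathbb R\otimes\mathbb R)$ is the completion of the space of all real-valued $f\in L^1_{\rm loc}(\mathbb R^2)$ with $\|f\|_{H_d^p}=\|M_d(f)\|_{L^p(\mathbb R^2)}<\infty$; the averages $\langle f\rangle_R$ extend continuously to it. The dyadic paraproduct with symbol $g$ maps $f$ to the dyadic distribution $$\pi_g(f)=\sum_{R\in\mathcal D\otimes\mathcal D}g_R\langle f\rangle_Rh_R,$$ and $\|\pi_g\|_{H_d^p\to\dot H_d^q}\in[0,\infty]$ is the least $A$ with $\|\pi_g(f)\|_{\dot H_d^q}\le A\|f\|_{H_d^p}$ for all $f\in H_d^p(\mathbb R\otimes\mathbb R)$ ($\infty$ if there is no finite such $A$). **Theorem.** (I) For all $0<p,q,r<\infty$ with $\frac1q=\frac1p+\frac1r$ there are constants $0<c\le C<\infty$, depending only on $p,q,r$, such that for every dyadic distribution $g$ $$c\,\|g\|_{\dot H_d^r(\mathbb R\otimes\mathbb R)}\le\|\pi_g\|_{H_d^p(\mathbb R\otimes\mathbb R)\to\dot H_d^q(\mathbb R\otimes\mathbb R)}\le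 C\,\|g\|_{\dot H_d^r(\mathbb R\otimes\mathbb R)}.$$ (II) For all $0<p<\infty$ there are constants $0<c\le C<\infty$, depending only on $p$, such that for every dyadic distribution $g$ $$c\,\|g\|_{BMO_d(\mathbb R\otimes\mathbb R)}\le\|\pi_g\|_{H_d^p(\mathbb R\otimes\mathbb R)\to\dot H_d^p(\mathbb R\otimes\mathbb R)}\le C\,\|g\|_{BMO_d(\mathbb R\otimes\mathbb R)}.$$ In both parts either side may be infinite, and then so is the other. -/

import Mathlib

open MeasureTheory Filter
open scoped ENNReal NNReal Topology

noncomputable section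

namespace BiDyadic

/-- The dyadic interval `[k 2ⁿ, (k + 1) 2ⁿ)`, with `n, k : ℤ`, coded by the pair `(n, k)`.
Distinct pairs give distinct intervals. -/
def dyadicInterval (I : ℤ × ℤ) : Set ℝ :=
  Set.Ico ((I.2 : ℝ) * (2 : ℝ) ^ I.1) (((I.2 : ℝ) + 1) * (2 : ℝ) ^ I.1)

/-- Index set of the dyadic rectangles `R = I × J`, where `I` and `J` are (codes of) arbitrary
dyadic intervals. -/
abbrev DyadicRect : Type := (ℤ × ℤ) × (ℤ × ℤ)

/-- The dyadic rectangle `I × J` as a subset of the plane. -/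
def rect (R : DyadicRect) : Set (ℝ × ℝ) :=
  dyadicInterval R.1 ×ˢ dyadicInterval R.2

/-- A dyadic distribution: a family of real numbers indexed by the dyadic rectangles, thought of
as the coefficients of a formal series in the Haar functions `h_R`. -/
abbrev DyadicDistribution : Type := DyadicRect → ℝ

/-- The family of averages `⟨f⟩_R` of a function over the dyadic rectangles. -/
def averages (f : ℝ × ℝ → ℝ) : DyadicRect → ℝ :=
  fun R => ⨍ y in rect R, f y

/-- The bi-parameter dyadic maximal function `x ↦ sup_{R ∋ x} |a_R|` of a family `a` of averages;
for a locally integrable `f`, `maximal (averages f)` is `M_d f`. -/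
def maximal (a : DyadicRect → ℝ) (x : ℝ × ℝ) : ℝ≥0∞ :=
  ⨆ (R : DyadicRect) (_ : x ∈ rect R), ENNReal.ofReal |a R|

/-- The bi-parameter dyadic square function `(∑_R g_R² χ_R(x) / |R|)^{1/2}`. -/
def squareFn (g : DyadicDistribution) (x : ℝ × ℝ) : ℝ≥0∞ :=
  (∑' R : DyadicRect,
    (rect R).indicator (fun _ => ENNReal.ofReal (g R ^ 2) / volume (rect R)) x) ^ (1 / 2 : ℝ)

/-- The (quasi-)norm of `H_d^p`, the `L^p` norm of the maximal function, for a family of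
averages. -/
def hardyNorm (p : ℝ) (a : DyadicRect → ℝ) : ℝ≥0∞ :=
  eLpNorm (maximal a) (ENNReal.ofReal p) volume

/-- The locally integrable functions `f` with `‖M_d f‖_{L^p} < ∞`. -/
def preHardy (p : ℝ) : Set (ℝ × ℝ → ℝ) :=
  {f | LocallyIntegrable f volume ∧ hardyNorm p (averages f) < ∞}

/-- The space `H_d^p(ℝ ⊗ ℝ)`, i.e. the completion of `preHardy p` for `f ↦ ‖M_d f‖_{L^p}`.
Since `|⟨f⟩_R| ≤ |R|^{-1/p} ‖M_d f‖_{L^p}`, the averages pass to the completion, and an element of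
the completion is determined by its averages (Fatou's lemma). So the completion is realised as the
set of families of averages which are limits, in the `H_d^p` (quasi-)norm, of families of averages
of functions of `preHardy p`; its (quasi-)norm is `hardyNorm p`. -/
def hardySpace (p : ℝ) : Set (DyadicRect → ℝ) :=
  {a | ∃ f : ℕ → ℝ × ℝ → ℝ, (∀ n, f n ∈ preHardy p) ∧
    Tendsto (fun n => hardyNorm p (fun R => a R - averages (f n) R)) atTop (𝓝 0)}

/-- The (quasi-)norm of `Ḣ_d^p(ℝ ⊗ ℝ)`, the `L^p` norm of the square function; it is `∞` when `g`
is not in that space. -/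
def dotHardyNorm (p : ℝ) (g : DyadicDistribution) : ℝ≥0∞ :=
  eLpNorm (squareFn g) (ENNReal.ofReal p) volume

/-- The paraproduct `π_g(f) = ∑_R g_R ⟨f⟩_R h_R`, as a dyadic distribution, for `f` given through
its averages `a_R = ⟨f⟩_R`. -/
def paraproduct (g : DyadicDistribution) (a : DyadicRect → ℝ) : DyadicDistribution :=
  fun R => g R * a R

/-- The operator norm of `π_g : H_d^p → Ḣ_d^q`: the least constant `A` with
`‖π_g(f)‖ ≤ A ‖f‖` for all `f` in `H_d^p`, and `∞` when there is no such constant. -/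
def paraproductNorm (p q : ℝ) (g : DyadicDistribution) : ℝ≥0∞ :=
  ⨅ (A : ℝ≥0) (_ : ∀ a ∈ hardySpace p,
    dotHardyNorm q (paraproduct g a) ≤ (A : ℝ≥0∞) * hardyNorm p a), (A : ℝ≥0∞)

open scoped Classical in
/-- The norm of `BMO_d(ℝ ⊗ ℝ)`: the supremum of `(|Ω|⁻¹ ∑_{R ⊆ Ω} g_R²)^{1/2}` over all open sets
`Ω` of the plane with finite positive measure; it is `∞` when `g` is not in that space. -/
def bmoNorm (g : DyadicDistribution) : ℝ≥0∞ :=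
  ⨆ (Ω : Set (ℝ × ℝ)) (_ : IsOpen Ω) (_ : 0 < volume Ω) (_ : volume Ω < ∞),
    ((∑' R : DyadicRect, if rect R ⊆ Ω then ENNReal.ofReal (g R ^ 2) else 0) / volume Ω)
      ^ (1 / 2 : ℝ)

end BiDyadic

end

noncomputable section

namespace BiDyadic

/-! ### Geometric sums over dyadic levels -/

/-! Write M for the maximal function of the averages a_R = ⟨f⟩_R and S for the square function of g.
Both upper bounds use only |a_R| ≤ M(x) for x in R. In (I) this gives S(π_g f) ≤ M · S(g) pointwise,
and Hölder finishes. In (II) it enters through the Carleson embedding `tsum_ofReal_sq_mul_le`, Σ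
g_R² b_R ≲ ‖g‖²_BMO ∫ sup_{R∋x} b_R dx: for p > 2 with b_R = a_R² ⟨f⟩_R after dualising S(π_g f)²
against f in the dual exponent of p/2, for p ≤ 2 with the weight M^{p-2} in place of f.

The lower bounds come from testing on functions whose averages are bounded below on every rectangle
lying mostly in a given set A. For p > 1 the function χ_A serves. For p ≤ 1 the function M(χ_A) is
in general not p-integrable, and χ_A is replaced by a finite piece f of its Haar series
(`exists_isTest_of_lt_two`), over rectangles R with |R ∩ U| > |R|/2, where U = {M χ_A > e}. Since
Haar functions have mean zero on both sides, M f lives where M χ_U ≥ 1/2, a set of measure ≲ |A|, so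
the L² bound for M f yields an L^p bound. The energy thrown away is controlled by a discrete
Merryfield inequality (`sum_level_mul_diff_le`): it is ≲ e²|U|, and the maximal theorem in L^{3/2}
gives |U| ≲ e^{-3/2}|A|, hence a small multiple of |A|. So χ_A - f is small in L², and the averages
of f are at least 1/4 on the required rectangles, except those inside a small set B.

In (I) all level sets Ω_k = {S > 2^k} are tested at once, by Σ_k ±2^{kr/p} f_k. The f_k may cancel,
so the signs are chosen by averaging over all of them: for each rectangle at least half of the
choices give an average no smaller than the largest term (`exists_signs`). This bounds a weighted
square function V with weights ≳ 2^{kr/p} on the rectangles mostly inside Ω_k. Rectangles mostly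
outside Ω_k contribute little at the much greater height 2^{k+m} (`tsum_level_outside_le`), so for T
= Σ 2^{kr}|Ω_k| ≈ ‖S‖_r^r one gets T ≤ T/2 + C‖π_g‖^q T^{q/p}, and 1 - q/p = q/r.

In (II) one set U is tested. Chebyshev and duality bound the mass Σ_{R⊆U} g_R² by C‖π_g‖²|U| plus
the masses of two sets of measure at most |U|/4 (`exists_coeffMass_le_add`); this is absorbed as in
the John–Nirenberg argument. Both absorptions need a finite quantity, so they are carried out for
finitely supported truncations of g, with constants independent of the truncation. -/

lemma two_rpow_ne_zero (x : ℝ) : (2 : ℝ≥0∞) ^ x ≠ 0 := by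
  simp [ENNReal.rpow_eq_zero_iff]

lemma two_rpow_ne_top (x : ℝ) : (2 : ℝ≥0∞) ^ x ≠ ∞ := by
  simp [ENNReal.rpow_eq_top_iff]

lemma two_rpow_add (x y : ℝ) : (2 : ℝ≥0∞) ^ (x + y) = 2 ^ x * 2 ^ y :=
  ENNReal.rpow_add _ _ (by simp) (by simp)

lemma two_rpow_le {x y : ℝ} (h : x ≤ y) : (2 : ℝ≥0∞) ^ x ≤ 2 ^ y :=
  ENNReal.rpow_le_rpow_of_exponent_le (by simp) h

/-- The sum of the geometric series of ratio `2 ^ (-r)`. -/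
def geoConst (r : ℝ) : ℝ≥0∞ := (1 - (2 : ℝ≥0∞) ^ (-r))⁻¹

lemma geoConst_ne_zero (r : ℝ) : geoConst r ≠ 0 := by
  unfold geoConst
  simp only [ne_eq, ENNReal.inv_eq_zero]
  exact ne_top_of_le_ne_top ENNReal.one_ne_top tsub_le_self

lemma geoConst_ne_top {r : ℝ} (hr : 0 < r) : geoConst r ≠ ∞ := by
  unfold geoConst
  rw [ENNReal.inv_ne_top]
  have : (2 : ℝ≥0∞) ^ (-r) < 1 := ENNReal.rpow_lt_one_of_one_lt_of_neg (by simp) (by linarith)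
  exact (tsub_pos_of_lt this).ne'

lemma tsum_geo (c r : ℝ) :
    ∑' j : ℕ, (2 : ℝ≥0∞) ^ (c - j * r) = 2 ^ c * geoConst r := by
  unfold geoConst
  rw [← ENNReal.tsum_geometric, ← ENNReal.tsum_mul_left]
  congr 1; ext j
  rw [sub_eq_add_neg, two_rpow_add, ← ENNReal.rpow_natCast, ← ENNReal.rpow_mul]
  congr 2; ring

lemma exists_dyadic_level {y : ℝ≥0∞} (h0 : y ≠ 0) (ht : y ≠ ∞) :
    ∃ n : ℤ, (2 : ℝ≥0∞) ^ (n : ℝ) < y ∧ y ≤ 2 ^ ((n : ℝ) + 1) := by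
  obtain ⟨n, h1, h2⟩ := ENNReal.exists_mem_Ioc_zpow h0 ht (y := 2) (by simp) (by simp)
  refine ⟨n, ?_, ?_⟩
  · rwa [ENNReal.rpow_intCast]
  · have : ((n : ℝ) + 1) = ((n + 1 : ℤ) : ℝ) := by push_cast; ring
    rwa [this, ENNReal.rpow_intCast]

lemma two_rpow_int_lt {K n : ℤ} : (2 : ℝ≥0∞) ^ (K : ℝ) < 2 ^ (n : ℝ) ↔ K < n := by
  constructor
  · intro h
    by_contra hc
    exact absurd h (not_lt.2 (two_rpow_le (by exact_mod_cast not_lt.1 hc)))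
  · intro h
    exact ENNReal.rpow_lt_rpow_of_exponent_lt (by simp) (by simp) (by exact_mod_cast h)

lemma tsum_int_le_geo (n : ℤ) (r : ℝ) :
    ∑' K : ℤ, (if K ≤ n then (2 : ℝ≥0∞) ^ ((K : ℝ) * r) else 0)
        = 2 ^ ((n : ℝ) * r) * geoConst r := by
  have hinj : Function.Injective (fun j : ℕ => n - (j : ℤ)) := by
    intro a b h; simpa using h
  rw [← hinj.tsum_eq]
  · rw [← tsum_geo]
    congr 1; ext j
    rw [if_pos (by simp)]
    congr 1; push_cast; ring
  · intro K hK
    have : K ≤ n := by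
      by_contra h; simp [h] at hK
    exact ⟨(n - K).toNat, by simp; omega⟩

/-- A geometric sum is comparable to its largest term. With `rpow_le_tsum_level` as converse, this
turns integrals of powers into sums over the levels 2^K, a discrete layer-cake formula valid also
for the values 0 and ∞. -/
lemma tsum_level_lt_le {r : ℝ} (hr : 0 < r) (y : ℝ≥0∞) :
    ∑' K : ℤ, (if (2 : ℝ≥0∞) ^ (K : ℝ) < y then (2 : ℝ≥0∞) ^ ((K : ℝ) * r) else 0)
      ≤ geoConst r * y ^ r := by
  by_cases h0 : y = 0
  · simp [h0]
  by_cases ht : y = ∞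
  · rw [ht, ENNReal.top_rpow_of_pos hr, ENNReal.mul_top (geoConst_ne_zero r)]; exact le_top
  obtain ⟨n, h1, h2⟩ := exists_dyadic_level h0 ht
  calc _ ≤ ∑' K : ℤ, (if K ≤ n then (2 : ℝ≥0∞) ^ ((K : ℝ) * r) else 0) := by
        refine ENNReal.tsum_le_tsum fun K => ?_
        split_ifs with ha hb
        · exact le_rfl
        · exfalso
          have := ha.trans_le h2
          rw [show (n : ℝ) + 1 = ((n + 1 : ℤ) : ℝ) by push_cast; ring, two_rpow_int_lt] at this
          omega
        · exact zero_le
        · exact le_rfl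
    _ = 2 ^ ((n : ℝ) * r) * geoConst r := tsum_int_le_geo n r
    _ ≤ geoConst r * y ^ r := by
        rw [mul_comm, ENNReal.rpow_mul]
        gcongr

lemma tsum_le_level_le {d : ℝ} (y : ℝ≥0∞) (hd : 0 < d) :
    ∑' K : ℤ, (if y ≤ (2 : ℝ≥0∞) ^ (K : ℝ) then (2 : ℝ≥0∞) ^ (-((K : ℝ) * d)) else 0)
      ≤ geoConst d * y ^ (-d) := by
  by_cases h0 : y = 0
  · rw [h0, ENNReal.zero_rpow_of_neg (by linarith), ENNReal.mul_top (geoConst_ne_zero d)]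
    exact le_top
  by_cases ht : y = ∞
  · have : ∀ K : ℤ, ¬ y ≤ (2 : ℝ≥0∞) ^ (K : ℝ) := fun K => by
      rw [ht, top_le_iff]; exact two_rpow_ne_top _
    simp only [this, if_false, tsum_zero, zero_le]
  obtain ⟨n, h1, h2⟩ := exists_dyadic_level h0 ht
  calc _ ≤ ∑' K : ℤ, (if -K ≤ -(n + 1) then (2 : ℝ≥0∞) ^ (((-K : ℤ) : ℝ) * d) else 0) := by
        refine ENNReal.tsum_le_tsum fun K => ?_
        split_ifs with ha hb
        · rw [show ((-K : ℤ) : ℝ) * d = -((K : ℝ) * d) by push_cast; ring]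
        · exfalso
          have := h1.trans_le ha
          rw [two_rpow_int_lt] at this
          omega
        · exact zero_le
        · exact le_rfl
    _ = ∑' K : ℤ, (if K ≤ -(n + 1) then (2 : ℝ≥0∞) ^ ((K : ℝ) * d) else 0) :=
        (Equiv.neg ℤ).tsum_eq (fun K : ℤ => if K ≤ -(n + 1) then (2 : ℝ≥0∞) ^ ((K : ℝ) * d) else 0)
    _ = 2 ^ (((-(n + 1) : ℤ) : ℝ) * d) * geoConst d := tsum_int_le_geo _ _
    _ ≤ geoConst d * y ^ (-d) := by
        rw [mul_comm]
        gcongr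
        rw [show ((-(n + 1) : ℤ) : ℝ) * d = ((n : ℝ) + 1) * (-d) by push_cast; ring,
          ENNReal.rpow_mul, ENNReal.rpow_neg, ENNReal.rpow_neg]
        gcongr

lemma rpow_le_tsum_level {r : ℝ} (hr : 0 < r) (y : ℝ≥0∞) :
    y ^ r ≤ 2 ^ r *
      ∑' K : ℤ, (if (2 : ℝ≥0∞) ^ (K : ℝ) < y then (2 : ℝ≥0∞) ^ ((K : ℝ) * r) else 0) := by
  by_cases h0 : y = 0
  · simp [h0, hr]
  by_cases ht : y = ∞
  · have : ∑' K : ℤ, (if (2 : ℝ≥0∞) ^ (K : ℝ) < y then (2 : ℝ≥0∞) ^ ((K : ℝ) * r) else 0) = ∞ := by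
      rw [← top_le_iff]
      have hinj : Function.Injective (fun j : ℕ => (j : ℤ)) := fun a b h => by simpa using h
      calc (∞ : ℝ≥0∞) = ∑' j : ℕ, 1 := by simp
        _ ≤ ∑' j : ℕ, (fun K : ℤ => if (2 : ℝ≥0∞) ^ (K : ℝ) < y then
              (2 : ℝ≥0∞) ^ ((K : ℝ) * r) else 0) (j : ℤ) := by
            refine ENNReal.tsum_le_tsum fun j => ?_
            simp only [ht, two_rpow_ne_top, lt_top_iff_ne_top, ne_eq, not_false_eq_true, if_true]
            calc (1 : ℝ≥0∞) = 2 ^ (0 : ℝ) := by simp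
              _ ≤ _ := two_rpow_le (by positivity)
        _ ≤ _ := ENNReal.tsum_comp_le_tsum_of_injective hinj _
    rw [this, ENNReal.mul_top (two_rpow_ne_zero r)]
    exact le_top
  obtain ⟨n, h1, h2⟩ := exists_dyadic_level h0 ht
  calc y ^ r ≤ (2 ^ ((n : ℝ) + 1)) ^ r := by gcongr
    _ = 2 ^ r * 2 ^ ((n : ℝ) * r) := by
        rw [← ENNReal.rpow_mul, ← two_rpow_add]; congr 1; ring
    _ ≤ _ := by
        gcongr
        refine le_trans ?_ (ENNReal.le_tsum n)
        rw [if_pos h1]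

/-! ### Dyadic intervals and rectangles -/

lemma mem_dyadicInterval {x : ℝ} {I : ℤ × ℤ} :
    x ∈ dyadicInterval I ↔ ⌊x / (2 : ℝ) ^ I.1⌋ = I.2 := by
  have : (0 : ℝ) < (2 : ℝ) ^ I.1 := by positivity
  rw [Int.floor_eq_iff, dyadicInterval, Set.mem_Ico, le_div_iff₀ this, div_lt_iff₀ this]

lemma measurableSet_dyadicInterval (I : ℤ × ℤ) : MeasurableSet (dyadicInterval I) :=
  measurableSet_Ico

lemma volume_dyadicInterval (I : ℤ × ℤ) :
    volume (dyadicInterval I) = ENNReal.ofReal ((2 : ℝ) ^ I.1) := by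
  rw [dyadicInterval, Real.volume_Ico]; congr 1; ring

lemma volume_dyadicInterval_ne_zero (I : ℤ × ℤ) : volume (dyadicInterval I) ≠ 0 := by
  rw [volume_dyadicInterval]
  have : (0 : ℝ) < (2 : ℝ) ^ I.1 := by positivity
  simpa using this

lemma volume_dyadicInterval_ne_top (I : ℤ × ℤ) : volume (dyadicInterval I) ≠ ∞ := by
  rw [volume_dyadicInterval]; exact ENNReal.ofReal_ne_top

/-- Passing to the dyadic ancestor j generations up is integer division of the index by 2^j; the
nesting of dyadic intervals follows from this. -/
lemma floor_div_zpow_add (x : ℝ) (n : ℤ) (j : ℕ) :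
    ⌊x / (2 : ℝ) ^ (n + j)⌋ = ⌊x / (2 : ℝ) ^ n⌋ / (2 ^ j : ℕ) := by
  rw [← Int.floor_div_natCast, zpow_add₀ (by norm_num), zpow_natCast, div_div]
  push_cast; rfl

lemma dyadicInterval_subset {I I' : ℤ × ℤ} (h : I.1 ≤ I'.1) {x : ℝ}
    (hx : x ∈ dyadicInterval I) (hx' : x ∈ dyadicInterval I') :
    dyadicInterval I ⊆ dyadicInterval I' := by
  obtain ⟨n, k⟩ := I
  obtain ⟨n', k'⟩ := I'
  obtain ⟨j, rfl⟩ := Int.le.dest h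
  intro z hz
  rw [mem_dyadicInterval] at *
  simp only at *
  rw [floor_div_zpow_add] at *
  rw [hz, ← hx, hx']

lemma dyadicInterval_nonempty (I : ℤ × ℤ) : (dyadicInterval I).Nonempty := by
  rw [Set.nonempty_iff_ne_empty]
  intro h
  exact volume_dyadicInterval_ne_zero I (by simp [h])

lemma fst_le_of_subset {I I' : ℤ × ℤ} (h : dyadicInterval I ⊆ dyadicInterval I') :
    I.1 ≤ I'.1 := by
  have := measure_mono (μ := volume) h
  rw [volume_dyadicInterval, volume_dyadicInterval, ENNReal.ofReal_le_ofReal_iff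
      (by positivity)] at this
  exact (zpow_le_zpow_iff_right₀ (by norm_num)).1 this

lemma dyadicInterval_eq_of_fst_eq {I I' : ℤ × ℤ} (h : I.1 = I'.1) {x : ℝ}
    (hx : x ∈ dyadicInterval I) (hx' : x ∈ dyadicInterval I') : I = I' := by
  rw [mem_dyadicInterval] at *
  refine Prod.ext h ?_
  rw [← hx, ← hx', h]

lemma measurableSet_rect (R : DyadicRect) : MeasurableSet (rect R) :=
  (measurableSet_dyadicInterval _).prod (measurableSet_dyadicInterval _)

lemma volume_rect (R : DyadicRect) :
    volume (rect R) = volume (dyadicInterval R.1) * volume (dyadicInterval R.2) := by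
  rw [rect, Measure.volume_eq_prod, Measure.prod_prod]

lemma volume_rect_ne_zero (R : DyadicRect) : volume (rect R) ≠ 0 := by
  rw [volume_rect]
  exact mul_ne_zero (volume_dyadicInterval_ne_zero _) (volume_dyadicInterval_ne_zero _)

lemma volume_rect_ne_top (R : DyadicRect) : volume (rect R) ≠ ∞ := by
  rw [volume_rect]
  exact ENNReal.mul_ne_top (volume_dyadicInterval_ne_top _) (volume_dyadicInterval_ne_top _)

/-! ### The one-parameter dyadic maximal function -/

/-- The dyadic maximal function on the line. -/
def intervalMax (f : ℝ → ℝ≥0∞) (x : ℝ) : ℝ≥0∞ :=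
  ⨆ (I : ℤ × ℤ) (_ : x ∈ dyadicInterval I),
    (∫⁻ y in dyadicInterval I, f y) / volume (dyadicInterval I)

lemma iSup_mem_eq_indicator {α ι : Type*} (s : ι → Set α) (c : ι → ℝ≥0∞) (x : α) :
    (⨆ (i : ι) (_ : x ∈ s i), c i) = ⨆ i, (s i).indicator (fun _ => c i) x := by
  refine iSup_congr fun i => ?_
  by_cases h : x ∈ s i <;> simp [h]

lemma measurable_intervalMax (f : ℝ → ℝ≥0∞) : Measurable (intervalMax f) := by
  have : intervalMax f = fun x => ⨆ I : ℤ × ℤ, (dyadicInterval I).indicator (fun _ =>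
      (∫⁻ y in dyadicInterval I, f y) / volume (dyadicInterval I)) x := by
    ext x; exact iSup_mem_eq_indicator _ _ x
  rw [this]
  exact Measurable.iSup fun I => measurable_const.indicator (measurableSet_dyadicInterval I)

/-- The inclusion-maximal members of `F` do it: two dyadic intervals are nested or disjoint, so
distinct maximal ones cannot meet. -/
lemma exists_disjoint_subfamily (F : Finset (ℤ × ℤ)) :
    ∃ G ⊆ F, (G : Set (ℤ × ℤ)).PairwiseDisjoint dyadicInterval ∧
      (⋃ I ∈ F, dyadicInterval I) ⊆ ⋃ I ∈ G, dyadicInterval I := by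
  classical
  refine ⟨F.filter fun I => ∀ I' ∈ F, dyadicInterval I ⊆ dyadicInterval I' → I' = I,
    Finset.filter_subset _ _, ?_, ?_⟩
  · intro I hI I' hI' hne
    simp only [Finset.coe_filter, Set.mem_ofPred_eq] at hI hI'
    rw [Function.onFun, Set.disjoint_left]
    intro x hx hx'
    rcases le_total I.1 I'.1 with h | h
    · exact hne (hI.2 I' hI'.1 (dyadicInterval_subset h hx hx')).symm
    · exact hne (hI'.2 I hI.1 (dyadicInterval_subset h hx' hx))
  · intro x hx
    simp only [Set.mem_iUnion, exists_prop] at hx ⊢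
    obtain ⟨I, hI, hxI⟩ := hx
    obtain ⟨J, hJ, hmax⟩ := Finset.exists_maximalFor Prod.fst
      (F.filter fun I' => dyadicInterval I ⊆ dyadicInterval I') ⟨I, by simp [hI]⟩
    simp only [Finset.mem_filter] at hJ hmax
    refine ⟨J, ?_, hJ.2 hxI⟩
    simp only [Finset.mem_filter]
    refine ⟨hJ.1, fun I' hI' hs => ?_⟩
    have h1 := hmax ⟨hI', hJ.2.trans hs⟩ (fst_le_of_subset hs)
    exact dyadicInterval_eq_of_fst_eq (le_antisymm h1 (fst_le_of_subset hs))
      (hs (hJ.2 hxI)) (hJ.2 hxI)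

lemma mul_volume_biUnion_le (f : ℝ → ℝ≥0∞) (c : ℝ≥0∞) (F : Finset (ℤ × ℤ))
    (hF : ∀ I ∈ F, c * volume (dyadicInterval I) ≤ ∫⁻ y in dyadicInterval I, f y) :
    c * volume (⋃ I ∈ F, dyadicInterval I) ≤ ∫⁻ y, f y := by
  obtain ⟨G, hGF, hdisj, hcov⟩ := exists_disjoint_subfamily F
  calc c * volume (⋃ I ∈ F, dyadicInterval I) ≤ c * volume (⋃ I ∈ G, dyadicInterval I) := by
        gcongr
    _ = ∑ I ∈ G, c * volume (dyadicInterval I) := by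
        rw [measure_biUnion_finset hdisj fun I _ => measurableSet_dyadicInterval I, Finset.mul_sum]
    _ ≤ ∑ I ∈ G, ∫⁻ y in dyadicInterval I, f y := Finset.sum_le_sum fun I hI => hF I (hGF hI)
    _ = ∫⁻ y in ⋃ I ∈ G, dyadicInterval I, f y :=
        (lintegral_biUnion_finset hdisj (fun I _ => measurableSet_dyadicInterval I) f).symm
    _ ≤ ∫⁻ y, f y := setLIntegral_le_lintegral _ _

lemma volume_biUnion_eq_iSup {α ι : Type*} [MeasurableSpace α] (μ : Measure α) [Countable ι]
    (s : ι → Set α) : μ (⋃ i, s i) = ⨆ F : Finset ι, μ (⋃ i ∈ F, s i) := by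
  rw [Set.iUnion_eq_iUnion_finset]
  refine Directed.measure_iUnion ?_
  refine Monotone.directed_le fun F G hFG => ?_
  exact Set.biUnion_subset_biUnion_left hFG

lemma mul_volume_intervalMax_le (f : ℝ → ℝ≥0∞) (c : ℝ≥0∞) :
    c * volume {x | c < intervalMax f x} ≤ ∫⁻ y, f y := by
  set A : Set (ℤ × ℤ) := {I | c < (∫⁻ y in dyadicInterval I, f y) / volume (dyadicInterval I)}
  have hset : {x | c < intervalMax f x} = ⋃ I : A, dyadicInterval I := by
    ext x
    simp only [intervalMax, Set.mem_ofPred_eq, lt_iSup_iff, Set.mem_iUnion, A, Subtype.exists,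
      exists_prop]
    exact ⟨fun ⟨I, h1, h2⟩ => ⟨I, h2, h1⟩, fun ⟨I, h1, h2⟩ => ⟨I, h2, h1⟩⟩
  -- An infinite family need not have maximal intervals (`f` is arbitrary), so the union is
  -- exhausted by finite subfamilies.
  rw [hset, volume_biUnion_eq_iSup, ENNReal.mul_iSup]
  refine iSup_le fun F => ?_
  have := mul_volume_biUnion_le f c (F.map ⟨Subtype.val, Subtype.val_injective⟩) (by
    intro I hI
    simp only [Finset.mem_map, Function.Embedding.coeFn_mk] at hI
    obtain ⟨J, _, rfl⟩ := hI
    have := J.2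
    simp only [A, Set.mem_ofPred_eq] at this
    exact (ENNReal.le_div_iff_mul_le (Or.inl (volume_dyadicInterval_ne_zero _))
      (Or.inl (volume_dyadicInterval_ne_top _))).1 this.le)
  simpa using this

lemma intervalMax_add_le (f g : ℝ → ℝ≥0∞) (hf : Measurable f) (x : ℝ) :
    intervalMax (fun y => f y + g y) x ≤ intervalMax f x + intervalMax g x := by
  refine iSup₂_le fun I hI => ?_
  rw [lintegral_add_left hf, ENNReal.add_div]
  exact add_le_add (le_iSup₂_of_le I hI le_rfl) (le_iSup₂_of_le I hI le_rfl)

lemma intervalMax_const_le (c : ℝ≥0∞) {f : ℝ → ℝ≥0∞} (hf : ∀ y, f y ≤ c) (x : ℝ) :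
    intervalMax f x ≤ c := by
  refine iSup₂_le fun I _ => ENNReal.div_le_of_le_mul ?_
  calc ∫⁻ y in dyadicInterval I, f y ≤ ∫⁻ _ in dyadicInterval I, c := lintegral_mono hf
    _ = _ := by simp

/-- The weak type estimate, localised to the points where `f` is large. -/
lemma mul_volume_intervalMax_le_lintegral_indicator {f : ℝ → ℝ≥0∞} (hf : Measurable f)
    {c : ℝ≥0∞} :
    c * volume {x | c + c < intervalMax f x} ≤ ∫⁻ y, {y | c < f y}.indicator f y := by
  refine le_trans ?_ (mul_volume_intervalMax_le _ c)
  refine mul_le_mul_right (measure_mono fun x hx => ?_) c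
  have hms : MeasurableSet {y | c < f y} := measurableSet_lt measurable_const hf
  have hsplit : f = fun y => {y | c < f y}.indicator f y + {y | c < f y}ᶜ.indicator f y := by
    ext y; exact (Set.indicator_self_add_compl_apply _ f y).symm
  have h1 : intervalMax f x ≤ intervalMax ({y | c < f y}.indicator f) x + c := by
    conv_lhs => rw [hsplit]
    refine (intervalMax_add_le _ _ (hf.indicator hms) x).trans ?_
    gcongr
    refine intervalMax_const_le c (fun y => ?_) x
    by_cases hy : c < f y
    · simp [hy]
    · simp only [Set.indicator, Set.mem_compl_iff, Set.mem_ofPred_eq,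
          hy, not_false_eq_true, if_true]
      exact not_lt.1 hy
  have h2 : c + c < _ := lt_of_lt_of_le hx h1
  exact lt_of_add_lt_add_right h2

/-- The constant in the `L^s` inequality for the dyadic maximal function on the line. -/
def maxConst (s : ℝ) : ℝ≥0∞ := 2 ^ s * 2 ^ s * geoConst (s - 1)

lemma maxConst_ne_top {s : ℝ} (hs : 1 < s) : maxConst s ≠ ∞ :=
  ENNReal.mul_ne_top (ENNReal.mul_ne_top (two_rpow_ne_top _) (two_rpow_ne_top _))
    (geoConst_ne_top (by linarith))

lemma lintegral_rpow_le_tsum {α : Type*} [MeasurableSpace α] {μ : Measure α} {f : α → ℝ≥0∞}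
    (hf : Measurable f) {r : ℝ} (hr : 0 < r) :
    ∫⁻ x, f x ^ r ∂μ ≤
      2 ^ r * ∑' K : ℤ, 2 ^ ((K : ℝ) * r) * μ {x | (2 : ℝ≥0∞) ^ (K : ℝ) < f x} := by
  have hms : ∀ K : ℤ, MeasurableSet {x | (2 : ℝ≥0∞) ^ (K : ℝ) < f x} := fun K =>
    measurableSet_lt measurable_const hf
  calc ∫⁻ x, f x ^ r ∂μ ≤ ∫⁻ x, 2 ^ r * ∑' K : ℤ, {x | (2 : ℝ≥0∞) ^ (K : ℝ) < f x}.indicator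
        (fun _ => (2 : ℝ≥0∞) ^ ((K : ℝ) * r)) x ∂μ := by
        refine lintegral_mono fun x => (rpow_le_tsum_level hr (f x)).trans (le_of_eq ?_)
        simp only [Set.indicator, Set.mem_ofPred_eq]
    _ = _ := by
        rw [lintegral_const_mul' _ _ (two_rpow_ne_top r),
          lintegral_tsum fun K => (measurable_const.indicator (hms K)).aemeasurable]
        congr 2; ext K
        rw [lintegral_indicator_const (hms K)]

lemma tsum_level_measure_le {α : Type*} [MeasurableSpace α] {μ : Measure α} {f : α → ℝ≥0∞}
    (hf : Measurable f) {r : ℝ} (hr : 0 < r) :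
    ∑' K : ℤ, 2 ^ ((K : ℝ) * r) * μ {x | (2 : ℝ≥0∞) ^ (K : ℝ) < f x} ≤
      geoConst r * ∫⁻ x, f x ^ r ∂μ := by
  have hms : ∀ K : ℤ, MeasurableSet {x | (2 : ℝ≥0∞) ^ (K : ℝ) < f x} := fun K =>
    measurableSet_lt measurable_const hf
  calc _ = ∫⁻ x, ∑' K : ℤ, {x | (2 : ℝ≥0∞) ^ (K : ℝ) < f x}.indicator
        (fun _ => (2 : ℝ≥0∞) ^ ((K : ℝ) * r)) x ∂μ := by
        rw [lintegral_tsum fun K => (measurable_const.indicator (hms K)).aemeasurable]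
        congr 1; ext K
        rw [lintegral_indicator_const (hms K)]
    _ ≤ ∫⁻ x, geoConst r * f x ^ r ∂μ := by
        refine lintegral_mono fun x => le_trans (le_of_eq ?_) (tsum_level_lt_le hr (f x))
        simp only [Set.indicator, Set.mem_ofPred_eq]
    _ = _ := lintegral_const_mul' _ _ (geoConst_ne_top hr)

/-- Marcinkiewicz interpolation between weak L¹ and L^∞: sum the localised weak type estimate over
the levels 2^K, each with threshold 2^{K-1} for `f`. The inner sum behaves like f^{s-1}, which is
where s > 1 is needed. -/
lemma lintegral_intervalMax_rpow_le {s : ℝ} (hs : 1 < s) {f : ℝ → ℝ≥0∞} (hf : Measurable f) :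
    ∫⁻ x, intervalMax f x ^ s ≤ maxConst s * ∫⁻ x, f x ^ s := by
  have hms : ∀ c : ℝ≥0∞, MeasurableSet {x | c < f x} := fun c =>
    measurableSet_lt measurable_const hf
  have key : ∀ K : ℤ, (2 : ℝ≥0∞) ^ ((K : ℝ) * s) *
      volume {x | (2 : ℝ≥0∞) ^ (K : ℝ) < intervalMax f x} ≤
      ∫⁻ y, 2 ^ s * (if (2 : ℝ≥0∞) ^ (((K - 1 : ℤ)) : ℝ) < f y then
        2 ^ (((K - 1 : ℤ) : ℝ) * (s - 1)) else 0) * f y := by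
    intro K
    have h1 := mul_volume_intervalMax_le_lintegral_indicator hf (c := 2 ^ ((K - 1 : ℤ) : ℝ))
    have h2 : (2 : ℝ≥0∞) ^ ((K - 1 : ℤ) : ℝ) + 2 ^ ((K - 1 : ℤ) : ℝ) = 2 ^ (K : ℝ) := by
      rw [← two_mul]
      conv_lhs => rw [show (2 : ℝ≥0∞) * 2 ^ ((K - 1 : ℤ) : ℝ) = 2 ^ (1 : ℝ) * 2 ^ ((K - 1 : ℤ) : ℝ)
        by rw [ENNReal.rpow_one], ← two_rpow_add]
      congr 1; push_cast; ring
    rw [h2] at h1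
    have h3 : (2 : ℝ≥0∞) ^ ((K : ℝ) * s) = 2 ^ s * 2 ^ (((K - 1 : ℤ) : ℝ) * (s - 1)) *
        2 ^ ((K - 1 : ℤ) : ℝ) := by
      rw [← two_rpow_add, ← two_rpow_add]; congr 1; push_cast; ring
    rw [h3, mul_assoc]
    calc _ ≤ 2 ^ s * 2 ^ (((K - 1 : ℤ) : ℝ) * (s - 1)) *
          ∫⁻ y, {y | (2 : ℝ≥0∞) ^ ((K - 1 : ℤ) : ℝ) < f y}.indicator f y := by gcongr
      _ = ∫⁻ y, 2 ^ s * 2 ^ (((K - 1 : ℤ) : ℝ) * (s - 1)) *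
          {y | (2 : ℝ≥0∞) ^ ((K - 1 : ℤ) : ℝ) < f y}.indicator f y :=
          (lintegral_const_mul' _ _ (ENNReal.mul_ne_top (two_rpow_ne_top _)
            (two_rpow_ne_top _))).symm
      _ = _ := by
          congr 1; ext y
          by_cases hy : (2 : ℝ≥0∞) ^ ((K - 1 : ℤ) : ℝ) < f y
          · rw [Set.indicator_of_mem (by exact hy), if_pos hy]
          · rw [Set.indicator_of_notMem (by exact hy), if_neg hy]; simp
  calc ∫⁻ x, intervalMax f x ^ s ≤ 2 ^ s * ∑' K : ℤ, 2 ^ ((K : ℝ) * s) *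
        volume {x | (2 : ℝ≥0∞) ^ (K : ℝ) < intervalMax f x} :=
        lintegral_rpow_le_tsum (measurable_intervalMax f) (by linarith)
    _ ≤ 2 ^ s * ∑' K : ℤ, ∫⁻ y, 2 ^ s * (if (2 : ℝ≥0∞) ^ (((K - 1 : ℤ)) : ℝ) < f y then
        2 ^ (((K - 1 : ℤ) : ℝ) * (s - 1)) else 0) * f y := by
        gcongr with K; exact key K
    _ = 2 ^ s * ∫⁻ y, ∑' K : ℤ, 2 ^ s * (if (2 : ℝ≥0∞) ^ (((K - 1 : ℤ)) : ℝ) < f y then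
        2 ^ (((K - 1 : ℤ) : ℝ) * (s - 1)) else 0) * f y := by
        rw [lintegral_tsum]
        intro K
        refine Measurable.aemeasurable (Measurable.mul (Measurable.const_mul ?_ _) hf)
        exact Measurable.ite (hms _) measurable_const measurable_const
    _ ≤ 2 ^ s * ∫⁻ y, (2 ^ s * geoConst (s - 1)) * f y ^ s := by
        gcongr with y
        rw [ENNReal.tsum_mul_right, ENNReal.tsum_mul_left]
        have e := (Equiv.subRight (1 : ℤ)).tsum_eq (fun K : ℤ =>
          if (2 : ℝ≥0∞) ^ (K : ℝ) < f y then (2 : ℝ≥0∞) ^ ((K : ℝ) * (s - 1)) else 0)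
        simp only [Equiv.subRight_apply] at e
        rw [e]
        calc _ ≤ 2 ^ s * (geoConst (s - 1) * f y ^ (s - 1)) * f y := by
              gcongr; exact tsum_level_lt_le (by linarith) _
          _ = 2 ^ s * geoConst (s - 1) * (f y ^ (s - 1) * f y ^ (1 : ℝ)) := by
              rw [ENNReal.rpow_one]; ring
          _ = _ := by
              rw [← ENNReal.rpow_add_of_nonneg _ _ (by linarith) zero_le_one, sub_add_cancel]
    _ = _ := by
        rw [lintegral_const_mul' _ _ (ENNReal.mul_ne_top (two_rpow_ne_top _)
          (geoConst_ne_top (by linarith)))]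
        unfold maxConst; ring

/-! ### The strong dyadic maximal function -/

/-- The bi-parameter dyadic maximal function of a nonnegative function. -/
def strongMax (f : ℝ × ℝ → ℝ≥0∞) (x : ℝ × ℝ) : ℝ≥0∞ :=
  ⨆ (R : DyadicRect) (_ : x ∈ rect R), (∫⁻ y in rect R, f y) / volume (rect R)

lemma measurable_iSup_rect (c : DyadicRect → ℝ≥0∞) :
    Measurable fun x => ⨆ (R : DyadicRect) (_ : x ∈ rect R), c R := by
  simp_rw [iSup_mem_eq_indicator]
  exact Measurable.iSup fun R => measurable_const.indicator (measurableSet_rect R)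

lemma measurable_strongMax (f : ℝ × ℝ → ℝ≥0∞) : Measurable (strongMax f) :=
  measurable_iSup_rect _

lemma measurable_maximal (a : DyadicRect → ℝ) : Measurable (maximal a) :=
  measurable_iSup_rect _

lemma measurable_intervalMax_snd {f : ℝ × ℝ → ℝ≥0∞} (hf : Measurable f) :
    Measurable fun z : ℝ × ℝ => intervalMax (fun y => f (z.1, y)) z.2 := by
  unfold intervalMax
  simp_rw [iSup_mem_eq_indicator]
  refine Measurable.iSup fun I => ?_
  have : (fun z : ℝ × ℝ => (dyadicInterval I).indicator (fun _ =>
      (∫⁻ y in dyadicInterval I, f (z.1, y)) / volume (dyadicInterval I)) z.2) =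
      (Prod.snd ⁻¹' dyadicInterval I).indicator (fun z : ℝ × ℝ =>
      (∫⁻ y in dyadicInterval I, f (z.1, y)) / volume (dyadicInterval I)) := by
    ext z
    by_cases h : z.2 ∈ dyadicInterval I
    · rw [Set.indicator_of_mem h, Set.indicator_of_mem ((Set.mem_preimage (f := Prod.snd)).2 h)]
    · rw [Set.indicator_of_notMem h, Set.indicator_of_notMem (fun h' => h (Set.mem_preimage.1 h'))]
  rw [this]
  refine Measurable.indicator ?_ (measurable_snd (measurableSet_dyadicInterval I))
  refine Measurable.div_const ?_ _
  exact (Measurable.lintegral_prod_right' hf).comp measurable_fst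

lemma measurable_intervalMax_fst {f : ℝ × ℝ → ℝ≥0∞} (hf : Measurable f) :
    Measurable fun z : ℝ × ℝ => intervalMax (fun x => f (x, z.2)) z.1 :=
  (measurable_intervalMax_snd (f := fun z => f z.swap) (hf.comp measurable_swap)).comp
    measurable_swap

lemma setLIntegral_rect (R : DyadicRect) {f : ℝ × ℝ → ℝ≥0∞} (hf : Measurable f) :
    ∫⁻ z in rect R, f z =
      ∫⁻ x in dyadicInterval R.1, ∫⁻ y in dyadicInterval R.2, f (x, y) := by
  rw [rect, Measure.volume_eq_prod, ← Measure.prod_restrict, lintegral_prod _ hf.aemeasurable]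

/-- An average over I × J is an average over I of averages over J. Iterating the one-parameter
theorem with Fubini then gives the bi-parameter one. -/
lemma strongMax_le {f : ℝ × ℝ → ℝ≥0∞} (hf : Measurable f) (z : ℝ × ℝ) :
    strongMax f z ≤ intervalMax (fun x => intervalMax (fun y => f (x, y)) z.2) z.1 := by
  refine iSup₂_le fun R hR => ?_
  refine le_iSup₂_of_le R.1 hR.1 ?_
  rw [setLIntegral_rect R hf, volume_rect]
  have h0 := volume_dyadicInterval_ne_zero R.2
  have ht := volume_dyadicInterval_ne_top R.2
  calc (∫⁻ x in dyadicInterval R.1, ∫⁻ y in dyadicInterval R.2, f (x, y)) /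
        (volume (dyadicInterval R.1) * volume (dyadicInterval R.2))
      ≤ (∫⁻ x in dyadicInterval R.1, intervalMax (fun y => f (x, y)) z.2 *
          volume (dyadicInterval R.2)) /
        (volume (dyadicInterval R.1) * volume (dyadicInterval R.2)) := by
        gcongr with x
        rw [← ENNReal.div_le_iff h0 ht]
        exact le_iSup₂_of_le R.2 hR.2 le_rfl
    _ = _ := by
        rw [lintegral_mul_const' _ _ ht, ENNReal.mul_div_mul_right _ _ h0 ht]

lemma lintegral_strongMax_rpow_le {s : ℝ} (hs : 1 < s) {f : ℝ × ℝ → ℝ≥0∞} (hf : Measurable f) :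
    ∫⁻ z, strongMax f z ^ s ≤ maxConst s * (maxConst s * ∫⁻ z, f z ^ s) := by
  have hm2 := measurable_intervalMax_snd hf
  have hm1 := measurable_intervalMax_fst hm2
  have hc := maxConst_ne_top hs
  have h1 : ∀ y, ∫⁻ x, intervalMax (fun x => intervalMax (fun y => f (x, y)) y) x ^ s ≤
      maxConst s * ∫⁻ x, intervalMax (fun y => f (x, y)) y ^ s := fun y =>
    lintegral_intervalMax_rpow_le hs (hm2.comp (measurable_id.prodMk measurable_const))
  have h2 : ∀ x, ∫⁻ y, intervalMax (fun y => f (x, y)) y ^ s ≤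
      maxConst s * ∫⁻ y, f (x, y) ^ s := fun x =>
    lintegral_intervalMax_rpow_le hs (hf.comp (measurable_const.prodMk measurable_id))
  have h3 : ∫⁻ y, ∫⁻ x, intervalMax (fun y => f (x, y)) y ^ s =
      ∫⁻ z : ℝ × ℝ, intervalMax (fun y => f (z.1, y)) z.2 ^ s := by
    rw [Measure.volume_eq_prod, lintegral_prod_symm _ (hm2.pow_const s).aemeasurable]
  have h4 : ∫⁻ z : ℝ × ℝ, intervalMax (fun y => f (z.1, y)) z.2 ^ s =
      ∫⁻ x, ∫⁻ y, intervalMax (fun y => f (x, y)) y ^ s := by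
    rw [Measure.volume_eq_prod, lintegral_prod _ (hm2.pow_const s).aemeasurable]
  calc ∫⁻ z, strongMax f z ^ s
      ≤ ∫⁻ z : ℝ × ℝ, intervalMax (fun x => intervalMax (fun y => f (x, y)) z.2) z.1 ^ s := by
        refine lintegral_mono fun z => ENNReal.rpow_le_rpow (strongMax_le hf z) (by linarith)
    _ = ∫⁻ y, ∫⁻ x, intervalMax (fun x => intervalMax (fun y => f (x, y)) y) x ^ s := by
        rw [Measure.volume_eq_prod, lintegral_prod_symm _ (hm1.pow_const s).aemeasurable]
    _ ≤ ∫⁻ y, maxConst s * ∫⁻ x, intervalMax (fun y => f (x, y)) y ^ s := lintegral_mono h1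
    _ = maxConst s * ∫⁻ x, ∫⁻ y, intervalMax (fun y => f (x, y)) y ^ s := by
        rw [lintegral_const_mul' _ _ hc, h3, h4]
    _ ≤ maxConst s * ∫⁻ x, maxConst s * ∫⁻ y, f (x, y) ^ s := by
        gcongr with x
        exact h2 x
    _ = _ := by
        rw [lintegral_const_mul' _ _ hc, Measure.volume_eq_prod,
          lintegral_prod _ (hf.pow_const s).aemeasurable]

/-! ### Superpositions of normalised indicators of rectangles -/

/-- The function `∑_R c_R χ_R / |R|`. -/
def rectSum (c : DyadicRect → ℝ≥0∞) (x : ℝ × ℝ) : ℝ≥0∞ :=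
  ∑' R : DyadicRect, (rect R).indicator (fun _ => c R / volume (rect R)) x

lemma measurable_rectSum (c : DyadicRect → ℝ≥0∞) : Measurable (rectSum c) :=
  Measurable.tsum fun R => measurable_const.indicator (measurableSet_rect R)

lemma rectSum_mono {c d : DyadicRect → ℝ≥0∞} (h : ∀ R, c R ≤ d R) (x : ℝ × ℝ) :
    rectSum c x ≤ rectSum d x := by
  refine ENNReal.tsum_le_tsum fun R => Set.indicator_le_indicator ?_
  gcongr
  exact h R

lemma rectSum_add (c d : DyadicRect → ℝ≥0∞) (x : ℝ × ℝ) :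
    rectSum (fun R => c R + d R) x = rectSum c x + rectSum d x := by
  unfold rectSum
  rw [← ENNReal.tsum_add]
  congr 1; ext R
  by_cases h : x ∈ rect R <;> simp [h, ENNReal.add_div]

lemma rectSum_const_mul (k : ℝ≥0∞) (c : DyadicRect → ℝ≥0∞) (x : ℝ × ℝ) :
    rectSum (fun R => k * c R) x = k * rectSum c x := by
  unfold rectSum
  rw [← ENNReal.tsum_mul_left]
  congr 1; ext R
  by_cases h : x ∈ rect R <;> simp [h, mul_div_assoc]

lemma rectSum_eq_zero {c : DyadicRect → ℝ≥0∞} {x : ℝ × ℝ} (h : ∀ R, x ∈ rect R → c R = 0) :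
    rectSum c x = 0 := by
  unfold rectSum
  rw [ENNReal.tsum_eq_zero]
  intro R
  by_cases hx : x ∈ rect R
  · simp [h R hx]
  · simp [hx]

lemma rectSum_le_of_mem {c d : DyadicRect → ℝ≥0∞} {x : ℝ × ℝ} (h : ∀ R, x ∈ rect R → c R ≤ d R) :
    rectSum c x ≤ rectSum d x := by
  refine ENNReal.tsum_le_tsum fun R => ?_
  by_cases hx : x ∈ rect R
  · simp only [Set.indicator_of_mem hx]
    gcongr
    exact h R hx
  · simp [hx]

/-- Tonelli. Pairing a squared square function with `f` gives coefficients times averages of `f`, to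
which the Carleson embedding or the maximal function applies. -/
lemma lintegral_rectSum_mul (c : DyadicRect → ℝ≥0∞) {f : ℝ × ℝ → ℝ≥0∞} (hf : Measurable f) :
    ∫⁻ x, rectSum c x * f x = ∑' R, c R * ((∫⁻ x in rect R, f x) / volume (rect R)) := by
  simp_rw [rectSum, ← ENNReal.tsum_mul_right]
  rw [lintegral_tsum fun R => Measurable.aemeasurable (f := fun x =>
    (rect R).indicator (fun _ => c R / volume (rect R)) x * f x)
    ((measurable_const.indicator (measurableSet_rect R)).mul hf)]
  congr 1; ext R
  have : ∀ x, (rect R).indicator (fun _ => c R / volume (rect R)) x * f x =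
      (rect R).indicator (fun x => c R / volume (rect R) * f x) x := fun x => by
    by_cases h : x ∈ rect R <;> simp [h]
  simp_rw [this]
  rw [lintegral_indicator (measurableSet_rect R), lintegral_const_mul _ hf,
    ENNReal.div_eq_inv_mul, ENNReal.div_eq_inv_mul]
  ring

lemma squareFn_eq (g : DyadicDistribution) (x : ℝ × ℝ) :
    squareFn g x = rectSum (fun R => ENNReal.ofReal (g R ^ 2)) x ^ (1 / 2 : ℝ) := rfl

lemma measurable_squareFn (g : DyadicDistribution) : Measurable (squareFn g) :=
  (measurable_rectSum _).pow_const _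

lemma eLpNorm_eq_lintegral {p : ℝ} (hp : 0 < p) (f : ℝ × ℝ → ℝ≥0∞) :
    eLpNorm f (ENNReal.ofReal p) volume = (∫⁻ x, f x ^ p) ^ (1 / p) := by
  rw [eLpNorm_eq_lintegral_rpow_enorm_toReal (by simpa using hp) ENNReal.ofReal_ne_top,
    ENNReal.toReal_ofReal hp.le]
  simp

lemma hardyNorm_eq {p : ℝ} (hp : 0 < p) (a : DyadicRect → ℝ) :
    hardyNorm p a = (∫⁻ x, maximal a x ^ p) ^ (1 / p) := eLpNorm_eq_lintegral hp _

lemma squareFn_rpow (g : DyadicDistribution) (p : ℝ) (x : ℝ × ℝ) :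
    squareFn g x ^ p = rectSum (fun R => ENNReal.ofReal (g R ^ 2)) x ^ (p / 2) := by
  rw [squareFn_eq, ← ENNReal.rpow_mul]; congr 1; ring

lemma dotHardyNorm_eq {p : ℝ} (hp : 0 < p) (g : DyadicDistribution) :
    dotHardyNorm p g =
      (∫⁻ x, rectSum (fun R => ENNReal.ofReal (g R ^ 2)) x ^ (p / 2)) ^ (1 / p) := by
  rw [dotHardyNorm, eLpNorm_eq_lintegral hp]
  simp_rw [squareFn_rpow]

lemma ofReal_abs_le_maximal (a : DyadicRect → ℝ) {x : ℝ × ℝ} {R : DyadicRect} (h : x ∈ rect R) :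
    ENNReal.ofReal |a R| ≤ maximal a x :=
  le_iSup₂_of_le R h le_rfl

lemma ofReal_mul_sq (u v : ℝ) :
    ENNReal.ofReal ((u * v) ^ 2) = ENNReal.ofReal (u ^ 2) * ENNReal.ofReal |v| ^ 2 := by
  rw [← ENNReal.ofReal_pow (abs_nonneg v), sq_abs, ← ENNReal.ofReal_mul (sq_nonneg u), mul_pow]

/-! ### Duality -/

/-- The converse of Hölder's inequality, proved by testing with powers of `G` itself. -/
lemma lintegral_rpow_le_of_dual {G : ℝ × ℝ → ℝ≥0∞} (hG : Measurable G) {s s' : ℝ}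
    (hs : s.HolderConjugate s') (K : ℝ≥0∞)
    (h : ∀ f : ℝ × ℝ → ℝ≥0∞, Measurable f →
      ∫⁻ x, G x * f x ≤ K * (∫⁻ x, f x ^ s') ^ (1 / s')) :
    ∫⁻ x, G x ^ s ≤ K ^ s := by
  have hs0 : 0 < s := hs.pos
  have hs1 : 1 < s := hs.lt
  set B := spanningSets (volume : Measure (ℝ × ℝ))
  -- Truncation in height and to a set of finite measure makes the integral `T` below finite, so
  -- that a power of it can be divided out.
  set Gn : ℕ → ℝ × ℝ → ℝ≥0∞ := fun n => (B n).indicator fun x => min (G x) n with hGn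
  have hmeas : ∀ n, Measurable (Gn n) := fun n =>
    (hG.min measurable_const).indicator (measurableSet_spanningSets _ n)
  have hle : ∀ n x, Gn n x ≤ G x := fun n x => by
    simp only [hGn]
    by_cases hx : x ∈ B n
    · simp [hx]
    · simp [hx]
  have hsup : ∀ x, G x ^ s = ⨆ n, Gn n x ^ s := by
    intro x
    refine le_antisymm ?_ (iSup_le fun n => ENNReal.rpow_le_rpow (hle n x) hs0.le)
    obtain ⟨n0, hn0⟩ : ∃ n, x ∈ B n := by
      have := iUnion_spanningSets (volume : Measure (ℝ × ℝ))
      exact Set.mem_iUnion.1 (this ▸ Set.mem_univ x)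
    have hmono : ∀ n ≥ n0, x ∈ B n := fun n hn => monotone_spanningSets _ hn hn0
    have hlim : Tendsto (fun n : ℕ => (min (G x) n) ^ s) atTop (𝓝 (G x ^ s)) := by
      refine (ENNReal.continuous_rpow_const.tendsto _).comp ?_
      have : Tendsto (fun n : ℕ => min (G x) (n : ℝ≥0∞)) atTop (𝓝 (min (G x) ∞)) :=
        tendsto_const_nhds.min ENNReal.tendsto_nat_nhds_top
      simpa using this
    refine le_of_tendsto hlim ?_
    filter_upwards [eventually_ge_atTop n0] with n hn
    refine le_iSup_of_le n ?_
    simp only [hGn, Set.indicator_of_mem (hmono n hn), le_refl]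
  have hmon : Monotone fun n x => Gn n x ^ s := by
    intro m n hmn x
    refine ENNReal.rpow_le_rpow ?_ hs0.le
    simp only [hGn]
    by_cases hx : x ∈ B m
    · rw [Set.indicator_of_mem hx, Set.indicator_of_mem (monotone_spanningSets _ hmn hx)]
      gcongr
    · simp [hx]
  simp_rw [hsup]
  rw [lintegral_iSup (fun n => (hmeas n).pow_const s) hmon]
  refine iSup_le fun n => ?_
  set T := ∫⁻ x, Gn n x ^ s
  have hT : T ≠ ∞ := by
    have : T ≤ ∫⁻ x, (B n).indicator (fun _ => (n : ℝ≥0∞) ^ s) x := by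
      refine lintegral_mono fun x => ?_
      simp only [hGn]
      by_cases hx : x ∈ B n
      · simp only [Set.indicator_of_mem hx]
        exact ENNReal.rpow_le_rpow (min_le_right _ _) hs0.le
      · simp [hx, hs0]
    refine ne_top_of_le_ne_top ?_ this
    rw [lintegral_indicator_const (measurableSet_spanningSets _ n)]
    exact ENNReal.mul_ne_top (ENNReal.rpow_ne_top_of_nonneg hs0.le (by simp))
      (measure_spanningSets_lt_top _ n).ne
  by_cases hT0 : T = 0
  · rw [hT0]; exact zero_le
  -- The extremal test function is G_n^{s-1}, because (s-1)s' = s.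
  have h1 : T ≤ K * T ^ (1 / s') := by
    calc T = ∫⁻ x, Gn n x * Gn n x ^ (s - 1) := by
          refine lintegral_congr fun x => ?_
          nth_rewrite 2 [← ENNReal.rpow_one (Gn n x)]
          rw [← ENNReal.rpow_add_of_nonneg _ _ zero_le_one (by linarith)]
          congr 1; ring
      _ ≤ ∫⁻ x, G x * Gn n x ^ (s - 1) := by
          gcongr with x; exact hle n x
      _ ≤ K * (∫⁻ x, (Gn n x ^ (s - 1)) ^ s') ^ (1 / s') := h _ ((hmeas n).pow_const _)
      _ = K * T ^ (1 / s') := by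
          simp_rw [← ENNReal.rpow_mul, hs.sub_one_mul_conj]; rfl
  have h2 : T ^ (1 / s) ≤ K := by
    have h3 : T = T ^ (1 / s) * T ^ (1 / s') := by
      rw [← ENNReal.rpow_add _ _ hT0 hT]
      simp [hs.inv_add_inv_eq_one]
    have hne : T ^ (1 / s') ≠ 0 := by simp [ENNReal.rpow_eq_zero_iff, hT0, hT]
    have hnt : T ^ (1 / s') ≠ ∞ := by simp [ENNReal.rpow_eq_top_iff, hT0, hT]
    have h4 : T ^ (1 / s) * T ^ (1 / s') ≤ K * T ^ (1 / s') := by rw [← h3]; exact h1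
    exact (ENNReal.mul_le_mul_iff_left hne hnt).1 h4
  calc T = (T ^ (1 / s)) ^ s := by
        rw [← ENNReal.rpow_mul, one_div_mul_cancel hs0.ne', ENNReal.rpow_one]
    _ ≤ K ^ s := by gcongr

/-- Hölder's inequality for `∫ f h`, with the maximal theorem applied to `h`. -/
lemma lintegral_mul_strongMax_le {s s' : ℝ} (hs : s.HolderConjugate s') {F f : ℝ × ℝ → ℝ≥0∞}
    (hF : Measurable F) (hf : Measurable f) :
    ∫⁻ x, F x * strongMax f x ≤
      (∫⁻ x, F x ^ s) ^ (1 / s) * (maxConst s' * maxConst s') ^ (1 / s') *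
        (∫⁻ x, f x ^ s') ^ (1 / s') := by
  calc ∫⁻ x, F x * strongMax f x
      ≤ (∫⁻ x, F x ^ s) ^ (1 / s) * (∫⁻ x, strongMax f x ^ s') ^ (1 / s') :=
        ENNReal.lintegral_mul_le_Lp_mul_Lq volume hs hF.aemeasurable
          (measurable_strongMax f).aemeasurable
    _ ≤ (∫⁻ x, F x ^ s) ^ (1 / s) *
          (maxConst s' * maxConst s' * ∫⁻ x, f x ^ s') ^ (1 / s') := by
        gcongr
        · exact one_div_nonneg.2 hs.symm.pos.le
        · rw [mul_assoc]; exact lintegral_strongMax_rpow_le hs.symm.lt hf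
    _ = _ := by
        rw [ENNReal.mul_rpow_of_nonneg _ _ (one_div_nonneg.2 hs.symm.pos.le), mul_assoc]

lemma lintegral_rect_div_le_strongMax (f : ℝ × ℝ → ℝ≥0∞) {R : DyadicRect} {x : ℝ × ℝ}
    (h : x ∈ rect R) : (∫⁻ y in rect R, f y) / volume (rect R) ≤ strongMax f x :=
  le_iSup₂_of_le R h le_rfl

/-! ### Carleson embedding -/

open scoped Classical in
/-- The sum of the squared coefficients over the rectangles inside `U`. -/
def coeffMass (g : DyadicDistribution) (U : Set (ℝ × ℝ)) : ℝ≥0∞ :=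
  ∑' R : DyadicRect, if rect R ⊆ U then ENNReal.ofReal (g R ^ 2) else 0

lemma coeffMass_mono (g : DyadicDistribution) {U V : Set (ℝ × ℝ)} (h : U ⊆ V) :
    coeffMass g U ≤ coeffMass g V := by
  refine ENNReal.tsum_le_tsum fun R => ?_
  split_ifs with h1 h2
  · exact le_rfl
  · exact absurd (h1.trans h) h2
  · exact zero_le
  · exact le_rfl

lemma coeffMass_eq_zero_of_volume (g : DyadicDistribution) {U : Set (ℝ × ℝ)}
    (h : volume U = 0) : coeffMass g U = 0 := by
  unfold coeffMass
  rw [ENNReal.tsum_eq_zero]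
  intro R
  rw [if_neg]
  intro hR
  exact volume_rect_ne_zero R (measure_mono_null hR h)

lemma ofReal_sq_le_coeffMass (g : DyadicDistribution) {U : Set (ℝ × ℝ)} {R : DyadicRect}
    (h : rect R ⊆ U) : ENNReal.ofReal (g R ^ 2) ≤ coeffMass g U := by
  unfold coeffMass
  refine le_trans ?_ (ENNReal.le_tsum R)
  rw [if_pos h]

lemma coeffMass_le_of_isOpen (g : DyadicDistribution) {U : Set (ℝ × ℝ)} (hU : IsOpen U)
    (ht : volume U ≠ ∞) : coeffMass g U ≤ bmoNorm g ^ 2 * volume U := by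
  by_cases h0 : volume U = 0
  · rw [coeffMass_eq_zero_of_volume g h0]; exact zero_le
  have h1 : (coeffMass g U / volume U) ^ (1 / 2 : ℝ) ≤ bmoNorm g := by
    unfold bmoNorm
    refine le_iSup_of_le U (le_iSup_of_le hU (le_iSup_of_le (pos_iff_ne_zero.2 h0)
      (le_iSup_of_le ht.lt_top ?_)))
    rfl
  rw [← ENNReal.div_le_iff h0 ht]
  calc coeffMass g U / volume U = ((coeffMass g U / volume U) ^ (1 / 2 : ℝ)) ^ 2 := by
        rw [← ENNReal.rpow_natCast, ← ENNReal.rpow_mul]; norm_num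
    _ ≤ _ := by gcongr

lemma eq_zero_of_bmoNorm_eq_zero {g : DyadicDistribution} (h : bmoNorm g = 0) (R : DyadicRect) :
    g R = 0 := by
  obtain ⟨V, hRV, hV, hlt⟩ := Set.exists_isOpen_lt_add (μ := volume) (rect R)
    (volume_rect_ne_top R) (ε := 1) (by simp)
  have h1 := coeffMass_le_of_isOpen g hV (ne_top_of_lt hlt)
  have h2 := (ofReal_sq_le_coeffMass g hRV).trans h1
  rw [h] at h2
  have h3 : ENNReal.ofReal (g R ^ 2) = 0 := by simpa using h2
  rw [ENNReal.ofReal_eq_zero] at h3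
  nlinarith [sq_nonneg (g R)]

/-- The `BMO` norm tests open sets only, while the sets met below are level sets made of half-open
rectangles. Outer regularity removes the restriction; the cases where 0 · ∞ could occur are
separated first. -/
lemma coeffMass_le (g : DyadicDistribution) (U : Set (ℝ × ℝ)) :
    coeffMass g U ≤ bmoNorm g ^ 2 * volume U := by
  by_cases hb : bmoNorm g = 0
  · have : coeffMass g U = 0 := by
      unfold coeffMass
      simp [eq_zero_of_bmoNorm_eq_zero hb]
    rw [this]; exact zero_le
  by_cases h0 : volume U = 0
  · rw [coeffMass_eq_zero_of_volume g h0]; exact zero_le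
  by_cases hbt : bmoNorm g = ∞
  · rw [hbt]; simp [ENNReal.top_mul h0]
  by_cases ht : volume U = ∞
  · rw [ht, ENNReal.mul_top (by simpa using hb)]; exact le_top
  refine ENNReal.le_of_forall_pos_le_add fun e he _ => ?_
  have hb2 : bmoNorm g ^ 2 ≠ ∞ := ENNReal.pow_ne_top hbt
  obtain ⟨V, hUV, hV, hlt⟩ := Set.exists_isOpen_lt_add (μ := volume) U ht
    (ε := e / (bmoNorm g ^ 2)) (by
      simp only [ne_eq, ENNReal.div_eq_zero_iff, not_or]
      exact ⟨by simpa using he.ne', hb2⟩)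
  calc coeffMass g U ≤ coeffMass g V := coeffMass_mono g hUV
    _ ≤ bmoNorm g ^ 2 * volume V := coeffMass_le_of_isOpen g hV (ne_top_of_lt hlt)
    _ ≤ bmoNorm g ^ 2 * (volume U + e / (bmoNorm g ^ 2)) := by gcongr
    _ = _ := by
        rw [mul_add, ENNReal.mul_div_cancel (by simpa using hb) hb2]

/-- Carleson embedding: a rectangle with b_R > 2^K lies entirely in the set where the supremum
exceeds 2^K, so the `BMO` condition applies to each level set, and the levels are summed. -/
lemma tsum_ofReal_sq_mul_le (g : DyadicDistribution) (b : DyadicRect → ℝ≥0∞) :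
    ∑' R, ENNReal.ofReal (g R ^ 2) * b R ≤
      2 * geoConst 1 * bmoNorm g ^ 2 * ∫⁻ x, ⨆ (R : DyadicRect) (_ : x ∈ rect R), b R := by
  set m : ℝ × ℝ → ℝ≥0∞ := fun x => ⨆ (R : DyadicRect) (_ : x ∈ rect R), b R
  have hm : Measurable m := measurable_iSup_rect b
  calc ∑' R, ENNReal.ofReal (g R ^ 2) * b R
      ≤ ∑' R, ENNReal.ofReal (g R ^ 2) * (2 * ∑' K : ℤ,
          (if (2 : ℝ≥0∞) ^ (K : ℝ) < b R then (2 : ℝ≥0∞) ^ ((K : ℝ) * 1) else 0)) := by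
        gcongr with R
        simpa using rpow_le_tsum_level one_pos (b R)
    _ = 2 * ∑' K : ℤ, ∑' R, (if (2 : ℝ≥0∞) ^ (K : ℝ) < b R then
          (2 : ℝ≥0∞) ^ ((K : ℝ) * 1) * ENNReal.ofReal (g R ^ 2) else 0) := by
        rw [ENNReal.tsum_comm, ← ENNReal.tsum_mul_left]
        congr 1; ext R
        rw [← mul_assoc, mul_comm _ (2 : ℝ≥0∞), mul_assoc, ← ENNReal.tsum_mul_left]
        congr 2; ext K
        split_ifs <;> ring
    _ ≤ 2 * ∑' K : ℤ, (2 : ℝ≥0∞) ^ ((K : ℝ) * 1) *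
        coeffMass g {x | (2 : ℝ≥0∞) ^ (K : ℝ) < m x} := by
        gcongr with K
        unfold coeffMass
        rw [← ENNReal.tsum_mul_left]
        refine ENNReal.tsum_le_tsum fun R => ?_
        split_ifs with h1 h2
        · exact le_rfl
        · refine absurd (fun x hx => ?_) h2
          exact lt_of_lt_of_le h1 (le_iSup₂_of_le
              (f := fun (R : DyadicRect) (_ : x ∈ rect R) => b R) R hx le_rfl)
        · exact zero_le
        · exact zero_le
    _ ≤ 2 * ∑' K : ℤ, (2 : ℝ≥0∞) ^ ((K : ℝ) * 1) *
          (bmoNorm g ^ 2 * volume {x | (2 : ℝ≥0∞) ^ (K : ℝ) < m x}) := by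
        gcongr with K; exact coeffMass_le g _
    _ = 2 * (bmoNorm g ^ 2 * ∑' K : ℤ, (2 : ℝ≥0∞) ^ ((K : ℝ) * 1) *
          volume {x | (2 : ℝ≥0∞) ^ (K : ℝ) < m x}) := by
        congr 1
        rw [← ENNReal.tsum_mul_left]
        congr 1; ext K; ring
    _ ≤ 2 * (bmoNorm g ^ 2 * (geoConst 1 * ∫⁻ x, m x ^ (1 : ℝ))) := by
        gcongr
        exact tsum_level_measure_le hm one_pos
    _ = _ := by simp only [ENNReal.rpow_one]; ring

/-! ### Upper bounds for the paraproduct -/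

lemma rectSum_paraproduct_le (g : DyadicDistribution) (a : DyadicRect → ℝ) (x : ℝ × ℝ) :
    rectSum (fun R => ENNReal.ofReal (paraproduct g a R ^ 2)) x ≤
      maximal a x ^ 2 * rectSum (fun R => ENNReal.ofReal (g R ^ 2)) x := by
  rw [← rectSum_const_mul]
  refine rectSum_le_of_mem fun R hR => ?_
  rw [paraproduct, ofReal_mul_sq, mul_comm]
  gcongr
  exact ofReal_abs_le_maximal a hR

lemma squareFn_paraproduct_le (g : DyadicDistribution) (a : DyadicRect → ℝ) (x : ℝ × ℝ) :
    squareFn (paraproduct g a) x ≤ maximal a x * squareFn g x := by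
  rw [squareFn_eq, squareFn_eq]
  calc _ ≤ (maximal a x ^ 2 * rectSum (fun R => ENNReal.ofReal (g R ^ 2)) x) ^ (1 / 2 : ℝ) :=
        ENNReal.rpow_le_rpow (rectSum_paraproduct_le g a x) (by norm_num)
    _ = _ := by
        rw [ENNReal.mul_rpow_of_nonneg _ _ (by norm_num), ← ENNReal.rpow_natCast,
          ← ENNReal.rpow_mul]
        norm_num

lemma dotHardyNorm_paraproduct_le {p q r : ℝ} (hp : 0 < p) (hq : 0 < q) (hr : 0 < r)
    (h : 1 / q = 1 / p + 1 / r) (g : DyadicDistribution) (a : DyadicRect → ℝ) :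
    dotHardyNorm q (paraproduct g a) ≤ dotHardyNorm r g * hardyNorm p a := by
  have hqp : q < p := by
    have : 1 / p < 1 / q := by rw [h]; linarith [one_div_pos.2 hr]
    exact (one_div_lt_one_div hp hq).1 this
  rw [dotHardyNorm, dotHardyNorm, eLpNorm_eq_lintegral hq, eLpNorm_eq_lintegral hr,
    hardyNorm_eq hp, mul_comm]
  refine le_trans ?_ (ENNReal.lintegral_Lp_mul_le_Lq_mul_Lr hq hqp h volume
    (measurable_maximal a).aemeasurable (measurable_squareFn g).aemeasurable)
  gcongr with x
  exact squareFn_paraproduct_le g a x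

/-- The upper bounds hold for an arbitrary family `a`, so membership in the completion plays no role
in them. -/
lemma paraproductNorm_le {p q : ℝ} {g : DyadicDistribution} {A : ℝ≥0∞}
    (h : ∀ a, dotHardyNorm q (paraproduct g a) ≤ A * hardyNorm p a) :
    paraproductNorm p q g ≤ A := by
  by_cases hA : A = ∞
  · rw [hA]; exact le_top
  lift A to ℝ≥0 using hA
  exact iInf₂_le A fun a _ => h a

/-- The common core of both ranges of p in the `BMO` upper bound: the embedding with b_R = a_R²
⟨f⟩_R, where `F` dominates all b_R with R ∋ x. -/
lemma tsum_paraproduct_le (g : DyadicDistribution) (a : DyadicRect → ℝ) {f : ℝ × ℝ → ℝ≥0∞}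
    (hf : Measurable f) {F : ℝ × ℝ → ℝ≥0∞}
    (hF : ∀ R x, x ∈ rect R → a R ≠ 0 →
      ENNReal.ofReal |a R| ^ 2 * ((∫⁻ x in rect R, f x) / volume (rect R)) ≤ F x) :
    ∫⁻ x, rectSum (fun R => ENNReal.ofReal (paraproduct g a R ^ 2)) x * f x ≤
      2 * geoConst 1 * bmoNorm g ^ 2 * ∫⁻ x, F x := by
  rw [lintegral_rectSum_mul _ hf]
  simp_rw [paraproduct, ofReal_mul_sq, mul_assoc (ENNReal.ofReal (g _ ^ 2))]
  refine (tsum_ofReal_sq_mul_le g _).trans ?_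
  gcongr with x
  refine iSup₂_le fun R hR => ?_
  by_cases h : a R = 0
  · simp [h]
  · exact hF R x hR h

/-- Duality in L^{p/2}: here b_R ≤ M(x)² · `strongMax f x` on R, and Hölder with the maximal theorem
for the dual exponent bounds the integral of this product. -/
lemma lintegral_paraproduct_le_of_two_lt {p : ℝ} (hp : 2 < p) :
    ∃ C : ℝ≥0∞, C ≠ ∞ ∧ ∀ (g : DyadicDistribution) (a : DyadicRect → ℝ),
      ∫⁻ x, rectSum (fun R => ENNReal.ofReal (paraproduct g a R ^ 2)) x ^ (p / 2) ≤
        C * bmoNorm g ^ p * ∫⁻ x, maximal a x ^ p := by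
  have hs : (p / 2).HolderConjugate (p / 2).conjExponent :=
    Real.HolderConjugate.conjExponent (by linarith)
  set s := p / 2 with hsdef
  set s' := s.conjExponent
  set D := (maxConst s' * maxConst s') ^ (1 / s')
  have hD : D ≠ ∞ := ENNReal.rpow_ne_top_of_nonneg (one_div_nonneg.2 hs.symm.pos.le)
    (ENNReal.mul_ne_top (maxConst_ne_top hs.symm.lt) (maxConst_ne_top hs.symm.lt))
  refine ⟨(2 * geoConst 1 * D) ^ s, ENNReal.rpow_ne_top_of_nonneg hs.pos.le
    (ENNReal.mul_ne_top (ENNReal.mul_ne_top (by simp) (geoConst_ne_top one_pos)) hD),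
    fun g a => ?_⟩
  refine (lintegral_rpow_le_of_dual (measurable_rectSum _) hs
    (2 * geoConst 1 * bmoNorm g ^ 2 * ((∫⁻ x, maximal a x ^ p) ^ (1 / s) * D)) ?_).trans
      (le_of_eq ?_)
  · intro f hf
    refine (tsum_paraproduct_le g a hf (F := fun x => maximal a x ^ 2 * strongMax f x)
      fun R x hx _ => ?_).trans ?_
    · gcongr
      · exact ofReal_abs_le_maximal a hx
      · exact lintegral_rect_div_le_strongMax f hx
    · rw [mul_assoc _ _ ((∫⁻ x, f x ^ s') ^ (1 / s'))]
      gcongr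
      refine (lintegral_mul_strongMax_le hs ((measurable_maximal a).pow_const 2) hf).trans
        (le_of_eq ?_)
      congr 4
      ext x
      rw [← ENNReal.rpow_natCast, ← ENNReal.rpow_mul]
      congr 1; rw [hsdef]; push_cast; ring
  · have h1 : (bmoNorm g ^ 2) ^ s = bmoNorm g ^ p := by
      rw [← ENNReal.rpow_natCast, ← ENNReal.rpow_mul]
      congr 1; rw [hsdef]; push_cast; ring
    have h2 : ((∫⁻ x, maximal a x ^ p) ^ (1 / s)) ^ s = ∫⁻ x, maximal a x ^ p := by
      rw [← ENNReal.rpow_mul, one_div_mul_cancel hs.pos.ne', ENNReal.rpow_one]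
    rw [ENNReal.mul_rpow_of_nonneg _ _ hs.pos.le, ENNReal.mul_rpow_of_nonneg _ _ hs.pos.le,
      ENNReal.mul_rpow_of_nonneg _ _ hs.pos.le, ENNReal.mul_rpow_of_nonneg _ D hs.pos.le,
      ENNReal.mul_rpow_of_nonneg _ D hs.pos.le, ENNReal.mul_rpow_of_nonneg _ (geoConst 1) hs.pos.le,
      h1, h2]
    ring

/-- For p/2 ≤ 1 duality is not available. Instead the squared square function is integrated against
M^{p-2}, and the weight is removed by Hölder with exponents p/2 and 1 - p/2. -/
lemma lintegral_paraproduct_le_of_le_two {p : ℝ} (hp : 0 < p) (hp2 : p ≤ 2)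
    (g : DyadicDistribution) (a : DyadicRect → ℝ) :
    ∫⁻ x, rectSum (fun R => ENNReal.ofReal (paraproduct g a R ^ 2)) x ^ (p / 2) ≤
        (2 * geoConst 1) ^ (p / 2) * bmoNorm g ^ p * ∫⁻ x, maximal a x ^ p := by
  by_cases hb : bmoNorm g = 0
  · have : ∀ x, rectSum (fun R => ENNReal.ofReal (paraproduct g a R ^ 2)) x = 0 := fun x =>
      rectSum_eq_zero fun R _ => by simp [paraproduct, eq_zero_of_bmoNorm_eq_zero hb]
    simp [this, hp]
  set T := ∫⁻ x, maximal a x ^ p with hTdef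
  by_cases hT : T = ∞
  · rw [hT, ENNReal.mul_top]
    · exact le_top
    · have h2 : ¬ p / 2 < 0 := not_lt.2 (by positivity)
      refine mul_ne_zero ?_ ?_
      · simp [ENNReal.rpow_eq_zero_iff, geoConst_ne_zero, h2]
      · simp [ENNReal.rpow_eq_zero_iff, hb, hp.le]
  have hm := measurable_maximal a
  set G := rectSum (fun R => ENNReal.ofReal (paraproduct g a R ^ 2)) with hG
  -- The powers of M cancel, since (p-2)p/2 + p(1-p/2) = 0. M is finite almost everywhere because
  -- its p-th power is integrable, and where M = 0 the square function vanishes too.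
  have hpt : ∀ᵐ x, G x ^ (p / 2) ≤
      (G x * maximal a x ^ (p - 2)) ^ (p / 2) * (maximal a x ^ p) ^ (1 - p / 2) := by
    filter_upwards [ae_lt_top (hm.pow_const p) hT] with x hx
    have hxt : maximal a x ≠ ∞ := by
      intro h; rw [h, ENNReal.top_rpow_of_pos hp] at hx; exact hx.ne rfl
    by_cases h0 : maximal a x = 0
    · have := rectSum_paraproduct_le g a x
      rw [h0] at this
      have : G x = 0 := by simpa using this
      simp [this, hp]
    · rw [ENNReal.mul_rpow_of_nonneg _ _ (by positivity), mul_assoc, ← ENNReal.rpow_mul,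
        ← ENNReal.rpow_mul, ← ENNReal.rpow_add _ _ h0 hxt]
      rw [show (p - 2) * (p / 2) + p * (1 - p / 2) = 0 by ring]
      simp
  have hkey : ∫⁻ x, G x * maximal a x ^ (p - 2) ≤ 2 * geoConst 1 * bmoNorm g ^ 2 * T := by
    refine tsum_paraproduct_le g a (hm.pow_const _) (F := fun x => maximal a x ^ p)
        fun R x hx h0 => ?_
    have hpos : ENNReal.ofReal |a R| ≠ 0 := by simpa using h0
    -- Here p - 2 ≤ 0 and M ≥ |a_R| on R, so the weight is at most |a_R|^{p-2} throughout R.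
    have h1 : (∫⁻ x in rect R, maximal a x ^ (p - 2)) / volume (rect R) ≤
        ENNReal.ofReal |a R| ^ (p - 2) := by
      refine ENNReal.div_le_of_le_mul ?_
      calc ∫⁻ x in rect R, maximal a x ^ (p - 2) ≤
          ∫⁻ x in rect R, ENNReal.ofReal |a R| ^ (p - 2) := by
            refine setLIntegral_mono' (measurableSet_rect R) fun y hy => ?_
            rw [show p - 2 = -(2 - p) by ring, ENNReal.rpow_neg, ENNReal.rpow_neg]
            gcongr
            exact ofReal_abs_le_maximal a hy
        _ = _ := by simp
    calc _ ≤ ENNReal.ofReal |a R| ^ 2 * ENNReal.ofReal |a R| ^ (p - 2) := by gcongr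
      _ = ENNReal.ofReal |a R| ^ p := by
          rw [← ENNReal.rpow_natCast, ← ENNReal.rpow_add _ _ hpos ENNReal.ofReal_ne_top]
          congr 1; push_cast; ring
      _ ≤ _ := ENNReal.rpow_le_rpow (ofReal_abs_le_maximal a hx) hp.le
  calc ∫⁻ x, G x ^ (p / 2)
      ≤ ∫⁻ x, (G x * maximal a x ^ (p - 2)) ^ (p / 2) * (maximal a x ^ p) ^ (1 - p / 2) :=
        lintegral_mono_ae hpt
    _ ≤ (∫⁻ x, G x * maximal a x ^ (p - 2)) ^ (p / 2) * T ^ (1 - p / 2) :=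
        ENNReal.lintegral_mul_norm_pow_le
          ((measurable_rectSum _).mul (hm.pow_const _)).aemeasurable
          (hm.pow_const _).aemeasurable (by positivity) (by linarith) (by ring)
    _ ≤ (2 * geoConst 1 * bmoNorm g ^ 2 * T) ^ (p / 2) * T ^ (1 - p / 2) := by
        gcongr
    _ = _ := by
        have h1 : (bmoNorm g ^ 2) ^ (p / 2) = bmoNorm g ^ p := by
          rw [← ENNReal.rpow_natCast, ← ENNReal.rpow_mul]
          congr 1; push_cast; ring
        rw [ENNReal.mul_rpow_of_nonneg _ _ (by positivity),
          ENNReal.mul_rpow_of_nonneg _ _ (by positivity), h1, mul_assoc,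
          ← ENNReal.rpow_add_of_nonneg _ _ (by positivity) (by linarith)]
        simp

lemma paraproductNorm_le_bmoNorm {p : ℝ} (hp : 0 < p) :
    ∃ C : ℝ≥0∞, C ≠ ∞ ∧ ∀ g : DyadicDistribution, paraproductNorm p p g ≤ C * bmoNorm g := by
  obtain ⟨C, hC, h⟩ : ∃ C : ℝ≥0∞, C ≠ ∞ ∧ ∀ (g : DyadicDistribution) (a : DyadicRect → ℝ),
      ∫⁻ x, rectSum (fun R => ENNReal.ofReal (paraproduct g a R ^ 2)) x ^ (p / 2) ≤
        C * bmoNorm g ^ p * ∫⁻ x, maximal a x ^ p := by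
    rcases le_or_gt p 2 with h | h
    · exact ⟨_, ENNReal.rpow_ne_top_of_nonneg (by positivity)
        (ENNReal.mul_ne_top (by simp) (geoConst_ne_top one_pos)),
        lintegral_paraproduct_le_of_le_two hp h⟩
    · exact lintegral_paraproduct_le_of_two_lt h
  refine ⟨C ^ (1 / p), ENNReal.rpow_ne_top_of_nonneg (by positivity) hC, fun g =>
    paraproductNorm_le fun a => ?_⟩
  rw [dotHardyNorm_eq hp, hardyNorm_eq hp]
  calc _ ≤ (C * bmoNorm g ^ p * ∫⁻ x, maximal a x ^ p) ^ (1 / p) := by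
        gcongr; exact h g a
    _ = _ := by
        rw [ENNReal.mul_rpow_of_nonneg _ _ (by positivity),
          ENNReal.mul_rpow_of_nonneg _ _ (by positivity), ← ENNReal.rpow_mul,
          mul_one_div_cancel hp.ne', ENNReal.rpow_one]

/-! ### Families indexed by rectangles: differences, energy and the product estimate -/

/-- Half the difference of the values at the two children of the first side. -/
def diffFst (c : DyadicRect → ℝ) (R : DyadicRect) : ℝ :=
  (c ((R.1.1 - 1, 2 * R.1.2), R.2) - c ((R.1.1 - 1, 2 * R.1.2 + 1), R.2)) / 2

/-- Half the difference of the values at the two children of the second side. -/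
def diffSnd (c : DyadicRect → ℝ) (R : DyadicRect) : ℝ :=
  (c (R.1, (R.2.1 - 1, 2 * R.2.2)) - c (R.1, (R.2.1 - 1, 2 * R.2.2 + 1))) / 2

/-- The family is a dyadic martingale in the first variable. -/
def MartFst (c : DyadicRect → ℝ) : Prop :=
  ∀ R, c R = (c ((R.1.1 - 1, 2 * R.1.2), R.2) + c ((R.1.1 - 1, 2 * R.1.2 + 1), R.2)) / 2

/-- The family is a dyadic martingale in the second variable. -/
def MartSnd (c : DyadicRect → ℝ) : Prop :=
  ∀ R, c R = (c (R.1, (R.2.1 - 1, 2 * R.2.2)) + c (R.1, (R.2.1 - 1, 2 * R.2.2 + 1))) / 2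

/-- The sum of `|R| c_R²` over the rectangles `R` of sides `2 ^ m` and `2 ^ n`. -/
def level (c : DyadicRect → ℝ) (m n : ℤ) : ℝ≥0∞ :=
  ∑' k : ℤ, ∑' l : ℤ, ENNReal.ofReal ((2 : ℝ) ^ m * 2 ^ n * c ((m, k), (n, l)) ^ 2)

lemma level_swap (c : DyadicRect → ℝ) (m n : ℤ) :
    level c m n = level (fun R => c R.swap) n m := by
  unfold level
  rw [ENNReal.tsum_comm]
  simp_rw [Prod.swap, mul_comm ((2 : ℝ) ^ m)]

lemma tsum_int_even_odd (f : ℤ → ℝ≥0∞) : ∑' k, f k = ∑' k, (f (2 * k) + f (2 * k + 1)) := by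
  have h := (Int.divModEquiv 2).symm.tsum_eq f
  rw [← h, ENNReal.tsum_prod']
  congr 1; ext k
  rw [tsum_fintype, Fin.sum_univ_two]
  simp [Int.divModEquiv, mul_comm]

lemma level_mono {c d : DyadicRect → ℝ} {m n : ℤ}
    (h : ∀ k l, c ((m, k), (n, l)) ^ 2 ≤ d ((m, k), (n, l)) ^ 2) : level c m n ≤ level d m n := by
  refine ENNReal.tsum_le_tsum fun k => ENNReal.tsum_le_tsum fun l => ENNReal.ofReal_le_ofReal ?_
  have := h k l
  gcongr

lemma level_const_mul (e : ℝ) (c : DyadicRect → ℝ) (m n : ℤ) :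
    level (fun R => e * c R) m n = ENNReal.ofReal (e ^ 2) * level c m n := by
  unfold level
  simp_rw [← ENNReal.tsum_mul_left]
  congr 1; ext k; congr 1; ext l
  rw [← ENNReal.ofReal_mul (sq_nonneg e)]
  congr 1; ring

lemma two_zpow_add_one (m : ℤ) : (2 : ℝ) ^ (m + 1) = 2 * 2 ^ m := by
  rw [zpow_add_one₀ (by norm_num)]; ring

/-- The parallelogram law: the mean of the squares at two children is the square of their mean plus
the square of half their difference. -/
lemma level_eq_add_diffFst {c : DyadicRect → ℝ} (hc : MartFst c) (m n : ℤ) :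
    level c m n = level c (m + 1) n + level (diffFst c) (m + 1) n := by
  unfold level
  rw [tsum_int_even_odd, ← ENNReal.tsum_add]
  congr 1; ext k
  rw [← ENNReal.tsum_add, ← ENNReal.tsum_add]
  congr 1; ext l
  have hc' := hc ((m + 1, k), (n, l))
  simp only [diffFst, add_sub_cancel_right] at *
  rw [← ENNReal.ofReal_add (by positivity) (by positivity),
    ← ENNReal.ofReal_add (by positivity) (by positivity), hc', two_zpow_add_one]
  congr 1; ring

/-- One step of a discrete integration by parts that moves the difference from `a` to `b`. The
energy of the product ab appears at two consecutive scales with the same factor, so the estimate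
telescopes. -/
lemma level_mul_diffFst_le {a b : DyadicRect → ℝ} (ha : MartFst a) (hb : MartFst b) (m n : ℤ) :
    level (fun R => b R * diffFst a R) (m + 1) n + 2 * level (fun R => a R * b R) (m + 1) n ≤
      2 * level (fun R => a R * b R) m n +
        14 * level (fun R => a R * diffFst b R) (m + 1) n := by
  unfold level
  rw [tsum_int_even_odd (fun k => ∑' l : ℤ, ENNReal.ofReal ((2 : ℝ) ^ m * 2 ^ n * _))]
  simp_rw [← ENNReal.tsum_mul_left, ← ENNReal.tsum_add, ← ENNReal.tsum_mul_left, ← ENNReal.tsum_add]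
  refine ENNReal.tsum_le_tsum fun k => ENNReal.tsum_le_tsum fun l => ?_
  have ha' := ha ((m + 1, k), (n, l))
  have hb' := hb ((m + 1, k), (n, l))
  simp only [diffFst, add_sub_cancel_right] at *
  rw [ha', hb']
  have h2 : (2 : ℝ≥0∞) = ENNReal.ofReal 2 := by simp
  have h14 : (14 : ℝ≥0∞) = ENNReal.ofReal 14 := by simp
  rw [h2, h14, ← ENNReal.ofReal_add (by positivity) (by positivity),
    ← ENNReal.ofReal_mul (by positivity), ← ENNReal.ofReal_mul (by positivity),
    ← ENNReal.ofReal_mul (by positivity), ← ENNReal.ofReal_add (by positivity) (by positivity),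
    ← ENNReal.ofReal_add (by positivity) (by positivity), two_zpow_add_one]
  refine ENNReal.ofReal_le_ofReal ?_
  generalize a ((m, 2 * k), (n, l)) = x
  generalize a ((m, 2 * k + 1), (n, l)) = y
  generalize b ((m, 2 * k), (n, l)) = X
  generalize b ((m, 2 * k + 1), (n, l)) = Y
  have hw : 0 ≤ (2 : ℝ) ^ m * 2 ^ n := by positivity
  -- Let α, δ be the half-sum and half-difference of x, y, and β, ε those of X, Y. Twice the mean of
  -- (ab)² over the children is 2(αβ + δε)² + 2(αε + βδ)². Up to the area factor, the right side
  -- minus the left is (βδ + 4αε)² + 2δ²ε²; the 14 is chosen to complete this square.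
  have := mul_nonneg hw
    (sq_nonneg (((X + Y) / 2) * ((x - y) / 2) + 4 * (((x + y) / 2) * ((X - Y) / 2))))
  have := mul_nonneg hw (sq_nonneg (((x - y) / 2) * ((X - Y) / 2)))
  nlinarith

lemma level_eq_add_sum_diffFst {c : DyadicRect → ℝ} (hc : MartFst c) (z n : ℤ) (M : ℕ) :
    level c z n = level c (z + M) n + ∑ i ∈ Finset.range M, level (diffFst c) (z + i + 1) n := by
  induction M with
  | zero => simp
  | succ M ih =>
    rw [ih, Finset.sum_range_succ, level_eq_add_diffFst hc (z + M) n]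
    push_cast
    rw [← add_assoc z]
    ring

lemma sum_level_mul_diffFst_le {a b : DyadicRect → ℝ} (ha : MartFst a) (hb : MartFst b)
    (z n : ℤ) (M : ℕ) :
    ∑ i ∈ Finset.range M, level (fun R => b R * diffFst a R) (z + i + 1) n ≤
      2 * level (fun R => a R * b R) z n +
        14 * ∑ i ∈ Finset.range M, level (fun R => a R * diffFst b R) (z + i + 1) n := by
  suffices h : ∑ i ∈ Finset.range M, level (fun R => b R * diffFst a R) (z + i + 1) n +
      2 * level (fun R => a R * b R) (z + M) n ≤ 2 * level (fun R => a R * b R) z n +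
        14 * ∑ i ∈ Finset.range M, level (fun R => a R * diffFst b R) (z + i + 1) n from
    le_self_add.trans h
  induction M with
  | zero => simp
  | succ M ih =>
    rw [Finset.sum_range_succ, Finset.sum_range_succ, mul_add]
    have := level_mul_diffFst_le ha hb (z + M) n
    push_cast
    rw [← add_assoc z]
    calc _ = ∑ i ∈ Finset.range M, level (fun R => b R * diffFst a R) (z + i + 1) n +
          (level (fun R => b R * diffFst a R) (z + M + 1) n +
            2 * level (fun R => a R * b R) (z + M + 1) n) := by ring
      _ ≤ ∑ i ∈ Finset.range M, level (fun R => b R * diffFst a R) (z + i + 1) n +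
          (2 * level (fun R => a R * b R) (z + M) n +
        14 * level (fun R => a R * diffFst b R) (z + M + 1) n) := by gcongr
      _ = (∑ i ∈ Finset.range M, level (fun R => b R * diffFst a R) (z + i + 1) n +
          2 * level (fun R => a R * b R) (z + M) n) +
        14 * level (fun R => a R * diffFst b R) (z + M + 1) n := by ring
      _ ≤ _ := by
        rw [← add_assoc]
        gcongr

lemma MartSnd.swap {c : DyadicRect → ℝ} (hc : MartSnd c) : MartFst fun R => c R.swap :=
  fun R => hc R.swap

lemma level_eq_add_sum_diffSnd {c : DyadicRect → ℝ} (hc : MartSnd c) (m z : ℤ) (M : ℕ) :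
    level c m z = level c m (z + M) + ∑ i ∈ Finset.range M, level (diffSnd c) m (z + i + 1) := by
  simp_rw [level_swap _ m]
  exact level_eq_add_sum_diffFst hc.swap z m M

lemma sum_level_mul_diffSnd_le {a b : DyadicRect → ℝ} (ha : MartSnd a) (hb : MartSnd b)
    (m z : ℤ) (M : ℕ) :
    ∑ i ∈ Finset.range M, level (fun R => b R * diffSnd a R) m (z + i + 1) ≤
      2 * level (fun R => a R * b R) m z +
        14 * ∑ i ∈ Finset.range M, level (fun R => a R * diffSnd b R) m (z + i + 1) := by
  simp_rw [level_swap _ m]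
  exact sum_level_mul_diffFst_le ha.swap hb.swap z m M

lemma MartFst.diffSnd {c : DyadicRect → ℝ} (hc : MartFst c) : MartFst (diffSnd c) := by
  intro R
  simp only [BiDyadic.diffSnd]
  rw [hc (R.1, (R.2.1 - 1, 2 * R.2.2)), hc (R.1, (R.2.1 - 1, 2 * R.2.2 + 1))]
  ring

lemma MartSnd.diffFst {c : DyadicRect → ℝ} (hc : MartSnd c) : MartSnd (diffFst c) := by
  intro R
  simp only [BiDyadic.diffFst]
  rw [hc ((R.1.1 - 1, 2 * R.1.2), R.2), hc ((R.1.1 - 1, 2 * R.1.2 + 1), R.2)]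
  ring

lemma sum_level_diffFst_le {c : DyadicRect → ℝ} (hc : MartFst c) (z n : ℤ) (M : ℕ) :
    ∑ i ∈ Finset.range M, level (diffFst c) (z + i + 1) n ≤ level c z n := by
  rw [level_eq_add_sum_diffFst hc z n M]; exact le_add_self

lemma sum_level_diffSnd_le {c : DyadicRect → ℝ} (hc : MartSnd c) (m z : ℤ) (M : ℕ) :
    ∑ i ∈ Finset.range M, level (diffSnd c) m (z + i + 1) ≤ level c m z := by
  rw [level_eq_add_sum_diffSnd hc m z M]; exact le_add_self

/-- The total energy is controlled by the mixed differences and the two coarse energies. -/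
lemma level_le_sum_diff {c : DyadicRect → ℝ} (h1 : MartFst c) (h2 : MartSnd c) (z : ℤ) (M : ℕ) :
    level c z z ≤ ∑ j ∈ Finset.range M, ∑ i ∈ Finset.range M,
        level (diffFst (diffSnd c)) (z + i + 1) (z + j + 1) +
      level c (z + M) z + level c z (z + M) := by
  calc level c z z = level c z (z + M) + ∑ j ∈ Finset.range M, level (diffSnd c) z (z + j + 1) :=
        level_eq_add_sum_diffSnd h2 z z M
    _ = level c z (z + M) + ∑ j ∈ Finset.range M, (level (diffSnd c) (z + M) (z + j + 1) +
          ∑ i ∈ Finset.range M, level (diffFst (diffSnd c)) (z + i + 1) (z + j + 1)) := by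
        congr 1
        exact Finset.sum_congr rfl fun j _ => level_eq_add_sum_diffFst h1.diffSnd z _ M
    _ ≤ level c z (z + M) + (level c (z + M) z +
          ∑ j ∈ Finset.range M, ∑ i ∈ Finset.range M,
            level (diffFst (diffSnd c)) (z + i + 1) (z + j + 1)) := by
        rw [Finset.sum_add_distrib]
        gcongr
        exact sum_level_diffSnd_le h2 _ z M
    _ = _ := by ring

lemma sq_mul_le_of_imp {u d e : ℝ} (h : d ≠ 0 → |u| ≤ e) :
    (u * d) ^ 2 ≤ (e * d) ^ 2 := by
  by_cases hd : d = 0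
  · simp [hd]
  · rw [mul_pow, mul_pow]
    have : u ^ 2 ≤ e ^ 2 := sq_le_sq' (by linarith [(abs_le.1 (h hd)).1]) (abs_le.1 (h hd)).2
    gcongr

/-- The discrete form of Merryfield's inequality: the mixed differences of `u`, weighted by `v`,
are controlled by the energy of `1 - v` when `u` is small wherever `v` does not vanish. -/
lemma sum_level_mul_diff_le {u v : DyadicRect → ℝ} (hu1 : MartFst u) (hu2 : MartSnd u)
    (hv1 : MartFst v) (hv2 : MartSnd v) (hv : ∀ R, 0 ≤ v R) {e : ℝ}
    (hsmall : ∀ R, v R ≠ 0 → |u R| ≤ e) {z : ℤ}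
    (hfine : ∀ k l, u ((z, k), (z, l)) * v ((z, k), (z, l)) = 0) (M : ℕ) :
    ∑ j ∈ Finset.range M, ∑ i ∈ Finset.range M,
        level (fun R => v R * diffFst (diffSnd u) R) (z + i + 1) (z + j + 1) ≤
      252 * ENNReal.ofReal (e ^ 2) * level (fun R => 1 - v R) z z := by
  set w : DyadicRect → ℝ := fun R => 1 - v R with hw
  have hw1 : MartFst w := fun R => by simp only [hw]; linarith [hv1 R]
  have hw2 : MartSnd w := fun R => by simp only [hw]; linarith [hv2 R]
  have hd1 : ∀ R, diffFst v R = -diffFst w R := fun R => by simp only [diffFst, hw]; ring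
  have hd2 : ∀ R, diffSnd v R = -diffSnd w R := fun R => by simp only [diffSnd, hw]; ring
  have hd12 : ∀ R, diffSnd (diffFst v) R = -diffSnd (diffFst w) R := fun R => by
    simp only [diffSnd, diffFst, hw]; ring
  -- A nonnegative martingale that vanishes at a rectangle vanishes at its descendants. Hence every
  -- difference of `v` is supported where v ≠ 0, which is where |u| ≤ e.
  have hz1 : ∀ R, v R = 0 → v ((R.1.1 - 1, 2 * R.1.2), R.2) = 0 ∧
      v ((R.1.1 - 1, 2 * R.1.2 + 1), R.2) = 0 := fun R h => by
    have h0 := hv1 R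
    have ha := hv ((R.1.1 - 1, 2 * R.1.2), R.2)
    have hb := hv ((R.1.1 - 1, 2 * R.1.2 + 1), R.2)
    constructor <;> linarith
  have hz2 : ∀ R, v R = 0 → v (R.1, (R.2.1 - 1, 2 * R.2.2)) = 0 ∧
      v (R.1, (R.2.1 - 1, 2 * R.2.2 + 1)) = 0 := fun R h => by
    have h0 := hv2 R
    have ha := hv (R.1, (R.2.1 - 1, 2 * R.2.2))
    have hb := hv (R.1, (R.2.1 - 1, 2 * R.2.2 + 1))
    constructor <;> linarith
  have hn1 : ∀ R, diffFst v R ≠ 0 → v R ≠ 0 := fun R h h0 => h (by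
    simp only [diffFst, hz1 R h0]; simp)
  have hn2 : ∀ R, diffSnd v R ≠ 0 → v R ≠ 0 := fun R h h0 => h (by
    simp only [diffSnd, hz2 R h0]; simp)
  have hn12 : ∀ R, diffSnd (diffFst v) R ≠ 0 → v R ≠ 0 := fun R h h0 => h (by
    simp only [diffSnd, diffFst]
    have h3 := hz1 _ (hz2 R h0).1
    have h4 := hz1 _ (hz2 R h0).2
    simp only at h3 h4
    rw [h3.1, h3.2, h4.1, h4.2]; simp)
  have e1 : ∀ m n, level (fun R => u R * diffFst v R) m n ≤
      ENNReal.ofReal (e ^ 2) * level (diffFst w) m n := fun m n => by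
    rw [← level_const_mul]
    refine level_mono fun k l => (sq_mul_le_of_imp fun h => hsmall _ (hn1 _ h)).trans (le_of_eq ?_)
    rw [hd1]; ring
  have e2 : ∀ m n, level (fun R => u R * diffSnd v R) m n ≤
      ENNReal.ofReal (e ^ 2) * level (diffSnd w) m n := fun m n => by
    rw [← level_const_mul]
    refine level_mono fun k l => (sq_mul_le_of_imp fun h => hsmall _ (hn2 _ h)).trans (le_of_eq ?_)
    rw [hd2]; ring
  have e12 : ∀ m n, level (fun R => u R * diffSnd (diffFst v) R) m n ≤
      ENNReal.ofReal (e ^ 2) * level (diffSnd (diffFst w)) m n := fun m n => by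
    rw [← level_const_mul]
    refine level_mono fun k l => (sq_mul_le_of_imp fun h => hsmall _ (hn12 _ h)).trans (le_of_eq ?_)
    rw [hd12]; ring
  set E := ENNReal.ofReal (e ^ 2)
  set W := level w z z
  have hfine0 : level (fun R => u R * v R) z z = 0 := by
    unfold level; simp [hfine]
  -- Second variable, at the finest first scale: the boundary term is the energy of uv on cells,
  -- which is zero.
  have hB : ∑ j ∈ Finset.range M, level (fun R => v R * diffSnd u R) z (z + j + 1) ≤
      14 * (E * W) := by
    refine (sum_level_mul_diffSnd_le hu2 hv2 z z M).trans ?_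
    rw [hfine0, mul_zero, zero_add]
    gcongr
    calc _ ≤ ∑ j ∈ Finset.range M, E * level (diffSnd w) z (z + j + 1) :=
          Finset.sum_le_sum fun j _ => e2 _ _
      _ ≤ _ := by
          rw [← Finset.mul_sum]
          gcongr
          exact sum_level_diffSnd_le hw2 z z M
  have hE : ∑ i ∈ Finset.range M, level (fun R => u R * diffFst v R) (z + i + 1) z ≤ E * W := by
    calc _ ≤ ∑ i ∈ Finset.range M, E * level (diffFst w) (z + i + 1) z :=
          Finset.sum_le_sum fun j _ => e1 _ _
      _ ≤ _ := by
          rw [← Finset.mul_sum]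
          gcongr
          exact sum_level_diffFst_le hw1 z z M
  have hF : ∑ i ∈ Finset.range M, ∑ j ∈ Finset.range M,
      level (fun R => u R * diffSnd (diffFst v) R) (z + i + 1) (z + j + 1) ≤ E * W := by
    calc _ ≤ ∑ i ∈ Finset.range M, ∑ j ∈ Finset.range M,
            E * level (diffSnd (diffFst w)) (z + i + 1) (z + j + 1) :=
          Finset.sum_le_sum fun i _ => Finset.sum_le_sum fun j _ => e12 _ _
      _ ≤ E * ∑ i ∈ Finset.range M, level (diffFst w) (z + i + 1) z := by
          simp_rw [← Finset.mul_sum]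
          gcongr
          exact sum_level_diffSnd_le hw2.diffFst _ z M
      _ ≤ _ := by
          gcongr
          exact sum_level_diffFst_le hw1 z z M
  -- The same with the weight Δ₁v in place of `v`; now the boundary term is the energy of uΔ₁v at
  -- the finest second scale, controlled by `hE`.
  have hC : ∑ i ∈ Finset.range M, ∑ j ∈ Finset.range M,
      level (fun R => diffFst v R * diffSnd u R) (z + i + 1) (z + j + 1) ≤ 16 * (E * W) := by
    calc _ ≤ ∑ i ∈ Finset.range M, (2 * level (fun R => u R * diffFst v R) (z + i + 1) z +
          14 * ∑ j ∈ Finset.range M,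
            level (fun R => u R * diffSnd (diffFst v) R) (z + i + 1) (z + j + 1)) :=
          Finset.sum_le_sum fun i _ => sum_level_mul_diffSnd_le hu2 hv2.diffFst _ z M
      _ ≤ 2 * (E * W) + 14 * (E * W) := by
          rw [Finset.sum_add_distrib, ← Finset.mul_sum, ← Finset.mul_sum]
          gcongr
      _ = _ := by ring
  -- The difference in the first variable is moved from Δ₂u to `v`, leaving the terms `hB` and `hC`;
  -- 252 = 2 · 14 + 14 · 16.
  calc _ ≤ ∑ j ∈ Finset.range M, (2 * level (fun R => diffSnd u R * v R) z (z + j + 1) +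
        14 * ∑ i ∈ Finset.range M,
          level (fun R => diffSnd u R * diffFst v R) (z + i + 1) (z + j + 1)) :=
        Finset.sum_le_sum fun j _ => sum_level_mul_diffFst_le hu1.diffSnd hv1 z _ M
    _ ≤ 2 * (14 * (E * W)) + 14 * (16 * (E * W)) := by
        rw [Finset.sum_add_distrib, ← Finset.mul_sum, ← Finset.mul_sum, Finset.sum_comm]
        simp_rw [mul_comm (diffSnd u _)]
        gcongr
    _ = _ := by ring

/-! ### Densities of sets on dyadic rectangles -/

lemma dyadicInterval_child_union (I : ℤ × ℤ) :
    dyadicInterval I = dyadicInterval (I.1 - 1, 2 * I.2) ∪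
        dyadicInterval (I.1 - 1, 2 * I.2 + 1) := by
  obtain ⟨n, k⟩ := I
  have h : (2 : ℝ) ^ n = 2 * 2 ^ (n - 1) := by rw [← two_zpow_add_one, sub_add_cancel]
  have hp : (0 : ℝ) < 2 ^ (n - 1) := by positivity
  simp only [dyadicInterval]
  rw [h]
  push_cast
  rw [show (2 * (k : ℝ) + 1) * 2 ^ (n - 1) = (2 * (k : ℝ) + 1) * 2 ^ (n - 1) from rfl,
    Set.Ico_union_Ico_eq_Ico (by nlinarith) (by nlinarith)]
  congr 1 <;> ring

lemma dyadicInterval_child_disjoint (I : ℤ × ℤ) :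
    Disjoint (dyadicInterval (I.1 - 1, 2 * I.2)) (dyadicInterval (I.1 - 1, 2 * I.2 + 1)) := by
  rw [Set.disjoint_left]
  intro x hx hx'
  have := dyadicInterval_eq_of_fst_eq (I := (I.1 - 1, 2 * I.2)) (I' := (I.1 - 1, 2 * I.2 + 1))
    rfl hx hx'
  simp at this

lemma volume_real_dyadicInterval (I : ℤ × ℤ) : volume.real (dyadicInterval I) = 2 ^ I.1 := by
  rw [measureReal_def, volume_dyadicInterval, ENNReal.toReal_ofReal (by positivity)]

lemma volume_real_rect (R : DyadicRect) : volume.real (rect R) = 2 ^ R.1.1 * 2 ^ R.2.1 := by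
  rw [measureReal_def, volume_rect, ENNReal.toReal_mul, ← measureReal_def, ← measureReal_def,
    volume_real_dyadicInterval, volume_real_dyadicInterval]

/-- The proportion of `R` occupied by `A`. -/
def density (A : Set (ℝ × ℝ)) (R : DyadicRect) : ℝ :=
  volume.real (A ∩ rect R) / (2 ^ R.1.1 * 2 ^ R.2.1)

lemma density_nonneg (A : Set (ℝ × ℝ)) (R : DyadicRect) : 0 ≤ density A R := by
  unfold density; positivity

lemma volume_inter_rect_ne_top (A : Set (ℝ × ℝ)) (R : DyadicRect) :
    volume (A ∩ rect R) ≠ ∞ :=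
  measure_ne_top_of_subset Set.inter_subset_right (volume_rect_ne_top R)

lemma density_le_one (A : Set (ℝ × ℝ)) (R : DyadicRect) : density A R ≤ 1 := by
  unfold density
  rw [← volume_real_rect]
  exact div_le_one_of_le₀ (measureReal_mono Set.inter_subset_right (volume_rect_ne_top R))
    (by positivity)

lemma density_mul (A : Set (ℝ × ℝ)) (R : DyadicRect) :
    2 ^ R.1.1 * 2 ^ R.2.1 * density A R = volume.real (A ∩ rect R) := by
  unfold density; field_simp

lemma density_eq_one {A : Set (ℝ × ℝ)} {R : DyadicRect} (h : rect R ⊆ A) : density A R = 1 := by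
  unfold density
  rw [Set.inter_eq_self_of_subset_right h, volume_real_rect]
  exact div_self (by positivity)

lemma density_eq_zero {A : Set (ℝ × ℝ)} {R : DyadicRect} (h : Disjoint (rect R) A) :
    density A R = 0 := by
  unfold density
  rw [Set.inter_comm, h.inter_eq]; simp

lemma martFst_density (A : Set (ℝ × ℝ)) (hA : MeasurableSet A) : MartFst (density A) := by
  rintro ⟨I, J⟩
  have h : volume.real (A ∩ rect (I, J)) = volume.real (A ∩ rect ((I.1 - 1, 2 * I.2), J)) +
      volume.real (A ∩ rect ((I.1 - 1, 2 * I.2 + 1), J)) := by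
    rw [← measureReal_union _ (hA.inter (measurableSet_rect _))
      (volume_inter_rect_ne_top _ _) (volume_inter_rect_ne_top _ _), ← Set.inter_union_distrib_left]
    · simp only [rect]
      rw [← Set.union_prod, ← dyadicInterval_child_union]
    · refine Disjoint.mono Set.inter_subset_right Set.inter_subset_right ?_
      exact Set.Disjoint.set_prod_left (dyadicInterval_child_disjoint I) _ _
  simp only [density]
  rw [h, show (2 : ℝ) ^ I.1 = 2 * 2 ^ (I.1 - 1) by rw [← two_zpow_add_one, sub_add_cancel]]
  field_simp

lemma martSnd_density (A : Set (ℝ × ℝ)) (hA : MeasurableSet A) : MartSnd (density A) := by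
  rintro ⟨I, J⟩
  have h : volume.real (A ∩ rect (I, J)) = volume.real (A ∩ rect (I, (J.1 - 1, 2 * J.2))) +
      volume.real (A ∩ rect (I, (J.1 - 1, 2 * J.2 + 1))) := by
    rw [← measureReal_union _ (hA.inter (measurableSet_rect _))
      (volume_inter_rect_ne_top _ _) (volume_inter_rect_ne_top _ _), ← Set.inter_union_distrib_left]
    · simp only [rect]
      rw [← Set.prod_union, ← dyadicInterval_child_union]
    · refine Disjoint.mono Set.inter_subset_right Set.inter_subset_right ?_
      exact Set.Disjoint.set_prod_right (dyadicInterval_child_disjoint J) _ _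
  simp only [density]
  rw [h, show (2 : ℝ) ^ J.1 = 2 * 2 ^ (J.1 - 1) by rw [← two_zpow_add_one, sub_add_cancel]]
  field_simp

lemma exists_mem_dyadicInterval (n : ℤ) (x : ℝ) : ∃ k, x ∈ dyadicInterval (n, k) :=
  ⟨⌊x / 2 ^ n⌋, mem_dyadicInterval.2 rfl⟩

lemma tsum_volume_inter_rect (A : Set (ℝ × ℝ)) (hA : MeasurableSet A) (m n : ℤ) :
    ∑' k : ℤ, ∑' l : ℤ, volume (A ∩ rect ((m, k), (n, l))) = volume A := by
  rw [← ENNReal.tsum_prod (f := fun k l => volume (A ∩ rect ((m, k), (n, l)))),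
    ← measure_iUnion]
  · rw [← Set.inter_iUnion]
    congr 1
    rw [Set.inter_eq_left]
    intro x _
    obtain ⟨k, hk⟩ := exists_mem_dyadicInterval m x.1
    obtain ⟨l, hl⟩ := exists_mem_dyadicInterval n x.2
    exact Set.mem_iUnion.2 ⟨(k, l), hk, hl⟩
  · rintro ⟨k, l⟩ ⟨k', l'⟩ hne
    rw [Function.onFun, Set.disjoint_left]
    rintro x ⟨_, hx1, hx2⟩ ⟨_, hx1', hx2'⟩
    have h1 := dyadicInterval_eq_of_fst_eq (I := (m, k)) (I' := (m, k')) rfl hx1 hx1'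
    have h2 := dyadicInterval_eq_of_fst_eq (I := (n, l)) (I' := (n, l')) rfl hx2 hx2'
    simp only [Prod.mk.injEq, true_and] at h1 h2
    exact hne (by rw [h1, h2])
  · exact fun _ => hA.inter (measurableSet_rect _)

lemma ofReal_area_mul_density (A : Set (ℝ × ℝ)) (R : DyadicRect) :
    ENNReal.ofReal (2 ^ R.1.1 * 2 ^ R.2.1 * density A R) = volume (A ∩ rect R) := by
  rw [density_mul, measureReal_def, ENNReal.ofReal_toReal (volume_inter_rect_ne_top A R)]

/-- The squared density is at most c times the density, and |R| times the density is |A ∩ R|, which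
sums to |A|. -/
lemma level_density_le {A : Set (ℝ × ℝ)} (hA : MeasurableSet A) {m n : ℤ} {c : ℝ}
    (hc : ∀ k l, density A ((m, k), (n, l)) ≤ c) :
    level (density A) m n ≤ ENNReal.ofReal c * volume A := by
  rw [← tsum_volume_inter_rect A hA m n]
  unfold level
  simp_rw [← ENNReal.tsum_mul_left]
  refine ENNReal.tsum_le_tsum fun k => ENNReal.tsum_le_tsum fun l => ?_
  have h0 := density_nonneg A ((m, k), (n, l))
  rw [← ofReal_area_mul_density, ← ENNReal.ofReal_mul (h0.trans (hc k l))]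
  refine ENNReal.ofReal_le_ofReal ?_
  have := mul_le_mul_of_nonneg_right (hc k l) h0
  calc (2 : ℝ) ^ m * 2 ^ n * density A ((m, k), (n, l)) ^ 2
      = 2 ^ m * 2 ^ n * (density A ((m, k), (n, l)) * density A ((m, k), (n, l))) := by ring
    _ ≤ 2 ^ m * 2 ^ n * (c * density A ((m, k), (n, l))) := by gcongr
    _ = _ := by ring

/-- `A` is a union of dyadic squares of side `2 ^ z`. -/
def IsCellUnion (z : ℤ) (A : Set (ℝ × ℝ)) : Prop :=
  ∀ k l, rect ((z, k), (z, l)) ⊆ A ∨ Disjoint (rect ((z, k), (z, l))) A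

lemma level_density_of_isCellUnion {A : Set (ℝ × ℝ)} (hA : MeasurableSet A) {z : ℤ}
    (h : IsCellUnion z A) : level (density A) z z = volume A := by
  rw [← tsum_volume_inter_rect A hA z z]
  unfold level
  congr 1; ext k; congr 1; ext l
  rw [← ofReal_area_mul_density]
  rcases h k l with h' | h'
  · rw [density_eq_one h']; simp
  · rw [density_eq_zero h']; simp

lemma isCellUnion_measurableSet {A : Set (ℝ × ℝ)} {z : ℤ} (h : IsCellUnion z A) :
    MeasurableSet A := by
  have : A = ⋃ kl : {kl : ℤ × ℤ // rect ((z, kl.1), (z, kl.2)) ⊆ A},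
      rect ((z, kl.1.1), (z, kl.1.2)) := by
    refine Set.Subset.antisymm (fun x hx => ?_) (Set.iUnion_subset fun kl => kl.2)
    obtain ⟨k, hk⟩ := exists_mem_dyadicInterval z x.1
    obtain ⟨l, hl⟩ := exists_mem_dyadicInterval z x.2
    have hmem : x ∈ rect ((z, k), (z, l)) := ⟨hk, hl⟩
    rcases h k l with h' | h'
    · exact Set.mem_iUnion.2 ⟨⟨(k, l), h'⟩, hmem⟩
    · exact absurd hx (Set.disjoint_left.1 h' hmem)
  rw [this]
  exact MeasurableSet.iUnion fun _ => measurableSet_rect _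

lemma density_le_div (A : Set (ℝ × ℝ)) (hA : volume A ≠ ∞) (R : DyadicRect) :
    density A R ≤ volume.real A / (2 ^ R.1.1 * 2 ^ R.2.1) := by
  unfold density
  gcongr
  exact Set.inter_subset_left

/-- The coefficient of `χ_A` with respect to the Haar function of `R`, normalised in `L^∞`. -/
def haarCoeff (A : Set (ℝ × ℝ)) (R : DyadicRect) : ℝ := diffFst (diffSnd (density A)) R

/-- The energy of the Haar coefficient of `χ_A` at `R`. -/
def haarEnergy (A : Set (ℝ × ℝ)) (R : DyadicRect) : ℝ :=
  2 ^ R.1.1 * 2 ^ R.2.1 * haarCoeff A R ^ 2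

lemma haarEnergy_nonneg (A : Set (ℝ × ℝ)) (R : DyadicRect) : 0 ≤ haarEnergy A R := by
  unfold haarEnergy; positivity

lemma tsum_dyadicRect (F : DyadicRect → ℝ≥0∞) :
    ∑' R, F R = ∑' n : ℤ, ∑' m : ℤ, ∑' k : ℤ, ∑' l : ℤ, F ((m, k), (n, l)) := by
  rw [ENNReal.tsum_prod', ENNReal.tsum_prod']
  simp_rw [ENNReal.tsum_prod' (f := fun b : ℤ × ℤ => F (_, b))]
  rw [ENNReal.tsum_comm (α := ℤ) (β := ℤ) (f := fun n m => ∑' k : ℤ, ∑' l : ℤ, F ((m, k), (n, l)))]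
  congr 1; ext m
  rw [ENNReal.tsum_comm]

lemma sum_range_le_tsum_int (G : ℤ → ℝ≥0∞) (z : ℤ) (M : ℕ) :
    ∑ i ∈ Finset.range M, G (z + i + 1) ≤ ∑' n, G n := by
  have hinj : Function.Injective (fun i : ℕ => z + i + 1) := fun a b h => by simpa using h
  exact (ENNReal.sum_le_tsum (f := fun i : ℕ => G (z + i + 1)) _).trans
    (ENNReal.tsum_comp_le_tsum_of_injective hinj G)

/-- The Haar energy of a set of dyadic squares is concentrated on the rectangles which have a
large density in `U`, if `U` contains the points where the dyadic maximal function is not small. -/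
lemma volume_le_tsum_haarEnergy {A U : Set (ℝ × ℝ)} (hA : volume A ≠ ∞) {z : ℤ}
    (hcell : IsCellUnion z A) (hU : MeasurableSet U) (hAU : A ⊆ U) {e : ℝ}
    (hsmall : ∀ R, ¬ rect R ⊆ U → density A R ≤ e) :
    volume A ≤ ∑' R, {R | 1 / 2 < density U R}.indicator
      (fun R => ENNReal.ofReal (haarEnergy A R)) R + 1008 * ENNReal.ofReal (e ^ 2) * volume U := by
  have hAm := isCellUnion_measurableSet hcell
  set D : Set DyadicRect := {R | 1 / 2 < density U R}
  set v : DyadicRect → ℝ := fun R => 1 - density U R with hv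
  have hv0 : ∀ R, 0 ≤ v R := fun R => by simp only [hv]; linarith [density_le_one U R]
  have hu1 := martFst_density A hAm
  have hu2 := martSnd_density A hAm
  have hv1 : MartFst v := fun R => by simp only [hv]; linarith [martFst_density U hU R]
  have hv2 : MartSnd v := fun R => by simp only [hv]; linarith [martSnd_density U hU R]
  have hw : (fun R => 1 - v R) = density U := by ext R; simp [hv]
  -- Merryfield's inequality with u the density of A and v that of the complement of U. The
  -- fine-scale product vanishes because a cell either lies in A ⊆ U or misses A.
  have hmix : ∀ M : ℕ, ∑ j ∈ Finset.range M, ∑ i ∈ Finset.range M,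
      level (fun R => v R * diffFst (diffSnd (density A)) R) (z + i + 1) (z + j + 1) ≤
      252 * ENNReal.ofReal (e ^ 2) * volume U := fun M => by
    refine (sum_level_mul_diff_le hu1 hu2 hv1 hv2 hv0 (e := e) ?_ ?_ M).trans ?_
    · intro R hR
      rw [abs_of_nonneg (density_nonneg A R)]
      refine hsmall R fun h => hR ?_
      simp [hv, density_eq_one h]
    · intro k l
      rcases hcell k l with h | h
      · simp [hv, density_eq_one (h.trans hAU)]
      · rw [density_eq_zero h, zero_mul]
    · gcongr
      rw [hw]
      refine (level_density_le hU fun k l => density_le_one U _).trans ?_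
      simp
  have hsum : ∀ M : ℕ, ∑ j ∈ Finset.range M, ∑ i ∈ Finset.range M,
      level (diffFst (diffSnd (density A))) (z + i + 1) (z + j + 1) ≤
      ∑' R, D.indicator (fun R => ENNReal.ofReal (haarEnergy A R)) R +
        1008 * ENNReal.ofReal (e ^ 2) * volume U := fun M => by
    -- A rectangle outside `D` has v ≥ 1/2, hence 1 ≤ 4v²; this is the source of 1008 = 4 · 252.
    have hpt : ∀ m n, level (diffFst (diffSnd (density A))) m n ≤
        ∑' k : ℤ, ∑' l : ℤ, D.indicator (fun R => ENNReal.ofReal (haarEnergy A R))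
          ((m, k), (n, l)) +
        4 * level (fun R => v R * diffFst (diffSnd (density A)) R) m n := fun m n => by
      unfold level
      simp_rw [← ENNReal.tsum_mul_left, ← ENNReal.tsum_add]
      refine ENNReal.tsum_le_tsum fun k => ENNReal.tsum_le_tsum fun l => ?_
      by_cases hD : ((m, k), (n, l)) ∈ D
      · rw [Set.indicator_of_mem hD]
        exact le_self_add
      · rw [Set.indicator_of_notMem hD, zero_add, show (4 : ℝ≥0∞) = ENNReal.ofReal 4 by simp,
          ← ENNReal.ofReal_mul (by norm_num)]
        refine ENNReal.ofReal_le_ofReal ?_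
        have h1 : 1 / 2 ≤ v ((m, k), (n, l)) := by
          have : ¬ 1 / 2 < density U ((m, k), (n, l)) := hD
          simp only [hv]; linarith
        have h2 : 1 ≤ 4 * v ((m, k), (n, l)) ^ 2 := by nlinarith
        calc _ = (2 : ℝ) ^ m * 2 ^ n * diffFst (diffSnd (density A)) ((m, k), (n, l)) ^ 2 * 1 := by
              ring
          _ ≤ (2 : ℝ) ^ m * 2 ^ n * diffFst (diffSnd (density A)) ((m, k), (n, l)) ^ 2 *
              (4 * v ((m, k), (n, l)) ^ 2) := by gcongr
          _ = _ := by ring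
    calc _ ≤ ∑ j ∈ Finset.range M, ∑ i ∈ Finset.range M,
          (∑' k : ℤ, ∑' l : ℤ, D.indicator (fun R => ENNReal.ofReal (haarEnergy A R))
            ((z + i + 1, k), (z + j + 1, l)) +
          4 * level (fun R => v R * diffFst (diffSnd (density A)) R) (z + i + 1) (z + j + 1)) :=
          Finset.sum_le_sum fun j _ => Finset.sum_le_sum fun i _ => hpt _ _
      _ ≤ _ := by
          simp_rw [Finset.sum_add_distrib, ← Finset.mul_sum]
          refine add_le_add ?_ ?_
          · rw [tsum_dyadicRect]
            refine (Finset.sum_le_sum fun (j : ℕ) _ => sum_range_le_tsum_int (fun m : ℤ =>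
              ∑' k : ℤ, ∑' l : ℤ, D.indicator (fun R => ENNReal.ofReal (haarEnergy A R))
                ((m, k), (z + j + 1, l))) z M).trans ?_
            exact sum_range_le_tsum_int (fun n : ℤ => ∑' m : ℤ,
              ∑' k : ℤ, ∑' l : ℤ, D.indicator (fun R => ENNReal.ofReal (haarEnergy A R))
                ((m, k), (n, l))) z M
          · calc _ ≤ 4 * (252 * ENNReal.ofReal (e ^ 2) * volume U) := by gcongr; exact hmix M
              _ = _ := by ring
  -- The two coarse terms of `level_le_sum_diff` disappear as M → ∞: when one side has length
  -- 2^{z+M}, the densities of A are at most |A| / (2^z 2^{z+M}).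
  have hlim : Tendsto (fun M : ℕ => ∑' R, D.indicator (fun R => ENNReal.ofReal (haarEnergy A R)) R +
        1008 * ENNReal.ofReal (e ^ 2) * volume U +
        2 * (ENNReal.ofReal (volume.real A / (2 ^ z * 2 ^ (z + M))) * volume A)) atTop
      (𝓝 (∑' R, D.indicator (fun R => ENNReal.ofReal (haarEnergy A R)) R +
        1008 * ENNReal.ofReal (e ^ 2) * volume U + 2 * (ENNReal.ofReal 0 * volume A))) := by
    refine Tendsto.add tendsto_const_nhds (ENNReal.Tendsto.const_mul
      (ENNReal.Tendsto.mul_const (ENNReal.tendsto_ofReal ?_) (Or.inr hA)) (Or.inr (by simp)))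
    have h1 : ∀ M : ℕ, volume.real A / (2 ^ z * 2 ^ (z + M)) =
        volume.real A / (2 ^ z * 2 ^ z) * (1 / 2) ^ M := fun M => by
      rw [zpow_add₀ (by norm_num), zpow_natCast]
      field_simp
      rw [mul_assoc, ← mul_pow]; norm_num
    simp_rw [h1]
    simpa using (tendsto_pow_atTop_nhds_zero_of_lt_one (r := (1 / 2 : ℝ)) (by norm_num)
      (by norm_num)).const_mul (volume.real A / (2 ^ z * 2 ^ z))
  simp only [ENNReal.ofReal_zero, zero_mul, mul_zero, add_zero] at hlim
  refine ge_of_tendsto' hlim fun M => ?_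
  calc volume A = level (density A) z z := (level_density_of_isCellUnion hAm hcell).symm
    _ ≤ _ := level_le_sum_diff hu1 hu2 z M
    _ ≤ ∑' R, D.indicator (fun R => ENNReal.ofReal (haarEnergy A R)) R +
        1008 * ENNReal.ofReal (e ^ 2) * volume U +
        ENNReal.ofReal (volume.real A / (2 ^ z * 2 ^ (z + M))) * volume A +
        ENNReal.ofReal (volume.real A / (2 ^ z * 2 ^ (z + M))) * volume A := by
      gcongr
      · exact hsum M
      · refine level_density_le hAm fun k l => (density_le_div A hA _).trans (le_of_eq ?_)
        simp only; rw [mul_comm]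
      · exact level_density_le hAm fun k l => density_le_div A hA _
    _ = _ := by ring

/-! ### Haar functions -/

/-- The `L^∞`-normalised Haar function of a dyadic interval. -/
def haar (I : ℤ × ℤ) (x : ℝ) : ℝ :=
  (dyadicInterval (I.1 - 1, 2 * I.2)).indicator 1 x -
    (dyadicInterval (I.1 - 1, 2 * I.2 + 1)).indicator 1 x

/-- The `L^∞`-normalised Haar function of a dyadic rectangle. -/
def haarRect (R : DyadicRect) (x : ℝ × ℝ) : ℝ := haar R.1 x.1 * haar R.2 x.2

lemma integrable_indicator_one_interval (I : ℤ × ℤ) :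
    Integrable ((dyadicInterval I).indicator (1 : ℝ → ℝ)) :=
  (integrable_indicator_iff (measurableSet_dyadicInterval I)).2
    (integrableOn_const (volume_dyadicInterval_ne_top I))

lemma integrable_haar (I : ℤ × ℤ) : Integrable (haar I) :=
  (integrable_indicator_one_interval _).sub (integrable_indicator_one_interval _)

lemma haar_eq_zero {I : ℤ × ℤ} {x : ℝ} (hx : x ∉ dyadicInterval I) : haar I x = 0 := by
  rw [dyadicInterval_child_union] at hx
  simp only [Set.mem_union, not_or] at hx
  simp [haar, hx.1, hx.2]

lemma haar_mul_self (I : ℤ × ℤ) (x : ℝ) :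
    haar I x * haar I x = (dyadicInterval I).indicator 1 x := by
  by_cases hx : x ∈ dyadicInterval I
  · rw [Set.indicator_of_mem hx]
    rw [dyadicInterval_child_union] at hx
    rcases hx with h | h
    · have h' := Set.disjoint_left.1 (dyadicInterval_child_disjoint I) h
      simp [haar, h, h']
    · have h' := Set.disjoint_right.1 (dyadicInterval_child_disjoint I) h
      simp [haar, h, h']
  · simp [haar_eq_zero hx, hx]

lemma integral_indicator_interval (I : ℤ × ℤ) :
    ∫ x, (dyadicInterval I).indicator (1 : ℝ → ℝ) x = 2 ^ I.1 := by
  rw [integral_indicator_one (measurableSet_dyadicInterval I), volume_real_dyadicInterval]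

lemma integral_haar (I : ℤ × ℤ) : ∫ x, haar I x = 0 := by
  unfold haar
  rw [integral_sub (integrable_indicator_one_interval _) (integrable_indicator_one_interval _),
    integral_indicator_interval, integral_indicator_interval, sub_self]

/-- If I' meets I without lying inside it, then I ⊆ I' and the mean zero property applies. -/
lemma setIntegral_haar_eq_zero {I I' : ℤ × ℤ} (h : ¬ dyadicInterval I' ⊆ dyadicInterval I) :
    ∫ x in dyadicInterval I', haar I x = 0 := by
  by_cases hd : ∃ x, x ∈ dyadicInterval I ∧ x ∈ dyadicInterval I'
  · obtain ⟨x, hx, hx'⟩ := hd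
    rcases le_total I.1 I'.1 with hle | hle
    · have hsub := dyadicInterval_subset hle hx hx'
      rw [setIntegral_eq_integral_of_forall_compl_eq_zero fun y hy =>
        haar_eq_zero fun hy' => hy (hsub hy'), integral_haar]
    · exact absurd (dyadicInterval_subset hle hx' hx) h
  · push Not at hd
    exact setIntegral_eq_zero_of_forall_eq_zero fun x hx => haar_eq_zero fun hx' => hd x hx' hx

/-- The Haar function of the longer interval is constant on the shorter one, where the other has
mean zero. -/
lemma integral_haar_mul_of_lt {I I' : ℤ × ℤ} (h : I.1 < I'.1) :
    ∫ x, haar I x * haar I' x = 0 := by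
  obtain ⟨x0, hx0⟩ := dyadicInterval_nonempty I
  have hconst : ∀ x ∈ dyadicInterval I, haar I' x = haar I' x0 := by
    intro x hx
    have key : ∀ C : ℤ × ℤ, C.1 = I'.1 - 1 → (dyadicInterval C).indicator (1 : ℝ → ℝ) x =
        (dyadicInterval C).indicator 1 x0 := fun C hC => by
      by_cases hxC : x ∈ dyadicInterval C
      · rw [Set.indicator_of_mem hxC,
          Set.indicator_of_mem (dyadicInterval_subset (by omega) hx hxC hx0)]
        rfl
      · rw [Set.indicator_of_notMem hxC, Set.indicator_of_notMem fun h0 =>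
          hxC (dyadicInterval_subset (by omega) hx0 h0 hx)]
    simp only [haar, key (I'.1 - 1, 2 * I'.2) rfl, key (I'.1 - 1, 2 * I'.2 + 1) rfl]
  have : ∀ x, haar I x * haar I' x = haar I x * haar I' x0 := by
    intro x
    by_cases hx : x ∈ dyadicInterval I
    · rw [hconst x hx]
    · simp [haar_eq_zero hx]
  simp_rw [this]
  rw [integral_mul_const, integral_haar, zero_mul]

lemma integral_haar_mul_of_ne {I I' : ℤ × ℤ} (h : I ≠ I') :
    ∫ x, haar I x * haar I' x = 0 := by
  rcases lt_trichotomy I.1 I'.1 with hlt | heq | hgt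
  · exact integral_haar_mul_of_lt hlt
  · have : ∀ x, haar I x * haar I' x = 0 := by
      intro x
      by_cases hx : x ∈ dyadicInterval I
      · by_cases hx' : x ∈ dyadicInterval I'
        · exact absurd (dyadicInterval_eq_of_fst_eq heq hx hx') h
        · simp [haar_eq_zero hx']
      · simp [haar_eq_zero hx]
    simp [this]
  · simp_rw [mul_comm (haar I _)]
    exact integral_haar_mul_of_lt hgt

lemma integral_haar_mul_self (I : ℤ × ℤ) : ∫ x, haar I x * haar I x = 2 ^ I.1 := by
  simp_rw [haar_mul_self]
  exact integral_indicator_interval I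

lemma integrable_haar_mul (I I' : ℤ × ℤ) : Integrable fun x => haar I x * haar I' x := by
  refine (integrable_haar I').bdd_mul (c := 1) (integrable_haar I).aestronglyMeasurable ?_
  refine Eventually.of_forall fun x => ?_
  rw [Real.norm_eq_abs, ← Real.sqrt_sq_eq_abs, sq, haar_mul_self]
  by_cases hx : x ∈ dyadicInterval I <;> simp [hx]

lemma integrable_haarRect (R : DyadicRect) : Integrable (haarRect R) :=
  (integrable_haar R.1).mul_prod (integrable_haar R.2)

lemma haarRect_mul (R R' : DyadicRect) (x : ℝ × ℝ) : haarRect R x * haarRect R' x =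
    (haar R.1 x.1 * haar R'.1 x.1) * (haar R.2 x.2 * haar R'.2 x.2) := by
  unfold haarRect; ring

lemma integrable_haarRect_mul (R R' : DyadicRect) :
    Integrable fun x => haarRect R x * haarRect R' x := by
  simp_rw [haarRect_mul]
  exact (integrable_haar_mul R.1 R'.1).mul_prod (integrable_haar_mul R.2 R'.2)

open scoped Classical in
lemma integral_haarRect_mul (R R' : DyadicRect) :
    ∫ x, haarRect R x * haarRect R' x = if R = R' then 2 ^ R.1.1 * 2 ^ R.2.1 else 0 := by
  simp_rw [haarRect_mul]
  rw [Measure.volume_eq_prod, integral_prod_mul (fun x => haar R.1 x * haar R'.1 x)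
    (fun y => haar R.2 y * haar R'.2 y)]
  split_ifs with h
  · subst h
    rw [integral_haar_mul_self, integral_haar_mul_self]
  · by_cases h1 : R.1 = R'.1
    · have h2 : R.2 ≠ R'.2 := fun h2 => h (Prod.ext h1 h2)
      rw [integral_haar_mul_of_ne h2, mul_zero]
    · rw [integral_haar_mul_of_ne h1, zero_mul]

lemma setIntegral_haarRect_eq_zero {R R' : DyadicRect} (h : ¬ rect R' ⊆ rect R) :
    ∫ x in rect R', haarRect R x = 0 := by
  unfold haarRect
  rw [rect, Measure.volume_eq_prod, setIntegral_prod_mul]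
  by_cases h1 : dyadicInterval R'.1 ⊆ dyadicInterval R.1
  · have h2 : ¬ dyadicInterval R'.2 ⊆ dyadicInterval R.2 := fun h2 => h (Set.prod_mono h1 h2)
    rw [setIntegral_haar_eq_zero h2, mul_zero]
  · rw [setIntegral_haar_eq_zero h1, zero_mul]

lemma integrable_indicator_one {A : Set (ℝ × ℝ)} (hA : MeasurableSet A) (hAt : volume A ≠ ∞) :
    Integrable (A.indicator (1 : ℝ × ℝ → ℝ)) :=
  (integrable_indicator_iff hA).2 (integrableOn_const hAt)

lemma setIntegral_indicator_rect {A : Set (ℝ × ℝ)} (hA : MeasurableSet A) (R : DyadicRect) :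
    ∫ x, A.indicator (1 : ℝ × ℝ → ℝ) x * (rect R).indicator 1 x =
      2 ^ R.1.1 * 2 ^ R.2.1 * density A R := by
  rw [density_mul]
  have : ∀ x, A.indicator (1 : ℝ × ℝ → ℝ) x * (rect R).indicator 1 x =
      (A ∩ rect R).indicator 1 x := fun x => by
    rw [Set.inter_indicator_one]; rfl
  simp_rw [this]
  rw [integral_indicator_one (hA.inter (measurableSet_rect R))]

lemma haarRect_eq (R : DyadicRect) (x : ℝ × ℝ) : haarRect R x =
    (rect ((R.1.1 - 1, 2 * R.1.2), (R.2.1 - 1, 2 * R.2.2))).indicator 1 x -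
    (rect ((R.1.1 - 1, 2 * R.1.2), (R.2.1 - 1, 2 * R.2.2 + 1))).indicator 1 x -
    (rect ((R.1.1 - 1, 2 * R.1.2 + 1), (R.2.1 - 1, 2 * R.2.2))).indicator 1 x +
    (rect ((R.1.1 - 1, 2 * R.1.2 + 1), (R.2.1 - 1, 2 * R.2.2 + 1))).indicator 1 x := by
  have h : ∀ I J : ℤ × ℤ, (rect (I, J)).indicator (1 : ℝ × ℝ → ℝ) x =
      (dyadicInterval I).indicator 1 x.1 * (dyadicInterval J).indicator 1 x.2 := fun I J => by
    by_cases h1 : x.1 ∈ dyadicInterval I <;> by_cases h2 : x.2 ∈ dyadicInterval J <;>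
      simp [rect, Set.indicator, h1, h2]
  simp only [h, haarRect, haar]
  ring

/-- The link between the two pictures: the mixed martingale difference of the density is the Haar
coefficient of χ_A, so the energies in Merryfield's inequality are those of the orthogonal
expansion. -/
lemma integral_indicator_mul_haarRect {A : Set (ℝ × ℝ)} (hA : MeasurableSet A) (R : DyadicRect) :
    ∫ x, A.indicator (1 : ℝ × ℝ → ℝ) x * haarRect R x =
      2 ^ R.1.1 * 2 ^ R.2.1 * haarCoeff A R := by
  have hint : ∀ R : DyadicRect,
      Integrable fun x => A.indicator (1 : ℝ × ℝ → ℝ) x * (rect R).indicator 1 x := fun R => by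
    have : ∀ x, A.indicator (1 : ℝ × ℝ → ℝ) x * (rect R).indicator 1 x =
        (A ∩ rect R).indicator 1 x := fun x => by
      rw [Set.inter_indicator_one]; rfl
    simp_rw [this]
    exact integrable_indicator_one (hA.inter (measurableSet_rect R)) (volume_inter_rect_ne_top A R)
  have hlin : ∀ f₁ f₂ f₃ f₄ : ℝ × ℝ → ℝ, Integrable f₁ → Integrable f₂ → Integrable f₃ →
      Integrable f₄ → ∫ x, (f₁ x - f₂ x - f₃ x + f₄ x) =
        (∫ x, f₁ x) - (∫ x, f₂ x) - (∫ x, f₃ x) + ∫ x, f₄ x := by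
    intro f₁ f₂ f₃ f₄ h₁ h₂ h₃ h₄
    have h₁₂ : Integrable fun x => f₁ x - f₂ x := h₁.sub h₂
    have h₁₂₃ : Integrable fun x => f₁ x - f₂ x - f₃ x := h₁₂.sub h₃
    rw [integral_add h₁₂₃ h₄, integral_sub h₁₂ h₃, integral_sub h₁ h₂]
  simp_rw [haarRect_eq, mul_add, mul_sub]
  rw [hlin _ _ _ _ (hint _) (hint _) (hint _) (hint _), setIntegral_indicator_rect hA,
      setIntegral_indicator_rect hA,
    setIntegral_indicator_rect hA, setIntegral_indicator_rect hA]
  simp only [haarCoeff, diffFst, diffSnd]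
  rw [show (2 : ℝ) ^ R.1.1 = 2 * 2 ^ (R.1.1 - 1) by rw [← two_zpow_add_one, sub_add_cancel],
    show (2 : ℝ) ^ R.2.1 = 2 * 2 ^ (R.2.1 - 1) by rw [← two_zpow_add_one, sub_add_cancel]]
  ring

/-- The partial sum of the Haar series of `χ_A` over the rectangles in `D`. -/
def haarSum (A : Set (ℝ × ℝ)) (D : Finset DyadicRect) (x : ℝ × ℝ) : ℝ :=
  ∑ R ∈ D, haarCoeff A R * haarRect R x

lemma integrable_haarSum (A : Set (ℝ × ℝ)) (D : Finset DyadicRect) : Integrable (haarSum A D) :=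
  integrable_finsetSum D fun R _ => (integrable_haarRect R).const_mul _

lemma haarSum_mul_self (A : Set (ℝ × ℝ)) (D : Finset DyadicRect) (x : ℝ × ℝ) :
    haarSum A D x * haarSum A D x = ∑ R ∈ D, ∑ R' ∈ D,
      haarCoeff A R * haarCoeff A R' * (haarRect R x * haarRect R' x) := by
  unfold haarSum
  rw [Finset.sum_mul_sum]
  refine Finset.sum_congr rfl fun R _ => Finset.sum_congr rfl fun R' _ => ?_
  ring

lemma integrable_haarSum_mul_self (A : Set (ℝ × ℝ)) (D : Finset DyadicRect) :
    Integrable fun x => haarSum A D x * haarSum A D x := by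
  simp_rw [haarSum_mul_self]
  exact integrable_finsetSum D fun R _ => integrable_finsetSum D fun R' _ =>
    (integrable_haarRect_mul R R').const_mul _

lemma integral_haarSum_mul_self (A : Set (ℝ × ℝ)) (D : Finset DyadicRect) :
    ∫ x, haarSum A D x * haarSum A D x = ∑ R ∈ D, haarEnergy A R := by
  classical
  simp_rw [haarSum_mul_self]
  rw [integral_finsetSum D fun R _ => integrable_finsetSum D fun R' _ =>
    (integrable_haarRect_mul R R').const_mul _]
  refine Finset.sum_congr rfl fun R hR => ?_
  rw [integral_finsetSum D fun R' _ => (integrable_haarRect_mul R R').const_mul _]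
  simp_rw [integral_const_mul, integral_haarRect_mul]
  rw [Finset.sum_eq_single R]
  · simp [haarEnergy]; ring
  · intro R' _ hne
    simp [hne.symm]
  · exact fun h => absurd hR h

lemma integrable_indicator_mul_haarSum {A : Set (ℝ × ℝ)} (hA : MeasurableSet A)
    (D : Finset DyadicRect) : Integrable fun x => A.indicator 1 x * haarSum A D x := by
  have : (fun x => A.indicator 1 x * haarSum A D x) = A.indicator (haarSum A D) := by
    ext x; by_cases hx : x ∈ A <;> simp [hx]
  rw [this]
  exact (integrable_haarSum A D).indicator hA

lemma integral_indicator_mul_haarSum {A : Set (ℝ × ℝ)} (hA : MeasurableSet A)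
    (D : Finset DyadicRect) :
    ∫ x, A.indicator (1 : ℝ × ℝ → ℝ) x * haarSum A D x = ∑ R ∈ D, haarEnergy A R := by
  have h1 : ∀ x, A.indicator (1 : ℝ × ℝ → ℝ) x * haarSum A D x =
      ∑ R ∈ D, haarCoeff A R * (A.indicator (1 : ℝ × ℝ → ℝ) x * haarRect R x) := fun x => by
    unfold haarSum
    rw [Finset.mul_sum]
    refine Finset.sum_congr rfl fun R _ => ?_
    ring
  have h2 : ∀ R : DyadicRect, Integrable fun x => A.indicator (1 : ℝ × ℝ → ℝ) x * haarRect R x :=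
    fun R => by
      have : (fun x => A.indicator (1 : ℝ × ℝ → ℝ) x * haarRect R x) =
          A.indicator (haarRect R) := by
        ext x; by_cases hx : x ∈ A <;> simp [hx]
      rw [this]
      exact (integrable_haarRect R).indicator hA
  simp_rw [h1]
  rw [integral_finsetSum D fun R _ => (h2 R).const_mul _]
  refine Finset.sum_congr rfl fun R _ => ?_
  rw [integral_const_mul, integral_indicator_mul_haarRect hA, haarEnergy]
  ring

/-- Pythagoras for the orthogonal system of Haar functions: the L² error of a partial sum is exactly
the missing energy. -/
lemma integral_sub_haarSum_sq {A : Set (ℝ × ℝ)} (hA : MeasurableSet A) (hAt : volume A ≠ ∞)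
    (D : Finset DyadicRect) :
    Integrable (fun x => (A.indicator 1 x - haarSum A D x) ^ 2) ∧
    ∫ x, (A.indicator 1 x - haarSum A D x) ^ 2 = volume.real A - ∑ R ∈ D, haarEnergy A R := by
  have h : ∀ x, (A.indicator 1 x - haarSum A D x) ^ 2 = A.indicator 1 x -
      2 * (A.indicator 1 x * haarSum A D x) + haarSum A D x * haarSum A D x := fun x => by
    by_cases hx : x ∈ A
    · simp [hx]; ring
    · simp [hx]; ring
  have h1 := integrable_indicator_one hA hAt
  have h2 := (integrable_indicator_mul_haarSum hA D).const_mul 2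
  have h3 := integrable_haarSum_mul_self A D
  have h12 : Integrable fun x => A.indicator 1 x - 2 * (A.indicator 1 x * haarSum A D x) :=
    h1.sub h2
  simp_rw [h]
  refine ⟨h12.add h3, ?_⟩
  rw [integral_add h12 h3, integral_sub h1 h2, integral_const_mul,
    integral_indicator_mul_haarSum hA, integral_haarSum_mul_self, integral_indicator_one hA]
  ring

/-! ### Averages over rectangles and their control by the strong maximal function -/

lemma averages_eq (f : ℝ × ℝ → ℝ) (R : DyadicRect) :
    averages f R = (2 ^ R.1.1 * 2 ^ R.2.1)⁻¹ * ∫ x in rect R, f x := by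
  rw [averages, setAverage_eq, volume_real_rect, smul_eq_mul]

lemma averages_indicator {A : Set (ℝ × ℝ)} (hA : MeasurableSet A) (R : DyadicRect) :
    averages (A.indicator 1) R = density A R := by
  rw [averages_eq, setIntegral_indicator hA]
  simp only [Pi.one_apply, integral_const, smul_eq_mul, mul_one]
  rw [density, measureReal_restrict_apply_univ, Set.inter_comm, div_eq_inv_mul]

lemma averages_sub {f g : ℝ × ℝ → ℝ} (hf : Integrable f) (hg : Integrable g) (R : DyadicRect) :
    averages (fun x => f x - g x) R = averages f R - averages g R := by
  rw [averages_eq, averages_eq, averages_eq, integral_sub hf.integrableOn hg.integrableOn]; ring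

lemma averages_finset_sum {ι : Type*} (s : Finset ι) (c : ι → ℝ) {f : ι → ℝ × ℝ → ℝ}
    (hf : ∀ i ∈ s, Integrable (f i)) (R : DyadicRect) :
    averages (fun x => ∑ i ∈ s, c i * f i x) R = ∑ i ∈ s, c i * averages (f i) R := by
  simp_rw [averages_eq]
  rw [integral_finsetSum s fun i hi => ((hf i hi).integrableOn.const_mul _), Finset.mul_sum]
  refine Finset.sum_congr rfl fun i _ => ?_
  rw [integral_const_mul]; ring

/-- The localisation that makes the p-integrability of the test functions possible for small p: the
maximal function of a partial sum vanishes off the union of the rectangles in `D`. -/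
lemma exists_subset_of_averages_haarSum_ne_zero {A : Set (ℝ × ℝ)} {D : Finset DyadicRect}
    {R : DyadicRect} (h : averages (haarSum A D) R ≠ 0) : ∃ R' ∈ D, rect R ⊆ rect R' := by
  by_contra hc
  push Not at hc
  refine h ?_
  have := averages_finset_sum D (haarCoeff A) (f := haarRect) (fun R _ => integrable_haarRect R) R
  unfold haarSum
  rw [this]
  refine Finset.sum_eq_zero fun R' hR' => ?_
  rw [averages_eq, setIntegral_haarRect_eq_zero (hc R' hR'), mul_zero, mul_zero]

lemma ofReal_abs_averages_le {f : ℝ × ℝ → ℝ} (R : DyadicRect) :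
    ENNReal.ofReal |averages f R| ≤ (∫⁻ x in rect R, ‖f x‖ₑ) / volume (rect R) := by
  rw [averages, setAverage_eq, smul_eq_mul, abs_mul, ENNReal.ofReal_mul (abs_nonneg _),
    abs_of_nonneg (by positivity), ENNReal.div_eq_inv_mul]
  gcongr
  · rw [ENNReal.ofReal_inv_of_pos]
    · rw [measureReal_def, ENNReal.ofReal_toReal (volume_rect_ne_top R)]
    · rw [volume_real_rect]; positivity
  · rw [← Real.enorm_eq_ofReal_abs]
    exact enorm_integral_le_lintegral_enorm _

lemma maximal_averages_le_strongMax (f : ℝ × ℝ → ℝ) (x : ℝ × ℝ) :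
    maximal (averages f) x ≤ strongMax (fun y => ‖f y‖ₑ) x :=
  iSup₂_mono fun R _ => ofReal_abs_averages_le R

lemma lintegral_indicator_div_eq {A : Set (ℝ × ℝ)} (hA : MeasurableSet A) (R : DyadicRect) :
    (∫⁻ x in rect R, A.indicator 1 x) / volume (rect R) = ENNReal.ofReal (density A R) := by
  rw [lintegral_indicator_one hA, Measure.restrict_apply hA, density, ← volume_real_rect,
    measureReal_def, measureReal_def, ENNReal.ofReal_div_of_pos,
    ENNReal.ofReal_toReal (volume_inter_rect_ne_top A R),
    ENNReal.ofReal_toReal (volume_rect_ne_top R)]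
  exact ENNReal.toReal_pos (volume_rect_ne_zero R) (volume_rect_ne_top R)

lemma ofReal_density_le_strongMax {A : Set (ℝ × ℝ)} (hA : MeasurableSet A) {R : DyadicRect}
    {x : ℝ × ℝ} (hx : x ∈ rect R) :
    ENNReal.ofReal (density A R) ≤ strongMax (A.indicator 1) x := by
  rw [← lintegral_indicator_div_eq hA]
  exact lintegral_rect_div_le_strongMax _ hx

/-- The constant in the bi-parameter maximal theorem. -/
def strongMaxConst (s : ℝ) : ℝ≥0∞ := maxConst s * maxConst s

lemma strongMaxConst_ne_top {s : ℝ} (hs : 1 < s) : strongMaxConst s ≠ ∞ :=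
  ENNReal.mul_ne_top (maxConst_ne_top hs) (maxConst_ne_top hs)

lemma lintegral_strongMax_le {s : ℝ} (hs : 1 < s) {f : ℝ × ℝ → ℝ≥0∞} (hf : Measurable f) :
    ∫⁻ x, strongMax f x ^ s ≤ strongMaxConst s * ∫⁻ x, f x ^ s := by
  rw [strongMaxConst, mul_assoc]; exact lintegral_strongMax_rpow_le hs hf

lemma lintegral_strongMax_indicator_le {s : ℝ} (hs : 1 < s) {A : Set (ℝ × ℝ)}
    (hA : MeasurableSet A) :
    ∫⁻ x, strongMax (A.indicator 1) x ^ s ≤ strongMaxConst s * volume A := by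
  refine (lintegral_strongMax_le hs (measurable_one.indicator hA)).trans (le_of_eq ?_)
  congr 1
  rw [← lintegral_indicator_one hA]
  congr 1; ext x
  by_cases hx : x ∈ A <;> simp [hx, lt_trans zero_lt_one hs]

lemma volume_le_of_le_rpow {U : Set (ℝ × ℝ)} {f : ℝ × ℝ → ℝ≥0∞} (hf : Measurable f) {c : ℝ≥0∞}
    (hc0 : c ≠ 0) (hct : c ≠ ∞) {s : ℝ} (hs : 0 < s) (hU : ∀ x ∈ U, c ≤ f x) :
    volume U ≤ (c ^ s)⁻¹ * ∫⁻ x, f x ^ s := by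
  have h0 : c ^ s ≠ 0 := by simp [ENNReal.rpow_eq_zero_iff, hc0, hs.le]
  have ht : c ^ s ≠ ∞ := ENNReal.rpow_ne_top_of_nonneg hs.le hct
  rw [← ENNReal.div_eq_inv_mul]
  refine le_trans (measure_mono fun x hx => ?_)
    (meas_ge_le_lintegral_div (hf.pow_const s).aemeasurable h0 ht)
  exact ENNReal.rpow_le_rpow (hU x hx) hs.le

/-! ### Test functions -/

lemma lintegral_enorm_rpow_two {f : ℝ × ℝ → ℝ} (hf : Integrable fun x => f x ^ 2) :
    ∫⁻ x, ‖f x‖ₑ ^ (2 : ℝ) = ENNReal.ofReal (∫ x, f x ^ 2) := by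
  rw [ofReal_integral_eq_lintegral_ofReal hf (Eventually.of_forall fun x => sq_nonneg _)]
  congr 1; ext x
  rw [Real.enorm_eq_ofReal_abs, ENNReal.rpow_two, ← ENNReal.ofReal_pow (abs_nonneg _), sq_abs]

lemma lintegral_strongMax_sq_le {f : ℝ × ℝ → ℝ} (hf : Integrable f)
    (hf2 : Integrable fun x => f x ^ 2) :
    ∫⁻ x, strongMax (fun y => ‖f y‖ₑ) x ^ (2 : ℝ) ≤
      strongMaxConst 2 * ENNReal.ofReal (∫ x, f x ^ 2) := by
  -- The maximal theorem is stated for measurable functions, so a measurable representative is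
  -- taken; the averages do not change.
  obtain ⟨f', hf'm, hff'⟩ := hf.aemeasurable
  have h1 : strongMax (fun y => ‖f y‖ₑ) = strongMax (fun y => ‖f' y‖ₑ) := by
    ext x
    unfold strongMax
    congr 1; ext R; congr 1; ext _; congr 1
    refine lintegral_congr_ae (ae_restrict_of_ae ?_)
    filter_upwards [hff'] with y hy
    rw [hy]
  have h2 : ∫⁻ x, ‖f' x‖ₑ ^ (2 : ℝ) = ∫⁻ x, ‖f x‖ₑ ^ (2 : ℝ) := by
    refine lintegral_congr_ae ?_
    filter_upwards [hff'] with y hy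
    rw [hy]
  rw [h1, ← lintegral_enorm_rpow_two hf2, ← h2]
  exact lintegral_strongMax_le (by norm_num) hf'm.enorm

/-- Smallness of the set where the maximal function is large, at a suitable level. -/
lemma exists_level_energy_le {θ : ℝ≥0∞} (hθ : θ ≠ 0) :
    ∃ e : ℝ, 0 < e ∧ e < 1 ∧ ∀ A : Set (ℝ × ℝ), MeasurableSet A →
      1008 * ENNReal.ofReal (e ^ 2) *
        volume {x | ENNReal.ofReal e < strongMax (A.indicator 1) x} ≤ θ * volume A := by
  set κ := strongMaxConst (3 / 2)
  have hκ : κ ≠ ∞ := strongMaxConst_ne_top (by norm_num)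
  set t : ℝ≥0∞ := min (1 / 2) (θ / (1008 * κ + 1))
  have ht0 : t ≠ 0 := by
    have h1 : θ / (1008 * κ + 1) ≠ 0 := by
      simp only [ne_eq, ENNReal.div_eq_zero_iff, not_or]
      exact ⟨hθ, ENNReal.add_ne_top.2 ⟨ENNReal.mul_ne_top (by simp) hκ, by simp⟩⟩
    have : 0 < t := lt_min (by simp) (pos_iff_ne_zero.2 h1)
    exact this.ne'
  have htt : t ≠ ∞ := ne_top_of_le_ne_top (by simp) (min_le_left _ _)
  have hthalf : t.toReal ≤ 1 / 2 := by
    have := ENNReal.toReal_mono (by simp) (min_le_left (1 / 2 : ℝ≥0∞) (θ / (1008 * κ + 1)))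
    exact this.trans_eq (by simp)
  have htpos : 0 < t.toReal := ENNReal.toReal_pos ht0 htt
  have hκt : 1008 * κ * t ≤ θ := by
    calc 1008 * κ * t ≤ (1008 * κ + 1) * (θ / (1008 * κ + 1)) := by
          gcongr
          · exact le_self_add
          · exact min_le_right _ _
      _ ≤ θ := ENNReal.mul_div_le
  -- With e = t², the maximal theorem in L^{3/2} gives |U| ≤ κ t^{-3} |A|, so e²|U| ≤ κ t |A|. Any
  -- exponent strictly between 1 and 2 would leave a positive power of t; 3/2 makes the powers
  -- integers.
  refine ⟨t.toReal ^ 2, by positivity, by nlinarith, fun A hA => ?_⟩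
  have he : ENNReal.ofReal (t.toReal ^ 2) = t ^ 2 := by
    rw [ENNReal.ofReal_pow htpos.le, ENNReal.ofReal_toReal htt]
  have hvol := volume_le_of_le_rpow (measurable_strongMax (A.indicator 1))
    (c := t ^ 2) (by simpa using ht0) (by simpa using htt) (s := 3 / 2) (by norm_num)
    (U := {x | ENNReal.ofReal (t.toReal ^ 2) < strongMax (A.indicator 1) x})
    (fun x hx => by rw [← he]; exact le_of_lt hx)
  have hmax := lintegral_strongMax_indicator_le (s := 3 / 2) (by norm_num) hA
  have hp : (t ^ 2) ^ (3 / 2 : ℝ) = t ^ 3 := by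
    rw [← ENNReal.rpow_natCast, ← ENNReal.rpow_mul, ← ENNReal.rpow_natCast]; norm_num
  rw [hp] at hvol
  have hsq : ENNReal.ofReal ((t.toReal ^ 2) ^ 2) = t * t ^ 3 := by
    rw [ENNReal.ofReal_pow (by positivity), he]; ring
  rw [hsq]
  calc _ ≤ 1008 * (t * t ^ 3) * ((t ^ 3)⁻¹ * (κ * volume A)) := by
        gcongr; exact hvol.trans (by gcongr)
    _ = 1008 * κ * t * volume A * (t ^ 3 * (t ^ 3)⁻¹) := by ring
    _ = 1008 * κ * t * volume A := by
        rw [ENNReal.mul_inv_cancel (by simpa using ht0) (by simpa using htt), mul_one]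
    _ ≤ _ := by gcongr

/-- A finite piece of the Haar series of `χ_A` which carries almost all of the energy and consists
of rectangles with a large density in a set of measure comparable to that of `A`. -/
lemma exists_haarSum_approx {θ : ℝ≥0∞} (hθ : θ ≠ 0) (hθt : θ ≠ ∞) :
    ∃ C : ℝ≥0∞, C ≠ ∞ ∧ ∀ (z : ℤ) (A : Set (ℝ × ℝ)), IsCellUnion z A → volume A ≠ ∞ →
      ∃ (U : Set (ℝ × ℝ)) (D : Finset DyadicRect), MeasurableSet U ∧ volume U ≤ C * volume A ∧
        (∀ R ∈ D, 1 / 2 < density U R) ∧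
        volume A ≤ ENNReal.ofReal (∑ R ∈ D, haarEnergy A R) + 2 * θ * volume A := by
  obtain ⟨e, he0, he1, he⟩ := exists_level_energy_le hθ
  refine ⟨(1008 * ENNReal.ofReal (e ^ 2))⁻¹ * θ, ?_, fun z A hcell hAt => ?_⟩
  · refine ENNReal.mul_ne_top ?_ hθt
    rw [ENNReal.inv_ne_top]
    refine mul_ne_zero (by simp) ?_
    simpa using by positivity
  have hA := isCellUnion_measurableSet hcell
  set U := {x | ENNReal.ofReal e < strongMax (A.indicator 1) x} with hU
  have hUm : MeasurableSet U := measurableSet_lt measurable_const (measurable_strongMax _)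
  by_cases hA0 : volume A = 0
  · exact ⟨∅, ∅, MeasurableSet.empty, by simp, by simp, by simp [hA0]⟩
  have hAU : A ⊆ U := by
    intro x hx
    obtain ⟨k, hk⟩ := exists_mem_dyadicInterval z x.1
    obtain ⟨l, hl⟩ := exists_mem_dyadicInterval z x.2
    have hmem : x ∈ rect ((z, k), (z, l)) := ⟨hk, hl⟩
    have hsub : rect ((z, k), (z, l)) ⊆ A := by
      rcases hcell k l with h | h
      · exact h
      · exact absurd hx (Set.disjoint_left.1 h hmem)
    refine lt_of_lt_of_le ?_ (ofReal_density_le_strongMax hA hmem)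
    rw [density_eq_one hsub]
    exact (ENNReal.ofReal_lt_ofReal_iff one_pos).2 he1
  have hsmall : ∀ R, ¬ rect R ⊆ U → density A R ≤ e := by
    intro R hR
    obtain ⟨x, hx, hxU⟩ := Set.not_subset.1 hR
    have h1 := (ofReal_density_le_strongMax hA hx).trans (not_lt.1 hxU)
    exact (ENNReal.ofReal_le_ofReal_iff he0.le).1 h1
  have hmain := volume_le_tsum_haarEnergy hAt hcell hUm hAU hsmall
  set F : DyadicRect → ℝ≥0∞ := fun R => {R | 1 / 2 < density U R}.indicator
      (fun R => ENNReal.ofReal (haarEnergy A R)) R with hF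
  have hmain2 : volume A ≤ ∑' R, F R + θ * volume A := hmain.trans (add_le_add le_rfl (he A hA))
  -- The full sum misses at most θ|A|. If every finite sum missed more than 2θ|A|, the full sum
  -- would miss at least 2θ|A|, which is impossible when 0 < |A| < ∞.
  obtain ⟨s, hs⟩ : ∃ s : Finset DyadicRect, volume A ≤ ∑ R ∈ s, F R + 2 * θ * volume A := by
    by_contra hc
    push Not at hc
    have h1 : ∑' R, F R + 2 * θ * volume A ≤ volume A := by
      rw [ENNReal.tsum_eq_iSup_sum, ENNReal.iSup_add]
      exact iSup_le fun s => (hc s).le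
    have h2 := h1.trans hmain2
    have hFt : ∑' R, F R ≠ ∞ := ne_top_of_le_ne_top hAt (le_self_add.trans h1)
    have h3 : 2 * θ * volume A ≤ θ * volume A := (ENNReal.add_le_add_iff_left hFt).1 h2
    have h4 : θ * volume A ≠ ∞ := ENNReal.mul_ne_top hθt hAt
    have h5 : θ * volume A + θ * volume A ≤ 0 + θ * volume A := by
      rw [zero_add, ← two_mul, ← mul_assoc]; exact h3
    have h6 := (ENNReal.add_le_add_iff_right h4).1 h5
    simp [hθ, hA0] at h6
  classical
  refine ⟨U, s.filter fun R => 1 / 2 < density U R, hUm, ?_, by simp, ?_⟩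
  · rw [mul_assoc, ← ENNReal.div_eq_inv_mul, ENNReal.le_div_iff_mul_le, mul_comm]
    · exact he A hA
    · exact Or.inl (mul_ne_zero (by simp) (by simpa using by positivity))
    · exact Or.inl (ENNReal.mul_ne_top (by simp) ENNReal.ofReal_ne_top)
  · refine hs.trans (le_of_eq ?_)
    congr 1
    rw [ENNReal.ofReal_sum_of_nonneg fun R _ => haarEnergy_nonneg A R, Finset.sum_filter]
    refine Finset.sum_congr rfl fun R _ => ?_
    simp only [hF, Set.indicator, Set.mem_ofPred_eq]

/-- `f` and `B` are test data for the set `A`: the averages of `f` are large on the rectangles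
which are mostly inside `A`, except those inside the small set `B`. -/
structure IsTest (η : ℝ≥0∞) (A B : Set (ℝ × ℝ)) (f : ℝ × ℝ → ℝ) : Prop where
  integrable : Integrable f
  volume_le : volume B ≤ η * volume A
  le_averages : ∀ R, 1 / 2 < density A R → 1 / 4 ≤ |averages f R| ∨ rect R ⊆ B

/-- The test function is the finite Haar sum of `exists_haarSum_approx`. It is close to χ_A in L²,
which gives the lower bound on averages off a small set, and its maximal function has support of
measure ≲ |A|, which turns the L² bound into an L^p bound for p < 2. -/
lemma exists_isTest_of_lt_two {p : ℝ} (hp : 0 < p) (hp2 : p < 2) {η : ℝ≥0∞} (hη : η ≠ 0) :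
    ∃ C : ℝ≥0∞, C ≠ ∞ ∧ ∀ (z : ℤ) (A : Set (ℝ × ℝ)), IsCellUnion z A → volume A ≠ ∞ →
      ∃ f B, IsTest η A B f ∧ ∫⁻ x, maximal (averages f) x ^ p ≤ C * volume A := by
  set κ := strongMaxConst 2
  have hκ : κ ≠ ∞ := strongMaxConst_ne_top (by norm_num)
  set θ : ℝ≥0∞ := min 1 (η / (32 * κ + 1))
  have hθ : θ ≠ 0 := by
    have h1 : η / (32 * κ + 1) ≠ 0 := by
      simp only [ne_eq, ENNReal.div_eq_zero_iff, not_or]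
      exact ⟨hη, ENNReal.add_ne_top.2 ⟨ENNReal.mul_ne_top (by simp) hκ, by simp⟩⟩
    have : 0 < θ := lt_min (by simp) (pos_iff_ne_zero.2 h1)
    exact this.ne'
  have hθt : θ ≠ ∞ := ne_top_of_le_ne_top (by simp) (min_le_left _ _)
  have hκθ : 32 * κ * θ ≤ η := by
    calc 32 * κ * θ ≤ (32 * κ + 1) * (η / (32 * κ + 1)) := by
          gcongr
          · exact le_self_add
          · exact min_le_right _ _
      _ ≤ η := ENNReal.mul_div_le
  obtain ⟨C, hC, hmain⟩ := exists_haarSum_approx hθ hθt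
  refine ⟨κ ^ (p / 2) * (4 * (κ * C)) ^ (1 - p / 2), ?_, fun z A hcell hAt => ?_⟩
  · exact ENNReal.mul_ne_top (ENNReal.rpow_ne_top_of_nonneg (by positivity) hκ)
      (ENNReal.rpow_ne_top_of_nonneg (by linarith)
        (ENNReal.mul_ne_top (by simp) (ENNReal.mul_ne_top hκ hC)))
  obtain ⟨U, D, hU, hUvol, hD, hE⟩ := hmain z A hcell hAt
  have hA := isCellUnion_measurableSet hcell
  set f := haarSum A D with hf
  set Q : ℝ × ℝ → ℝ := fun x => A.indicator 1 x - f x with hQ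
  have hfi : Integrable f := integrable_haarSum A D
  have h1A := integrable_indicator_one hA hAt
  have hQi : Integrable Q := h1A.sub hfi
  obtain ⟨hQ2i, hQ2⟩ := integral_sub_haarSum_sq hA hAt D
  have hQ2le : ENNReal.ofReal (∫ x, Q x ^ 2) ≤ 2 * θ * volume A := by
    simp only [hQ, hf]
    rw [hQ2, ENNReal.ofReal_sub _ (Finset.sum_nonneg fun R _ => haarEnergy_nonneg A R),
      measureReal_def, ENNReal.ofReal_toReal hAt, tsub_le_iff_left]
    exact hE
  have hf2i : Integrable fun x => f x ^ 2 := by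
    simp_rw [sq]; exact integrable_haarSum_mul_self A D
  have hf2le : ENNReal.ofReal (∫ x, f x ^ 2) ≤ volume A := by
    have h1 : ∫ x, f x ^ 2 = ∑ R ∈ D, haarEnergy A R := by
      simp_rw [sq]; exact integral_haarSum_mul_self A D
    have h2 : 0 ≤ ∫ x, (A.indicator 1 x - haarSum A D x) ^ 2 :=
      integral_nonneg fun x => sq_nonneg _
    rw [hQ2] at h2
    rw [h1]
    refine (ENNReal.ofReal_le_ofReal (sub_nonneg.1 h2)).trans (le_of_eq ?_)
    rw [measureReal_def, ENNReal.ofReal_toReal hAt]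
  -- With Q = χ_A - f, Chebyshev and the L² maximal theorem give |B| ≤ 16 · κ · 2θ|A|, which
  -- explains the 32 in the choice of θ. A rectangle not inside B has |⟨Q⟩_R| < 1/4, and 1/2 - 1/4 =
  -- 1/4.
  set B := {x | (1 / 4 : ℝ≥0∞) ≤ strongMax (fun y => ‖Q y‖ₑ) x} with hB
  refine ⟨f, B, ⟨hfi, ?_, ?_⟩, ?_⟩
  · have h1 := volume_le_of_le_rpow (measurable_strongMax fun y => ‖Q y‖ₑ) (c := 1 / 4) (by simp)
      (by simp) (s := 2) (by norm_num) (U := B) (fun x hx => hx)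
    have h2 := lintegral_strongMax_sq_le hQi hQ2i
    have h3 : (((1 : ℝ≥0∞) / 4) ^ (2 : ℝ))⁻¹ = 16 := by
      rw [ENNReal.rpow_two, one_div, ENNReal.inv_pow, inv_inv]; norm_num
    rw [h3] at h1
    calc volume B ≤ 16 * (κ * (2 * θ * volume A)) :=
        h1.trans (by gcongr; exact h2.trans (by gcongr))
      _ = 32 * κ * θ * volume A := by ring
      _ ≤ _ := by gcongr
  · intro R hR
    by_cases hQR : |averages Q R| < 1 / 4
    · left
      have h1 : averages Q R = density A R - averages f R := by
        rw [← averages_indicator hA, ← averages_sub h1A hfi]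
      rw [h1] at hQR
      have h2 := (abs_lt.1 hQR).2
      exact le_trans (by linarith) (le_abs_self _)
    · right
      intro x hx
      have h1 := (ofReal_abs_averages_le (f := Q) R).trans (lintegral_rect_div_le_strongMax _ hx)
      refine le_trans ?_ h1
      refine le_trans (le_of_eq ?_) (ENNReal.ofReal_le_ofReal (not_lt.1 hQR))
      rw [ENNReal.ofReal_div_of_pos (by norm_num)]; simp
  -- V contains every rectangle of `D`, hence the support of the maximal function of f.
  · set V := {x | (1 / 2 : ℝ≥0∞) ≤ strongMax (U.indicator 1) x} with hV
    have hVm : MeasurableSet V := measurableSet_le measurable_const (measurable_strongMax _)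
    have hVvol : volume V ≤ 4 * (κ * C) * volume A := by
      have h1 := volume_le_of_le_rpow (measurable_strongMax (U.indicator 1)) (c := 1 / 2) (by simp)
        (by simp) (s := 2) (by norm_num) (U := V) (fun x hx => hx)
      have h3 : (((1 : ℝ≥0∞) / 2) ^ (2 : ℝ))⁻¹ = 4 := by
        rw [ENNReal.rpow_two, one_div, ENNReal.inv_pow, inv_inv]; norm_num
      rw [h3] at h1
      calc volume V ≤ 4 * (κ * (C * volume A)) := h1.trans (by
            gcongr
            exact (lintegral_strongMax_indicator_le (by norm_num) hU).trans (by gcongr))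
        _ = _ := by ring
    have hzero : ∀ x ∉ V, maximal (averages f) x = 0 := by
      intro x hx
      rw [← nonpos_iff_eq_zero]
      refine iSup₂_le fun R hR => ?_
      by_contra hne
      have hne' : averages f R ≠ 0 := fun h => hne (by simp [h])
      obtain ⟨R', hR'D, hsub⟩ := exists_subset_of_averages_haarSum_ne_zero hne'
      refine hx ?_
      refine le_trans ?_ (ofReal_density_le_strongMax hU (hsub hR))
      refine le_trans (le_of_eq ?_) (ENNReal.ofReal_le_ofReal (hD R' hR'D).le)
      rw [ENNReal.ofReal_div_of_pos (by norm_num)]; simp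
    have hm := measurable_maximal (averages f)
    have hM2 : ∫⁻ x, maximal (averages f) x ^ (2 : ℝ) ≤ κ * volume A := by
      refine le_trans ?_ ((lintegral_strongMax_sq_le hfi hf2i).trans (by gcongr))
      gcongr with x
      exact maximal_averages_le_strongMax f x
    calc ∫⁻ x, maximal (averages f) x ^ p
        ≤ ∫⁻ x, (maximal (averages f) x ^ (2 : ℝ)) ^ (p / 2) * (V.indicator 1 x) ^ (1 - p / 2) := by
          refine lintegral_mono fun x => ?_
          by_cases hx : x ∈ V
          · rw [Set.indicator_of_mem hx, ← ENNReal.rpow_mul]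
            simp only [Pi.one_apply, ENNReal.one_rpow, mul_one]
            rw [mul_div_cancel₀ _ two_ne_zero]
          · rw [hzero x hx, ENNReal.zero_rpow_of_pos hp]; exact zero_le
      _ ≤ (∫⁻ x, maximal (averages f) x ^ (2 : ℝ)) ^ (p / 2) *
          (∫⁻ x, V.indicator 1 x) ^ (1 - p / 2) :=
          ENNReal.lintegral_mul_norm_pow_le (hm.pow_const _).aemeasurable
            (measurable_one.indicator hVm).aemeasurable (by positivity) (by linarith) (by ring)
      _ ≤ (κ * volume A) ^ (p / 2) * (4 * (κ * C) * volume A) ^ (1 - p / 2) := by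
          rw [lintegral_indicator_one hVm]
          gcongr
          linarith
      _ = κ ^ (p / 2) * (4 * (κ * C)) ^ (1 - p / 2) *
          (volume A ^ (p / 2) * volume A ^ (1 - p / 2)) := by
          rw [ENNReal.mul_rpow_of_nonneg _ _ (by positivity),
            ENNReal.mul_rpow_of_nonneg _ _ (by linarith)]
          ring
      _ = _ := by
          rw [← ENNReal.rpow_add_of_nonneg _ _ (by positivity) (by linarith)]
          simp

/-! ### Families of test functions and random signs -/

lemma ennreal_sum_rpow_le {ι : Type*} (s : Finset ι) (f : ι → ℝ≥0∞) {p : ℝ} (hp : 0 < p)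
    (hp1 : p ≤ 1) : (∑ i ∈ s, f i) ^ p ≤ ∑ i ∈ s, f i ^ p :=
  Finset.le_sum_of_subadditive (fun x : ℝ≥0∞ => x ^ p) (by simp [hp])
    (fun a b => ENNReal.rpow_add_le_add_rpow a b hp.le hp1) s f

lemma maximal_finset_sum_le {ι : Type*} (s : Finset ι) (c : ι → ℝ) (a : ι → DyadicRect → ℝ)
    (x : ℝ × ℝ) : maximal (fun R => ∑ i ∈ s, c i * a i R) x ≤
      ∑ i ∈ s, ENNReal.ofReal |c i| * maximal (a i) x := by
  refine iSup₂_le fun R hR => ?_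
  calc ENNReal.ofReal |∑ i ∈ s, c i * a i R|
      ≤ ENNReal.ofReal (∑ i ∈ s, |c i| * |a i R|) := by
        refine ENNReal.ofReal_le_ofReal ((Finset.abs_sum_le_sum_abs _ _).trans (le_of_eq ?_))
        simp_rw [abs_mul]
    _ = ∑ i ∈ s, ENNReal.ofReal |c i| * ENNReal.ofReal |a i R| := by
        rw [ENNReal.ofReal_sum_of_nonneg fun i _ => by positivity]
        simp_rw [ENNReal.ofReal_mul (abs_nonneg _)]
    _ ≤ _ := by
        gcongr with i
        exact ofReal_abs_le_maximal (a i) hR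

lemma ofReal_two_rpow (x : ℝ) : ENNReal.ofReal ((2 : ℝ) ^ x) = 2 ^ x := by
  rw [← ENNReal.ofReal_rpow_of_pos (by norm_num)]; simp

lemma strongMax_mono {f g : ℝ × ℝ → ℝ≥0∞} (h : ∀ x, f x ≤ g x) (x : ℝ × ℝ) :
    strongMax f x ≤ strongMax g x := by
  refine iSup₂_mono fun R _ => ?_
  gcongr with y
  exact h y

/-- At a fixed point the sum of the 2^{kt} is geometric, hence dominated by its largest term, whose
p-th power is one of the terms on the right. -/
lemma sum_level_indicator_rpow_le {t p : ℝ} (hp : 0 < p) (W : Finset ℤ)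
    (A : ℤ → Set (ℝ × ℝ)) (x : ℝ × ℝ) :
    (∑ k ∈ W, (A k).indicator (fun _ => (2 : ℝ≥0∞) ^ ((k : ℝ) * t)) x) ^ p ≤
      geoConst t ^ p * ∑ k ∈ W, (A k).indicator (fun _ => (2 : ℝ≥0∞) ^ ((k : ℝ) * (t * p))) x := by
  classical
  set S := W.filter fun k => x ∈ A k with hS
  have hsum : ∀ f : ℤ → ℝ≥0∞, ∑ k ∈ W, (A k).indicator (fun _ => f k) x = ∑ k ∈ S, f k := by
    intro f
    rw [hS, Finset.sum_filter]
    refine Finset.sum_congr rfl fun k _ => ?_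
    by_cases hk : x ∈ A k <;> simp [hk]
  rw [hsum, hsum]
  rcases S.eq_empty_or_nonempty with h | h
  · simp [h, hp]
  · set n := S.max' h
    have h1 : ∑ k ∈ S, (2 : ℝ≥0∞) ^ ((k : ℝ) * t) ≤ 2 ^ ((n : ℝ) * t) * geoConst t := by
      rw [← tsum_int_le_geo]
      refine le_trans (Finset.sum_le_sum fun k hk => ?_) (ENNReal.sum_le_tsum S)
      rw [if_pos (S.le_max' k hk)]
    calc _ ≤ (2 ^ ((n : ℝ) * t) * geoConst t) ^ p := by gcongr
      _ = geoConst t ^ p * 2 ^ ((n : ℝ) * (t * p)) := by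
          rw [ENNReal.mul_rpow_of_nonneg _ _ hp.le, ← ENNReal.rpow_mul, mul_comm, mul_assoc]
      _ ≤ _ := by
          gcongr
          exact Finset.single_le_sum (f := fun k : ℤ => (2 : ℝ≥0∞) ^ ((k : ℝ) * (t * p)))
            (fun _ _ => zero_le) (S.max'_mem h)

/-- Simultaneous test functions for a family of sets, with a bound for all combinations. -/
lemma exists_test_family {p r : ℝ} (hp : 0 < p) (hr : 0 < r) {η : ℝ≥0∞} (hη : η ≠ 0) :
    ∃ C : ℝ≥0∞, C ≠ ∞ ∧ ∀ (z : ℤ) (W : Finset ℤ) (A : ℤ → Set (ℝ × ℝ)),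
      (∀ k, IsCellUnion z (A k)) → (∀ k, volume (A k) ≠ ∞) →
      ∃ (f : ℤ → ℝ × ℝ → ℝ) (B : ℤ → Set (ℝ × ℝ)), (∀ k, IsTest η (A k) (B k) (f k)) ∧
        ∀ σ : ℤ → ℝ, (∀ k, |σ k| ≤ 1) →
          ∫⁻ x, maximal (averages fun x =>
            ∑ k ∈ W, (σ k * (2 : ℝ) ^ ((k : ℝ) * (r / p))) * f k x) x ^ p ≤
          C * ∑ k ∈ W, 2 ^ ((k : ℝ) * r) * volume (A k) := by
  have habs : ∀ (σ : ℤ → ℝ), (∀ k, |σ k| ≤ 1) → ∀ k : ℤ,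
      |σ k * (2 : ℝ) ^ ((k : ℝ) * (r / p))| ≤ (2 : ℝ) ^ ((k : ℝ) * (r / p)) := fun σ hσ k => by
    rw [abs_mul, abs_of_pos (by positivity : (0 : ℝ) < 2 ^ ((k : ℝ) * (r / p)))]
    exact mul_le_of_le_one_left (by positivity) (hσ k)
  rcases le_or_gt p 1 with hp1 | hp1
  -- For p ≤ 1 the p-th power is subadditive, so the separate bounds for the f_k add up for any
  -- signs.
  · obtain ⟨C, hC, h⟩ := exists_isTest_of_lt_two hp (by linarith) hη
    refine ⟨C, hC, fun z W A hcell hAt => ?_⟩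
    choose f B hfB hM using fun k => h z (A k) (hcell k) (hAt k)
    refine ⟨f, B, hfB, fun σ hσ => ?_⟩
    have hav : (averages fun x => ∑ k ∈ W, (σ k * (2 : ℝ) ^ ((k : ℝ) * (r / p))) * f k x) =
        fun R => ∑ k ∈ W, (σ k * (2 : ℝ) ^ ((k : ℝ) * (r / p))) * averages (f k) R := by
      ext R
      exact averages_finset_sum W _ (fun k _ => (hfB k).integrable) R
    rw [hav]
    calc _ ≤ ∫⁻ x, ∑ k ∈ W, (2 : ℝ≥0∞) ^ ((k : ℝ) * r) * maximal (averages (f k)) x ^ p := by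
          refine lintegral_mono fun x => ?_
          refine (ENNReal.rpow_le_rpow (maximal_finset_sum_le W _ _ x) hp.le).trans ?_
          refine (ennreal_sum_rpow_le W _ hp hp1).trans (Finset.sum_le_sum fun k _ => ?_)
          rw [ENNReal.mul_rpow_of_nonneg _ _ hp.le]
          gcongr
          calc _ ≤ (ENNReal.ofReal ((2 : ℝ) ^ ((k : ℝ) * (r / p)))) ^ p := by
                gcongr; exact habs σ hσ k
            _ = _ := by
                rw [ofReal_two_rpow, ← ENNReal.rpow_mul]
                congr 1; field_simp
      _ = ∑ k ∈ W, (2 : ℝ≥0∞) ^ ((k : ℝ) * r) * ∫⁻ x, maximal (averages (f k)) x ^ p := by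
          rw [lintegral_finsetSum W fun k _ => ((measurable_maximal _).pow_const p).const_mul _]
          refine Finset.sum_congr rfl fun k _ => ?_
          rw [lintegral_const_mul' _ _ (two_rpow_ne_top _)]
      _ ≤ ∑ k ∈ W, (2 : ℝ≥0∞) ^ ((k : ℝ) * r) * (C * volume (A k)) := by
          gcongr with k; exact hM k
      _ = _ := by
          rw [Finset.mul_sum]
          exact Finset.sum_congr rfl fun k _ => by ring
  -- For p > 1 the indicators themselves are used, with empty exceptional sets, and the maximal
  -- theorem in L^p bounds the combination.
  · have ht : 0 < r / p := by positivity
    refine ⟨strongMaxConst p * geoConst (r / p) ^ p, ENNReal.mul_ne_top (strongMaxConst_ne_top hp1)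
      (ENNReal.rpow_ne_top_of_nonneg hp.le (geoConst_ne_top ht)), fun z W A hcell hAt => ?_⟩
    have hAm := fun k => isCellUnion_measurableSet (hcell k)
    refine ⟨fun k => (A k).indicator 1, fun _ => ∅, fun k => ⟨integrable_indicator_one (hAm k)
      (hAt k), by simp, fun R hR => Or.inl ?_⟩, fun σ hσ => ?_⟩
    · rw [averages_indicator (hAm k), abs_of_nonneg (density_nonneg _ _)]
      linarith
    set H : ℝ × ℝ → ℝ≥0∞ := fun x => ∑ k ∈ W, (A k).indicator
      (fun _ => (2 : ℝ≥0∞) ^ ((k : ℝ) * (r / p))) x with hH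
    have hHm : Measurable H :=
      Finset.measurable_fun_sum W fun k _ => measurable_const.indicator (hAm k)
    have hle : ∀ x, ‖∑ k ∈ W, (σ k * (2 : ℝ) ^ ((k : ℝ) * (r / p))) *
        (A k).indicator (1 : ℝ × ℝ → ℝ) x‖ₑ ≤ H x := by
      intro x
      refine (enorm_sum_le _ _).trans (Finset.sum_le_sum fun k _ => ?_)
      by_cases hk : x ∈ A k
      · rw [Set.indicator_of_mem hk, Set.indicator_of_mem hk, Pi.one_apply, mul_one,
          Real.enorm_eq_ofReal_abs, ← ofReal_two_rpow]
        exact ENNReal.ofReal_le_ofReal (habs σ hσ k)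
      · simp [hk]
    calc _ ≤ ∫⁻ x, strongMax H x ^ p := by
          gcongr with x
          exact (maximal_averages_le_strongMax _ x).trans (strongMax_mono hle x)
      _ ≤ strongMaxConst p * ∫⁻ x, H x ^ p := lintegral_strongMax_le hp1 hHm
      _ ≤ strongMaxConst p * ∫⁻ x, geoConst (r / p) ^ p * ∑ k ∈ W, (A k).indicator
            (fun _ => (2 : ℝ≥0∞) ^ ((k : ℝ) * (r / p * p))) x := by
          gcongr with x
          exact sum_level_indicator_rpow_le hp W A x
      _ = _ := by
          rw [lintegral_const_mul' _ _ (ENNReal.rpow_ne_top_of_nonneg hp.le (geoConst_ne_top ht)),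
            lintegral_finsetSum W fun k _ => measurable_const.indicator (hAm k), ← mul_assoc]
          congr 1
          refine Finset.sum_congr rfl fun k _ => ?_
          rw [lintegral_indicator_const (hAm k), div_mul_cancel₀ _ hp.ne']

open scoped Classical in
/-- The choice of signs attached to a finite set. -/
def signOf (T : Finset ℤ) (k : ℤ) : ℝ := if k ∈ T then 1 else -1

lemma abs_signOf (T : Finset ℤ) (k : ℤ) : |signOf T k| ≤ 1 := by
  unfold signOf; split_ifs <;> simp

open scoped Classical in
-- Flipping the sign of the k-th term changes the sum by 2|b_k| in absolute value, so at least one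
-- of the two sums has absolute value at least |b_k|. Thus at least half of the sign choices are
-- good.
lemma card_powerset_le_two_mul (W : Finset ℤ) (b : ℤ → ℝ) {k : ℤ} (hk : k ∈ W) :
    W.powerset.card ≤
      2 * (W.powerset.filter fun T => |b k| ≤ |∑ j ∈ W, signOf T j * b j|).card := by
  set G := W.powerset.filter fun T => |b k| ≤ |∑ j ∈ W, signOf T j * b j| with hG
  set flip : Finset ℤ → Finset ℤ := fun T => symmDiff T {k} with hflip
  have hcov : W.powerset ⊆ G ∪ G.image flip := by
    intro T hT
    have hTW := Finset.mem_powerset.1 hT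
    have hflipT : flip T ∈ W.powerset := by
      rw [Finset.mem_powerset]
      intro j hj
      rw [hflip, Finset.mem_symmDiff] at hj
      rcases hj with h | h
      · exact hTW h.1
      · rw [Finset.mem_singleton.1 h.1]; exact hk
    have hff : flip (flip T) = T := by
      simp only [hflip]; exact symmDiff_symmDiff_cancel_right ({k} : Finset ℤ) T
    have hs : ∀ j, signOf (flip T) j = if j = k then -signOf T j else signOf T j := by
      intro j
      simp only [signOf, hflip, Finset.mem_symmDiff, Finset.mem_singleton]
      by_cases hj : j = k <;> by_cases hjT : j ∈ T <;> simp [hj, hjT] <;> simp_all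
    have hdiff : ∑ j ∈ W, signOf T j * b j - ∑ j ∈ W, signOf (flip T) j * b j =
        2 * signOf T k * b k := by
      rw [← Finset.sum_sub_distrib, Finset.sum_eq_single k]
      · rw [hs, if_pos rfl]; ring
      · intro j _ hj
        rw [hs, if_neg hj]; ring
      · exact fun h => absurd hk h
    have habs : |2 * signOf T k * b k| = 2 * |b k| := by
      rw [abs_mul, abs_mul]
      have : |signOf T k| = 1 := by unfold signOf; split_ifs <;> simp
      rw [this]; simp
    rw [Finset.mem_union]
    by_cases h1 : |b k| ≤ |∑ j ∈ W, signOf T j * b j|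
    · exact Or.inl (Finset.mem_filter.2 ⟨hT, h1⟩)
    · right
      refine Finset.mem_image.2 ⟨flip T, Finset.mem_filter.2 ⟨hflipT, ?_⟩, hff⟩
      have h2 := abs_sub (∑ j ∈ W, signOf T j * b j) (∑ j ∈ W, signOf (flip T) j * b j)
      rw [hdiff, habs] at h2
      linarith
  calc W.powerset.card ≤ (G ∪ G.image flip).card := Finset.card_le_card hcov
    _ ≤ G.card + (G.image flip).card := Finset.card_union_le G (G.image flip)
    _ ≤ G.card + G.card := Nat.add_le_add_left Finset.card_image_le _
    _ = _ := by ring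

/-- If values in [0, Z] have mean at least Z/2, at least a quarter of them are ≥ Z/4. This transfers
the lower bound to means of s-th powers for every s > 0, convex or not. -/
lemma card_mul_rpow_le_sum {ι : Type*} (P : Finset ι) (Y : ι → ℝ≥0∞) {Z : ℝ≥0∞} (hZ : Z ≠ ∞)
    (hY : ∀ i ∈ P, Y i ≤ Z) (hsum : P.card * Z ≤ 2 * ∑ i ∈ P, Y i) {s : ℝ} (hs : 0 < s) :
    P.card * Z ^ s ≤ 4 * 4 ^ s * ∑ i ∈ P, Y i ^ s := by
  classical
  by_cases hZ0 : Z = 0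
  · simp [hZ0, hs]
  set H := P.filter fun i => Z / 4 ≤ Y i with hH
  have h1 : ∑ i ∈ P, Y i ≤ H.card * Z + P.card * (Z / 4) := by
    rw [← Finset.sum_filter_add_sum_filter_not P (fun i => Z / 4 ≤ Y i)]
    refine add_le_add ?_ ?_
    · calc _ ≤ ∑ i ∈ H, Z := Finset.sum_le_sum fun i hi => hY i (Finset.mem_filter.1 hi).1
        _ = _ := by simp
    · calc _ ≤ ∑ i ∈ P.filter fun i => ¬ Z / 4 ≤ Y i, Z / 4 :=
            Finset.sum_le_sum fun i hi => (not_le.1 (Finset.mem_filter.1 hi).2).le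
        _ = ((P.filter fun i => ¬ Z / 4 ≤ Y i).card : ℝ≥0∞) * (Z / 4) := by simp
        _ ≤ _ := by gcongr; exact Finset.filter_subset _ _
  have hcard : P.card ≤ 4 * H.card := by
    have h2 : (P.card : ℝ≥0∞) * Z ≤ 2 * (H.card * Z + P.card * (Z / 4)) := hsum.trans (by gcongr)
    have h3 := ENNReal.toReal_mono (by finiteness) h2
    have hz : 0 < Z.toReal := ENNReal.toReal_pos hZ0 hZ
    rw [ENNReal.toReal_mul, ENNReal.toReal_mul, ENNReal.toReal_add (by finiteness) (by finiteness),
      ENNReal.toReal_mul, ENNReal.toReal_mul, ENNReal.toReal_div] at h3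
    simp only [ENNReal.toReal_natCast, ENNReal.toReal_ofNat] at h3
    have h4 : (P.card : ℝ) * Z.toReal ≤ (4 * H.card) * Z.toReal := by linarith
    exact_mod_cast le_of_mul_le_mul_right h4 hz
  calc (P.card : ℝ≥0∞) * Z ^ s ≤ (4 * H.card : ℕ) * Z ^ s := by gcongr
    _ = 4 * 4 ^ s * ∑ i ∈ H, (Z / 4) ^ s := by
        rw [Finset.sum_const, nsmul_eq_mul, ENNReal.div_rpow_of_nonneg _ _ hs.le]
        have h4 : (4 : ℝ≥0∞) ^ s * (Z ^ s / 4 ^ s) = Z ^ s := by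
          refine ENNReal.mul_div_cancel ?_ ?_
          · simp [ENNReal.rpow_eq_zero_iff]
          · exact ENNReal.rpow_ne_top_of_nonneg hs.le (by simp)
        push_cast
        calc _ = 4 * (H.card : ℝ≥0∞) * (4 ^ s * (Z ^ s / 4 ^ s)) := by rw [h4]
          _ = _ := by ring
    _ ≤ 4 * 4 ^ s * ∑ i ∈ H, Y i ^ s := by
        gcongr with i hi
        exact (Finset.mem_filter.1 hi).2
    _ ≤ _ := by
        gcongr
        exact Finset.filter_subset _ _

/-- Some choice of signs makes the square function of the combination comparable to that of the
largest member of the family. -/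
lemma exists_signs {s : ℝ} (hs : 0 < s) (g : DyadicDistribution) (W : Finset ℤ)
    (a : ℤ → DyadicRect → ℝ) (b : DyadicRect → ℝ)
    (hb : ∀ R, b R = 0 ∨ ∃ k ∈ W, |b R| ≤ |a k R|)
    (hfin : ∀ x, rectSum (fun R => ENNReal.ofReal ((g R * b R) ^ 2)) x ≠ ∞) :
    ∃ σ : ℤ → ℝ, (∀ k, |σ k| ≤ 1) ∧
      ∫⁻ x, rectSum (fun R => ENNReal.ofReal ((g R * b R) ^ 2)) x ^ s ≤ 4 * 4 ^ s *
        ∫⁻ x, rectSum (fun R => ENNReal.ofReal ((g R * ∑ k ∈ W, σ k * a k R) ^ 2)) x ^ s := by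
  classical
  set P := W.powerset with hP
  set c : DyadicRect → ℝ≥0∞ := fun R => ENNReal.ofReal ((g R * b R) ^ 2) with hc
  set aT : Finset ℤ → DyadicRect → ℝ := fun T R => ∑ k ∈ W, signOf T k * a k R
  -- For the signs `T` only those rectangles are kept on which the combination is at least as large
  -- as b. Each rectangle survives for at least half of the choices.
  set cT : Finset ℤ → DyadicRect → ℝ≥0∞ := fun T R => if |b R| ≤ |aT T R| then c R else 0 with hcT
  have hcTle : ∀ T R, cT T R ≤ c R := fun T R => by
    simp only [hcT]; split_ifs <;> simp
  have hcTle2 : ∀ T R, cT T R ≤ ENNReal.ofReal ((g R * aT T R) ^ 2) := fun T R => by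
    simp only [hcT, hc]
    split_ifs with h
    · refine ENNReal.ofReal_le_ofReal ?_
      rw [mul_pow, mul_pow]
      exact mul_le_mul_of_nonneg_left (sq_le_sq.2 h) (sq_nonneg _)
    · exact zero_le
  have hcount : ∀ R, (P.card : ℝ≥0∞) * c R ≤ 2 * ∑ T ∈ P, cT T R := by
    intro R
    simp only [hcT]
    rw [← Finset.sum_filter, Finset.sum_const, nsmul_eq_mul, ← mul_assoc]
    rcases hb R with h | ⟨k, hk, h⟩
    · simp [hc, h]
    · gcongr
      have h1 := card_powerset_le_two_mul W (fun j => a j R) hk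
      have h2 : (P.filter fun T => |a k R| ≤ |∑ j ∈ W, signOf T j * a j R|).card ≤
          (P.filter fun T => |b R| ≤ |aT T R|).card := by
        refine Finset.card_le_card fun T hT => ?_
        rw [Finset.mem_filter] at hT ⊢
        exact ⟨hT.1, h.trans hT.2⟩
      have h3 : P.card ≤ 2 * (P.filter fun T => |b R| ≤ |aT T R|).card := h1.trans (by gcongr)
      exact_mod_cast h3
  have hrs : ∀ x, rectSum (fun R => ∑ T ∈ P, cT T R) x = ∑ T ∈ P, rectSum (cT T) x := by
    intro x
    unfold rectSum
    rw [← Summable.tsum_finsetSum fun T _ => ENNReal.summable]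
    congr 1; ext R
    by_cases hx : x ∈ rect R
    · simp only [Set.indicator_of_mem hx, ENNReal.div_eq_inv_mul, Finset.mul_sum]
    · simp [hx]
  have hpt : ∀ x, (P.card : ℝ≥0∞) * rectSum c x ^ s ≤
      4 * 4 ^ s * ∑ T ∈ P, rectSum (cT T) x ^ s := by
    intro x
    refine card_mul_rpow_le_sum P _ (hfin x) (fun T _ => rectSum_mono (hcTle T) x) ?_ hs
    rw [← hrs, ← rectSum_const_mul, ← rectSum_const_mul]
    exact rectSum_mono hcount x
  have h4 : (4 : ℝ≥0∞) * 4 ^ s ≠ ∞ :=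
    ENNReal.mul_ne_top (by simp) (ENNReal.rpow_ne_top_of_nonneg hs.le (by simp))
  have hint : (P.card : ℝ≥0∞) * ∫⁻ x, rectSum c x ^ s ≤
      ∑ T ∈ P, 4 * 4 ^ s * ∫⁻ x, rectSum (cT T) x ^ s := by
    rw [← lintegral_const_mul' _ _ (by simp), ← Finset.mul_sum,
      ← lintegral_finsetSum P fun T _ => (measurable_rectSum _).pow_const s,
      ← lintegral_const_mul' _ _ h4]
    exact lintegral_mono hpt
  -- The average over all signs being large, some choice of signs is good for the whole integral.
  obtain ⟨T, _, hT⟩ : ∃ T ∈ P, ∫⁻ x, rectSum c x ^ s ≤ 4 * 4 ^ s * ∫⁻ x, rectSum (cT T) x ^ s := by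
    by_contra hcon
    push Not at hcon
    have h1 := ENNReal.sum_lt_sum_of_nonempty ⟨∅, Finset.empty_mem_powerset W⟩ hcon
    rw [Finset.sum_const, nsmul_eq_mul] at h1
    exact absurd hint (not_le.2 h1)
  refine ⟨signOf T, abs_signOf T, hT.trans ?_⟩
  gcongr with x
  exact rectSum_mono (hcTle2 T) x

/-! ### Testing the paraproduct -/

/-- `A` bounds the norm of the paraproduct with symbol `g` from `H^p` to `Ḣ^q`. -/
def HasBound (p q : ℝ) (g : DyadicDistribution) (A : ℝ≥0∞) : Prop :=
  ∀ a ∈ hardySpace p, dotHardyNorm q (paraproduct g a) ≤ A * hardyNorm p a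

/-- Any number above a bound is again a bound, so bounds may be taken nonzero, as needed for
dividing by powers of A. -/
lemma le_paraproductNorm {p q : ℝ} {g : DyadicDistribution} {X : ℝ≥0∞}
    (h : ∀ A : ℝ≥0∞, A ≠ 0 → A ≠ ∞ → HasBound p q g A → X ≤ A) : X ≤ paraproductNorm p q g := by
  refine le_iInf₂ fun A hA => le_of_forall_gt_imp_ge_of_dense fun B hB => ?_
  by_cases hBt : B = ∞
  · rw [hBt]; exact le_top
  · exact h B hB.ne_bot hBt fun a ha => (hA a ha).trans (by gcongr)

lemma averages_mem_hardySpace {p : ℝ} (hp : 0 < p) {f : ℝ × ℝ → ℝ} (hf : Integrable f)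
    (hM : ∫⁻ x, maximal (averages f) x ^ p ≠ ∞) : averages f ∈ hardySpace p := by
  refine ⟨fun _ => f, fun _ => ⟨hf.locallyIntegrable, ?_⟩, ?_⟩
  · rw [hardyNorm_eq hp]
    exact (ENNReal.rpow_ne_top_of_nonneg (by positivity) hM).lt_top
  · have h0 : ∀ x, maximal (fun R => averages f R - averages f R) x = 0 := fun x => by
      simp [maximal]
    have : hardyNorm p (fun R => averages f R - averages f R) = 0 := by
      rw [hardyNorm_eq hp]; simp only [h0]; simp [hp]
    simp_rw [this]
    exact tendsto_const_nhds

lemma HasBound.lintegral_le {p q : ℝ} {g : DyadicDistribution} {A : ℝ≥0∞} (h : HasBound p q g A)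
    (hp : 0 < p) (hq : 0 < q) {f : ℝ × ℝ → ℝ} (hf : Integrable f)
    (hM : ∫⁻ x, maximal (averages f) x ^ p ≠ ∞) :
    ∫⁻ x, rectSum (fun R => ENNReal.ofReal ((g R * averages f R) ^ 2)) x ^ (q / 2) ≤
      A ^ q * (∫⁻ x, maximal (averages f) x ^ p) ^ (q / p) := by
  have h1 := h _ (averages_mem_hardySpace hp hf hM)
  rw [dotHardyNorm_eq hq, hardyNorm_eq hp] at h1
  have h2 := ENNReal.rpow_le_rpow h1 hq.le
  rw [← ENNReal.rpow_mul, one_div_mul_cancel hq.ne', ENNReal.rpow_one,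
    ENNReal.mul_rpow_of_nonneg _ _ hq.le, ← ENNReal.rpow_mul, one_div_mul_eq_div] at h2
  exact h2

lemma HasBound.mono {p q : ℝ} (hq : 0 < q) {g g' : DyadicDistribution} {A : ℝ≥0∞}
    (h : HasBound p q g A) (hg : ∀ R, g' R ^ 2 ≤ g R ^ 2) : HasBound p q g' A := by
  intro a ha
  refine le_trans ?_ (h a ha)
  rw [dotHardyNorm_eq hq, dotHardyNorm_eq hq]
  gcongr with x
  refine rectSum_mono (fun R => ENNReal.ofReal_le_ofReal ?_) x
  simp only [paraproduct]
  rw [mul_pow, mul_pow]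
  have := hg R
  gcongr

lemma rectSum_ne_top {c : DyadicRect → ℝ≥0∞} {F : Finset DyadicRect} (hF : ∀ R ∉ F, c R = 0)
    (hc : ∀ R, c R ≠ ∞) (x : ℝ × ℝ) : rectSum c x ≠ ∞ := by
  unfold rectSum
  rw [tsum_eq_sum (s := F) fun R hR => by simp [hF R hR]]
  refine ENNReal.sum_ne_top.2 fun R _ => ?_
  by_cases hx : x ∈ rect R
  · rw [Set.indicator_of_mem hx]
    exact ENNReal.div_ne_top (hc R) (volume_rect_ne_zero R)
  · simp [hx]

/-- Weights detecting the rectangles which are mostly inside one of the given sets, for which the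
weighted square function is controlled by a bound of the paraproduct. -/
lemma exists_weights {p q r : ℝ} (hp : 0 < p) (hq : 0 < q) (hr : 0 < r) {η : ℝ≥0∞} (hη : η ≠ 0) :
    ∃ C : ℝ≥0∞, C ≠ ∞ ∧ ∀ (g : DyadicDistribution) (F : Finset DyadicRect), (∀ R ∉ F, g R = 0) →
      ∀ A, HasBound p q g A → ∀ (z : ℤ) (W : Finset ℤ) (Ω : ℤ → Set (ℝ × ℝ)),
      (∀ k, IsCellUnion z (Ω k)) → (∀ k, volume (Ω k) ≠ ∞) →
      ∃ (b : DyadicRect → ℝ) (B : ℤ → Set (ℝ × ℝ)), (∀ k, volume (B k) ≤ η * volume (Ω k)) ∧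
        (∀ k ∈ W, ∀ R, 1 / 2 < density (Ω k) R →
          (2 : ℝ) ^ ((k : ℝ) * (r / p)) / 4 ≤ b R ∨ rect R ⊆ B k) ∧
        ∫⁻ x, rectSum (fun R => ENNReal.ofReal ((g R * b R) ^ 2)) x ^ (q / 2) ≤
          C * A ^ q * (∑ k ∈ W, 2 ^ ((k : ℝ) * r) * volume (Ω k)) ^ (q / p) := by
  obtain ⟨C, hC, h⟩ := exists_test_family hp hr hη
  refine ⟨4 * 4 ^ (q / 2) * C ^ (q / p), ?_, fun g F hgF A hA z W Ω hcell hΩt => ?_⟩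
  · exact ENNReal.mul_ne_top (ENNReal.mul_ne_top (by simp)
      (ENNReal.rpow_ne_top_of_nonneg (by positivity) (by simp)))
      (ENNReal.rpow_ne_top_of_nonneg (by positivity) hC)
  obtain ⟨f, B, hfB, hM⟩ := h z W Ω hcell hΩt
  set a : ℤ → DyadicRect → ℝ := fun k R => (2 : ℝ) ^ ((k : ℝ) * (r / p)) * averages (f k) R with ha
  -- The weight b_R is the maximum over k in `W` of the scaled test averages |a_k R|; for empty `W`
  -- it is set to 0.
  have hex : ∀ R, ∃ y : ℝ, (∀ k ∈ W, |a k R| ≤ y) ∧ (y = 0 ∨ ∃ k ∈ W, |y| ≤ |a k R|) := by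
    intro R
    rcases W.eq_empty_or_nonempty with hW | hW
    · exact ⟨0, by simp [hW], Or.inl rfl⟩
    · obtain ⟨k, hk, hmax⟩ := W.exists_max_image (fun k => |a k R|) hW
      exact ⟨|a k R|, hmax, Or.inr ⟨k, hk, by simp⟩⟩
  choose b hb1 hb2 using hex
  obtain ⟨σ, hσ, hσle⟩ := exists_signs (s := q / 2) (by positivity) g W a b hb2
    (rectSum_ne_top (F := F) (fun R hR => by simp [hgF R hR]) fun R => ENNReal.ofReal_ne_top)
  refine ⟨b, B, fun k => (hfB k).volume_le, fun k hk R hR => ?_, hσle.trans ?_⟩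
  · refine ((hfB k).le_averages R hR).imp (fun h1 => le_trans ?_ (hb1 R k hk)) id
    simp only [ha]
    rw [abs_mul, abs_of_pos (by positivity : (0 : ℝ) < 2 ^ ((k : ℝ) * (r / p))), div_eq_mul_one_div]
    gcongr
  · set T := ∑ k ∈ W, (2 : ℝ≥0∞) ^ ((k : ℝ) * r) * volume (Ω k) with hT
    have hTt : T ≠ ∞ :=
      ENNReal.sum_ne_top.2 fun k _ => ENNReal.mul_ne_top (two_rpow_ne_top _) (hΩt k)
    set G : ℝ × ℝ → ℝ := fun x =>
      ∑ k ∈ W, (σ k * (2 : ℝ) ^ ((k : ℝ) * (r / p))) * f k x with hG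
    have hGi : Integrable G :=
      integrable_finsetSum W fun k _ => ((hfB k).integrable.const_mul _)
    have hGav : ∀ R, averages G R = ∑ k ∈ W, σ k * a k R := by
      intro R
      rw [hG, averages_finset_sum W (fun k => σ k * (2 : ℝ) ^ ((k : ℝ) * (r / p)))
        (fun k _ => (hfB k).integrable)]
      exact Finset.sum_congr rfl fun k _ => by simp only [ha]; ring
    have hMG := hM σ hσ
    have htest := hA.lintegral_le hp hq hGi
      (ne_top_of_le_ne_top (ENNReal.mul_ne_top hC hTt) hMG)
    simp_rw [hGav] at htest
    calc _ ≤ 4 * 4 ^ (q / 2) * (A ^ q * (C * T) ^ (q / p)) := by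
          gcongr
          exact htest.trans (by gcongr)
      _ = _ := by
          rw [ENNReal.mul_rpow_of_nonneg _ _ (by positivity)]
          ring

/-! ### Finitely supported symbols -/

open scoped Classical in
/-- The restriction of a symbol to a finite set of rectangles. -/
def truncate (g : DyadicDistribution) (F : Finset DyadicRect) : DyadicDistribution :=
  fun R => if R ∈ F then g R else 0

lemma truncate_of_notMem (g : DyadicDistribution) {F : Finset DyadicRect} {R : DyadicRect}
    (h : R ∉ F) : truncate g F R = 0 := if_neg h

lemma truncate_sq_le (g : DyadicDistribution) (F : Finset DyadicRect) (R : DyadicRect) :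
    truncate g F R ^ 2 ≤ g R ^ 2 := by
  unfold truncate; split_ifs
  · exact le_rfl
  · simpa using sq_nonneg (g R)

lemma truncate_sq_mono (g : DyadicDistribution) {F G : Finset DyadicRect} (h : F ⊆ G)
    (R : DyadicRect) : truncate g F R ^ 2 ≤ truncate g G R ^ 2 := by
  unfold truncate
  by_cases hF : R ∈ F
  · simp [hF, h hF]
  · rw [if_neg hF, zero_pow two_ne_zero]
    exact sq_nonneg _

lemma rectSum_eq_iSup_truncate (g : DyadicDistribution) (x : ℝ × ℝ) :
    rectSum (fun R => ENNReal.ofReal (g R ^ 2)) x =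
      ⨆ F, rectSum (fun R => ENNReal.ofReal (truncate g F R ^ 2)) x := by
  refine le_antisymm ?_ (iSup_le fun F => rectSum_mono
    (fun R => ENNReal.ofReal_le_ofReal (truncate_sq_le g F R)) x)
  rw [rectSum, ENNReal.tsum_eq_iSup_sum]
  refine iSup_mono fun F => ?_
  refine le_trans (Finset.sum_le_sum fun R hR => ?_) (ENNReal.sum_le_tsum F)
  simp only [truncate, if_pos hR, le_refl]

/-- Monotone convergence along the directed family of finite sets of rectangles. It reduces the
lower bound to finite symbols, for which the quantities to be absorbed are finite. -/
lemma dotHardyNorm_le_of_truncate {r : ℝ} (hr : 0 < r) {g : DyadicDistribution} {K : ℝ≥0∞}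
    (h : ∀ F, dotHardyNorm r (truncate g F) ≤ K) : dotHardyNorm r g ≤ K := by
  rw [dotHardyNorm_eq hr, one_div, ENNReal.rpow_inv_le_iff hr]
  have hr2 : 0 < r / 2 := by positivity
  have hsup : ∀ x, rectSum (fun R => ENNReal.ofReal (g R ^ 2)) x ^ (r / 2) =
      ⨆ F, rectSum (fun R => ENNReal.ofReal (truncate g F R ^ 2)) x ^ (r / 2) := fun x => by
    rw [rectSum_eq_iSup_truncate]
    exact (ENNReal.orderIsoRpow (r / 2) hr2).map_iSup _
  simp_rw [hsup]
  rw [lintegral_iSup_directed (fun F => ((measurable_rectSum _).pow_const _).aemeasurable)]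
  · refine iSup_le fun F => ?_
    have := h F
    rwa [dotHardyNorm_eq hr, one_div, ENNReal.rpow_inv_le_iff hr] at this
  · refine Monotone.directed_le fun F G hFG x => ?_
    refine ENNReal.rpow_le_rpow (rectSum_mono (fun R => ENNReal.ofReal_le_ofReal ?_) x) hr2.le
    exact truncate_sq_mono g hFG R

lemma coeffMass_eq_iSup_truncate (g : DyadicDistribution) (U : Set (ℝ × ℝ)) :
    coeffMass g U ≤ ⨆ F, coeffMass (truncate g F) U := by
  rw [coeffMass, ENNReal.tsum_eq_iSup_sum]
  refine iSup_mono fun F => ?_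
  refine le_trans (Finset.sum_le_sum fun R hR => ?_) (ENNReal.sum_le_tsum F)
  rw [truncate, if_pos hR]

/-- The smallest scale occurring in a finite family. -/
lemma exists_scale_le (F : Finset DyadicRect) : ∃ z : ℤ, ∀ R ∈ F, z ≤ R.1.1 ∧ z ≤ R.2.1 := by
  classical
  induction F using Finset.induction_on with
  | empty => exact ⟨0, by simp⟩
  | insert R F _ ih =>
    obtain ⟨z, hz⟩ := ih
    refine ⟨min z (min R.1.1 R.2.1), fun S hS => ?_⟩
    rcases Finset.mem_insert.1 hS with rfl | h
    · omega
    · have := hz S h; omega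

lemma mem_rect_iff_of_cell {z k l : ℤ} {R : DyadicRect} (h1 : z ≤ R.1.1) (h2 : z ≤ R.2.1)
    {x y : ℝ × ℝ} (hx : x ∈ rect ((z, k), (z, l))) (hy : y ∈ rect ((z, k), (z, l))) :
    x ∈ rect R ↔ y ∈ rect R := by
  have key : ∀ {x y : ℝ × ℝ}, x ∈ rect ((z, k), (z, l)) → y ∈ rect ((z, k), (z, l)) →
      x ∈ rect R → y ∈ rect R := fun {x y} hx hy h =>
    ⟨dyadicInterval_subset (I := (z, k)) h1 hx.1 h.1 hy.1,
      dyadicInterval_subset (I := (z, l)) h2 hx.2 h.2 hy.2⟩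
  exact ⟨key hx hy, key hy hx⟩

lemma isCellUnion_of_iff {z : ℤ} {A : Set (ℝ × ℝ)}
    (h : ∀ k l x y, x ∈ rect ((z, k), (z, l)) → y ∈ rect ((z, k), (z, l)) → x ∈ A → y ∈ A) :
    IsCellUnion z A := by
  intro k l
  by_cases hx : ∃ x ∈ rect ((z, k), (z, l)), x ∈ A
  · obtain ⟨x, hx, hxA⟩ := hx
    exact Or.inl fun y hy => h k l x y hx hy hxA
  · push Not at hx
    exact Or.inr (Set.disjoint_left.2 hx)

lemma isCellUnion_biUnion {z : ℤ} {F : Finset DyadicRect} (hz : ∀ R ∈ F, z ≤ R.1.1 ∧ z ≤ R.2.1) :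
    IsCellUnion z (⋃ R ∈ F, rect R) := by
  refine isCellUnion_of_iff fun k l x y hx hy hxA => ?_
  simp only [Set.mem_iUnion, exists_prop] at hxA ⊢
  obtain ⟨R, hR, hxR⟩ := hxA
  exact ⟨R, hR, (mem_rect_iff_of_cell (hz R hR).1 (hz R hR).2 hx hy).1 hxR⟩

lemma volume_biUnion_rect_ne_top (F : Finset DyadicRect) : volume (⋃ R ∈ F, rect R) ≠ ∞ := by
  refine ne_top_of_le_ne_top ?_ (measure_biUnion_finset_le F rect)
  exact ENNReal.sum_ne_top.2 fun R _ => volume_rect_ne_top R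

lemma rectSum_eq_of_cell {c : DyadicRect → ℝ≥0∞} {F : Finset DyadicRect} (hF : ∀ R ∉ F, c R = 0)
    {z : ℤ} (hz : ∀ R ∈ F, z ≤ R.1.1 ∧ z ≤ R.2.1) {k l : ℤ} {x y : ℝ × ℝ}
    (hx : x ∈ rect ((z, k), (z, l))) (hy : y ∈ rect ((z, k), (z, l))) :
    rectSum c x = rectSum c y := by
  unfold rectSum
  congr 1; ext R
  by_cases hR : R ∈ F
  · have := mem_rect_iff_of_cell (hz R hR).1 (hz R hR).2 hx hy
    by_cases h : x ∈ rect R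
    · rw [Set.indicator_of_mem h, Set.indicator_of_mem (this.1 h)]
    · rw [Set.indicator_of_notMem h, Set.indicator_of_notMem fun h' => h (this.2 h')]
  · simp [hF R hR]

lemma density_compl {A : Set (ℝ × ℝ)} (hA : MeasurableSet A) (R : DyadicRect) :
    density Aᶜ R = 1 - density A R := by
  have h : volume.real (A ∩ rect R) + volume.real (Aᶜ ∩ rect R) = 2 ^ R.1.1 * 2 ^ R.2.1 := by
    rw [← volume_real_rect, Set.inter_comm, Set.inter_comm Aᶜ, ← Set.sdiff_eq,
      measureReal_inter_add_sdiff hA (volume_rect_ne_top R)]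
  unfold density
  rw [eq_sub_iff_add_eq, ← add_div, add_comm, h]
  exact div_self (by positivity)

lemma one_le_two_mul_lintegral_compl {A : Set (ℝ × ℝ)} (hA : MeasurableSet A) {R : DyadicRect}
    (h : density A R ≤ 1 / 2) : 1 ≤ 2 * ((∫⁻ x in rect R, Aᶜ.indicator 1 x) / volume (rect R)) := by
  rw [lintegral_indicator_div_eq hA.compl, density_compl hA,
    show (2 : ℝ≥0∞) = ENNReal.ofReal 2 by simp, ← ENNReal.ofReal_mul (by norm_num),
    ENNReal.one_le_ofReal]
  linarith

/-- The rectangles which are at least half outside of `N` are controlled by the values outside. -/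
lemma lintegral_rectSum_rpow_le_compl {s : ℝ} (hs : 1 < s) :
    ∃ C : ℝ≥0∞, C ≠ ∞ ∧ ∀ (c c' : DyadicRect → ℝ≥0∞) (N : Set (ℝ × ℝ)), MeasurableSet N →
      (∀ R, c' R ≤ c R) → (∀ R, c' R ≠ 0 → density N R ≤ 1 / 2) →
      ∫⁻ x, rectSum c' x ^ s ≤ C * ∫⁻ x, (rectSum c x * Nᶜ.indicator 1 x) ^ s := by
  have hc : s.HolderConjugate s.conjExponent := Real.HolderConjugate.conjExponent hs
  set s' := s.conjExponent
  set D := (maxConst s' * maxConst s') ^ (1 / s')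
  have hD : D ≠ ∞ := ENNReal.rpow_ne_top_of_nonneg (one_div_nonneg.2 hc.symm.pos.le)
    (ENNReal.mul_ne_top (maxConst_ne_top hc.symm.lt) (maxConst_ne_top hc.symm.lt))
  refine ⟨(2 * D) ^ s, ENNReal.rpow_ne_top_of_nonneg hc.pos.le (ENNReal.mul_ne_top (by simp) hD),
    fun c c' N hN hcc' hdens => ?_⟩
  have h1N : Measurable (Nᶜ.indicator (1 : ℝ × ℝ → ℝ≥0∞)) := measurable_one.indicator hN.compl
  set H : ℝ × ℝ → ℝ≥0∞ := fun x => rectSum c x * Nᶜ.indicator 1 x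
  have hHm : Measurable H := (measurable_rectSum c).mul h1N
  refine (lintegral_rpow_le_of_dual (measurable_rectSum c') hc
    (2 * ((∫⁻ x, H x ^ s) ^ (1 / s) * D)) fun f hf => ?_).trans (le_of_eq ?_)
  · rw [lintegral_rectSum_mul c' hf]
    calc _ ≤ ∑' R, 2 * (c R * ((∫⁻ x in rect R, Nᶜ.indicator 1 x * strongMax f x) /
            volume (rect R))) := by
          refine ENNReal.tsum_le_tsum fun R => ?_
          by_cases h0 : c' R = 0
          · rw [h0, zero_mul]; exact zero_le
          set M := (∫⁻ x in rect R, f x) / volume (rect R) with hM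
          have h1 := one_le_two_mul_lintegral_compl hN (hdens R h0)
          -- The average of f over R is at most its maximal function at every point of R, so it may
          -- be moved inside the integral over the part of R outside N.
          have h2 : (∫⁻ x in rect R, Nᶜ.indicator 1 x) * M ≤
              ∫⁻ x in rect R, Nᶜ.indicator 1 x * strongMax f x := by
            rw [← lintegral_mul_const _ h1N]
            refine setLIntegral_mono' (measurableSet_rect R) fun x hx => ?_
            gcongr
            exact lintegral_rect_div_le_strongMax f hx
          calc c' R * M ≤ c R * (1 * M) := by rw [one_mul]; gcongr; exact hcc' R
            _ ≤ c R * (2 * ((∫⁻ x in rect R, Nᶜ.indicator 1 x) / volume (rect R)) * M) := by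
                gcongr
            _ = 2 * (c R * (((∫⁻ x in rect R, Nᶜ.indicator 1 x) * M) / volume (rect R))) := by
                simp only [ENNReal.div_eq_inv_mul]; ring
            _ ≤ _ := by gcongr
      _ = 2 * ∫⁻ x, rectSum c x * (Nᶜ.indicator 1 x * strongMax f x) := by
          rw [ENNReal.tsum_mul_left, lintegral_rectSum_mul c
            (f := fun x => Nᶜ.indicator 1 x * strongMax f x) (h1N.mul (measurable_strongMax f))]
      _ = 2 * ∫⁻ x, H x * strongMax f x := by simp only [H, mul_assoc]
      _ ≤ 2 * ((∫⁻ x, H x ^ s) ^ (1 / s) * D * (∫⁻ x, f x ^ s') ^ (1 / s')) := by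
          gcongr
          exact lintegral_mul_strongMax_le hc hHm hf
      _ = _ := by ring
  · have h2 : ((∫⁻ x, H x ^ s) ^ (1 / s)) ^ s = ∫⁻ x, H x ^ s := by
      rw [← ENNReal.rpow_mul, one_div_mul_cancel hc.pos.ne', ENNReal.rpow_one]
    rw [ENNReal.mul_rpow_of_nonneg _ _ hc.pos.le, ENNReal.mul_rpow_of_nonneg _ _ hc.pos.le,
      ENNReal.mul_rpow_of_nonneg _ _ hc.pos.le, h2]
    ring

/-! ### The lower bound by the norm of `BMO` -/

/-- A good-λ step. After discarding the rectangles inside B, the remaining square function obeys an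
L^p bound on U; it exceeds a multiple of A only on a small set N. Rectangles at least half outside N
are summed by integrating over U \ N, and all others lie inside E. -/
lemma exists_coeffMass_le_add {p : ℝ} (hp : 0 < p) :
    ∃ L : ℝ≥0∞, L ≠ ∞ ∧ ∀ (g : DyadicDistribution) (F : Finset DyadicRect), (∀ R ∉ F, g R = 0) →
      ∀ A, A ≠ 0 → A ≠ ∞ → HasBound p p g A → ∀ (z : ℤ) (U : Set (ℝ × ℝ)),
      IsCellUnion z U → volume U ≠ ∞ →
      ∃ B E : Set (ℝ × ℝ), volume B ≤ 4⁻¹ * volume U ∧ volume E ≤ 4⁻¹ * volume U ∧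
        coeffMass g U ≤ L * A ^ 2 * volume U + (coeffMass g B + coeffMass g E) := by
  classical
  -- Only the index k = 0 is used later, so the scaling exponent r is immaterial and is set to 1.
  obtain ⟨C, hC, hw⟩ := exists_weights hp hp one_pos (η := 4⁻¹) (by simp)
  have hp2 : 0 < p / 2 := by positivity
  set κ := strongMaxConst 2
  have hκ : κ ≠ ∞ := strongMaxConst_ne_top (by norm_num)
  set D : ℝ≥0∞ := 16 ^ (p / 2) * C
  have hD : D ≠ ∞ := ENNReal.mul_ne_top (ENNReal.rpow_ne_top_of_nonneg hp2.le (by simp)) hC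
  -- K is so large that Chebyshev for N, followed by the L² maximal theorem for its indicator
  -- (factor 4κ), leaves |E| ≤ |U|/4.
  set K : ℝ≥0∞ := 4 * (4 * κ * D) + 1
  have hKt : K ≠ ∞ := ENNReal.add_ne_top.2 ⟨ENNReal.mul_ne_top (by simp)
    (ENNReal.mul_ne_top (ENNReal.mul_ne_top (by simp) hκ) hD), by simp⟩
  have hK0 : K ≠ 0 := by simp [K]
  have hKD : 4 * κ * (K⁻¹ * D) ≤ 4⁻¹ := by
    rw [show 4 * κ * (K⁻¹ * D) = K⁻¹ * (4 * κ * D) by ring, ← ENNReal.div_eq_inv_mul]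
    refine ENNReal.div_le_of_le_mul ?_
    rw [← ENNReal.div_eq_inv_mul, ENNReal.le_div_iff_mul_le (by simp) (by simp), mul_comm]
    exact le_self_add
  set τ₀ := K ^ (2 / p)
  have hτ₀ : τ₀ ^ (p / 2) = K := by
    rw [← ENNReal.rpow_mul, show 2 / p * (p / 2) = 1 by field_simp, ENNReal.rpow_one]
  have hτ₀t : τ₀ ≠ ∞ := ENNReal.rpow_ne_top_of_nonneg (by positivity) hKt
  have hτ₀0 : τ₀ ≠ 0 := by
    intro h; rw [h, ENNReal.zero_rpow_of_pos hp2] at hτ₀; exact hK0 hτ₀.symm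
  refine ⟨2 * τ₀, ENNReal.mul_ne_top (by simp) hτ₀t, fun g F hgF A hA0 hAt hA z U hU hUt => ?_⟩
  obtain ⟨b, B, hB, hbB, hint⟩ := hw g F hgF A hA z {0} (fun _ => U) (fun _ => hU) fun _ => hUt
  have hUm := isCellUnion_measurableSet hU
  set c : DyadicRect → ℝ≥0∞ := fun R =>
    if rect R ⊆ U ∧ ¬ rect R ⊆ B 0 then ENNReal.ofReal (g R ^ 2) else 0
  set τ := τ₀ * A ^ 2
  set N := {x | τ < rectSum c x}
  have hNm : MeasurableSet N := measurableSet_lt measurable_const (measurable_rectSum c)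
  set E := {x | 2⁻¹ ≤ strongMax (N.indicator 1) x}
  have hH : ∫⁻ x, rectSum c x ^ (p / 2) ≤ D * A ^ p * volume U := by
    simp only [Finset.sum_singleton, div_self hp.ne', ENNReal.rpow_one] at hint
    calc ∫⁻ x, rectSum c x ^ (p / 2)
        ≤ ∫⁻ x, 16 ^ (p / 2) * rectSum (fun R => ENNReal.ofReal ((g R * b R) ^ 2)) x ^ (p / 2) := by
          refine lintegral_mono fun x => ?_
          rw [← ENNReal.mul_rpow_of_nonneg _ _ hp2.le, ← rectSum_const_mul]
          refine ENNReal.rpow_le_rpow (rectSum_mono (fun R => ?_) x) hp2.le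
          simp only [c]
          split_ifs with h
          · have h1 := (hbB 0 (by simp) R (by
              rw [density_eq_one h.1]; norm_num)).resolve_right h.2
            have h2 : (1 : ℝ) / 4 ≤ b R := by simpa using h1
            rw [show (16 : ℝ≥0∞) = ENNReal.ofReal 16 by simp, ← ENNReal.ofReal_mul (by norm_num)]
            refine ENNReal.ofReal_le_ofReal ?_
            have h3 : (1 : ℝ) ≤ 16 * b R ^ 2 := by nlinarith
            nlinarith [mul_le_mul_of_nonneg_left h3 (sq_nonneg (g R))]
          · exact zero_le
      _ = 16 ^ (p / 2) * ∫⁻ x, rectSum (fun R => ENNReal.ofReal ((g R * b R) ^ 2)) x ^ (p / 2) :=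
          lintegral_const_mul _ ((measurable_rectSum _).pow_const _)
      _ ≤ 16 ^ (p / 2) * (C * A ^ p * (2 ^ (((0 : ℤ) : ℝ) * 1) * volume U)) := by gcongr
      _ = D * A ^ p * volume U := by simp [D]; ring
  have hAp0 : A ^ p ≠ 0 := by simp [ENNReal.rpow_eq_zero_iff, hA0, hp.le]
  have hApt : A ^ p ≠ ∞ := ENNReal.rpow_ne_top_of_nonneg hp.le hAt
  have hτp : τ ^ (p / 2) = K * A ^ p := by
    rw [ENNReal.mul_rpow_of_nonneg _ _ hp2.le, hτ₀, ← ENNReal.rpow_natCast, ← ENNReal.rpow_mul]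
    congr 2; push_cast; ring
  have hN : volume N ≤ K⁻¹ * D * volume U := by
    refine (volume_le_of_le_rpow (measurable_rectSum c) (c := τ)
      (mul_ne_zero hτ₀0 (pow_ne_zero _ hA0)) (ENNReal.mul_ne_top hτ₀t (ENNReal.pow_ne_top hAt)) hp2
      fun x hx => le_of_lt hx).trans ?_
    rw [hτp]
    calc _ ≤ (K * A ^ p)⁻¹ * (D * A ^ p * volume U) := by gcongr
      _ = K⁻¹ * D * volume U * ((A ^ p)⁻¹ * A ^ p) := by
          rw [ENNReal.mul_inv (Or.inl hK0) (Or.inl hKt)]; ring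
      _ = _ := by rw [ENNReal.inv_mul_cancel hAp0 hApt, mul_one]
  have hE : volume E ≤ 4⁻¹ * volume U := by
    refine (volume_le_of_le_rpow (measurable_strongMax _) (c := 2⁻¹) (by simp) (by simp)
      (two_pos (α := ℝ)) fun x hx => hx).trans ?_
    calc _ ≤ (((2 : ℝ≥0∞)⁻¹ ^ (2 : ℝ))⁻¹) * (κ * volume N) := by
          gcongr; exact lintegral_strongMax_indicator_le (by norm_num) hNm
      _ = 4 * (κ * volume N) := by
          rw [ENNReal.inv_rpow, inv_inv]; norm_num
      _ ≤ 4 * (κ * (K⁻¹ * D * volume U)) := by gcongr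
      _ = 4 * κ * (K⁻¹ * D) * volume U := by ring
      _ ≤ _ := by gcongr
  refine ⟨B 0, E, hB 0, hE, ?_⟩
  have h1N : Measurable (Nᶜ.indicator (1 : ℝ × ℝ → ℝ≥0∞)) := measurable_one.indicator hNm.compl
  have hmain : ∑' R, c R * ((∫⁻ x in rect R, Nᶜ.indicator 1 x) / volume (rect R)) ≤
      τ * volume U := by
    rw [← lintegral_rectSum_mul c h1N, ← lintegral_indicator_const hUm]
    refine lintegral_mono fun x => ?_
    by_cases hxN : x ∈ N
    · simp [hxN]
    by_cases hxU : x ∈ U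
    · rw [Set.indicator_of_mem hxU, Set.indicator_of_mem (by simpa using hxN), Pi.one_apply,
        mul_one]
      simpa [N] using hxN
    · rw [rectSum_eq_zero fun R hR => if_neg fun h => hxU (h.1 hR), zero_mul]
      exact zero_le
  calc coeffMass g U
      ≤ ∑' R, (2 * (c R * ((∫⁻ x in rect R, Nᶜ.indicator 1 x) / volume (rect R))) +
        ((if rect R ⊆ B 0 then ENNReal.ofReal (g R ^ 2) else 0) +
          (if rect R ⊆ E then ENNReal.ofReal (g R ^ 2) else 0))) := by
        unfold coeffMass
        refine ENNReal.tsum_le_tsum fun R => ?_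
        by_cases hRU : rect R ⊆ U
        swap
        · rw [if_neg hRU]; exact zero_le
        rw [if_pos hRU]
        by_cases hRB : rect R ⊆ B 0
        · rw [if_pos hRB]
          exact le_add_left (le_add_right le_rfl)
        by_cases hRE : rect R ⊆ E
        · rw [if_pos hRE]
          exact le_add_left (le_add_left le_rfl)
        have hd : density N R ≤ 1 / 2 := by
          by_contra! hd
          refine hRE fun x hx => le_trans ?_ (ofReal_density_le_strongMax hNm hx)
          rw [show (2⁻¹ : ℝ≥0∞) = ENNReal.ofReal (1 / 2) by
            rw [one_div, ENNReal.ofReal_inv_of_pos two_pos]; simp]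
          exact ENNReal.ofReal_le_ofReal hd.le
        have h2 := one_le_two_mul_lintegral_compl hNm hd
        refine le_add_right ?_
        simp only [c, if_pos (And.intro hRU hRB)]
        calc ENNReal.ofReal (g R ^ 2) = ENNReal.ofReal (g R ^ 2) * 1 := (mul_one _).symm
          _ ≤ ENNReal.ofReal (g R ^ 2) * _ := mul_le_mul_right h2 _
          _ = _ := by ring
    _ = 2 * ∑' R, c R * ((∫⁻ x in rect R, Nᶜ.indicator 1 x) / volume (rect R)) +
        (coeffMass g (B 0) + coeffMass g E) := by
        rw [ENNReal.tsum_add, ENNReal.tsum_add, ENNReal.tsum_mul_left]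
        rfl
    _ ≤ 2 * (τ * volume U) + (coeffMass g (B 0) + coeffMass g E) := by gcongr
    _ = _ := by simp only [τ]; ring

/-- For a symbol supported in `F`, only the union of the rectangles of `F` inside U matters, and
this is a union of cells. The exceptional sets B and E need not be, so this is what permits the
iteration. -/
lemma coeffMass_le_of_cellUnion {g : DyadicDistribution} {F : Finset DyadicRect}
    (hgF : ∀ R ∉ F, g R = 0) {z : ℤ} (hz : ∀ R ∈ F, z ≤ R.1.1 ∧ z ≤ R.2.1) {b : ℝ≥0∞}
    (hb : ∀ U, IsCellUnion z U → volume U ≠ ∞ → coeffMass g U ≤ b * volume U)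
    (U : Set (ℝ × ℝ)) : coeffMass g U ≤ b * volume U := by
  classical
  set G := F.filter fun R => rect R ⊆ U
  have hGU : (⋃ R ∈ G, rect R) ⊆ U :=
    Set.iUnion₂_subset fun R hR => (Finset.mem_filter.1 hR).2
  calc coeffMass g U ≤ coeffMass g (⋃ R ∈ G, rect R) := by
        unfold coeffMass
        refine ENNReal.tsum_le_tsum fun R => ?_
        by_cases hF : R ∈ F
        · split_ifs with h1 h2
          · exact le_rfl
          · exact absurd (Set.subset_biUnion_of_mem (u := fun R => rect R)
              (show R ∈ (G : Set DyadicRect) from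
                  Finset.mem_coe.2 (Finset.mem_filter.2 ⟨hF, h1⟩))) h2
          · exact zero_le
          · exact zero_le
        · simp [hgF R hF]
    _ ≤ b * volume (⋃ R ∈ G, rect R) :=
        hb _ (isCellUnion_biUnion fun R hR => hz R (Finset.mem_filter.1 hR).1)
          (volume_biUnion_rect_ne_top G)
    _ ≤ _ := by gcongr

/-- A crude bound depending on the symbol, used only for the finiteness of the supremum to be
absorbed. -/
lemma coeffMass_le_sum_mul {g : DyadicDistribution} {F : Finset DyadicRect}
    (hgF : ∀ R ∉ F, g R = 0) (U : Set (ℝ × ℝ)) :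
    coeffMass g U ≤ (∑ R ∈ F, ENNReal.ofReal (g R ^ 2) / volume (rect R)) * volume U := by
  unfold coeffMass
  rw [tsum_eq_sum (s := F) fun R hR => by simp [hgF R hR], Finset.sum_mul]
  refine Finset.sum_le_sum fun R _ => ?_
  split_ifs with h
  · rw [← ENNReal.mul_div_right_comm, ENNReal.le_div_iff_mul_le (Or.inl (volume_rect_ne_zero R))
      (Or.inl (volume_rect_ne_top R))]
    gcongr
  · exact zero_le

/-- The norm of the paraproduct bounds the norm of its symbol in `BMO`. -/
lemma bmoNorm_le_paraproductNorm {p : ℝ} (hp : 0 < p) :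
    ∃ C : ℝ≥0∞, C ≠ ∞ ∧ ∀ g, bmoNorm g ≤ C * paraproductNorm p p g := by
  obtain ⟨L, hL, h⟩ := exists_coeffMass_le_add hp
  refine ⟨(2 * L) ^ (1 / 2 : ℝ) + 1, ENNReal.add_ne_top.2 ⟨ENNReal.rpow_ne_top_of_nonneg
    (by norm_num) (ENNReal.mul_ne_top (by simp) hL), by simp⟩, fun g => ?_⟩
  have hC0 : (2 * L) ^ (1 / 2 : ℝ) + 1 ≠ 0 := by simp
  have hCt : (2 * L) ^ (1 / 2 : ℝ) + 1 ≠ ∞ := ENNReal.add_ne_top.2 ⟨ENNReal.rpow_ne_top_of_nonneg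
    (by norm_num) (ENNReal.mul_ne_top (by simp) hL), by simp⟩
  rw [mul_comm, ← ENNReal.div_le_iff hC0 hCt]
  refine le_paraproductNorm fun A hA0 hAt hA => ?_
  rw [ENNReal.div_le_iff hC0 hCt]
  have key : ∀ F U, coeffMass (truncate g F) U ≤ 2 * (L * A ^ 2) * volume U := by
    intro F
    set f := truncate g F
    have hfF : ∀ R ∉ F, f R = 0 := fun R hR => truncate_of_notMem g hR
    obtain ⟨z, hz⟩ := exists_scale_le F
    set b := ⨆ (U : Set (ℝ × ℝ)) (_ : IsCellUnion z U) (_ : volume U ≠ ∞),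
      coeffMass f U / volume U
    have hbt : b ≠ ∞ := by
      refine ne_top_of_le_ne_top (b := ∑ R ∈ F, ENNReal.ofReal (f R ^ 2) / volume (rect R))
        (ENNReal.sum_ne_top.2 fun R _ =>
          ENNReal.div_ne_top (by simp) (volume_rect_ne_zero R)) ?_
      exact iSup_le fun U => iSup₂_le fun _ _ =>
          ENNReal.div_le_of_le_mul (coeffMass_le_sum_mul hfF U)
    have hb : ∀ U, coeffMass f U ≤ b * volume U := by
      refine coeffMass_le_of_cellUnion hfF hz fun U hU hUt => ?_
      by_cases h0 : volume U = 0
      · rw [coeffMass_eq_zero_of_volume f h0]; exact zero_le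
      rw [← ENNReal.div_le_iff h0 hUt]
      exact le_iSup_of_le U (le_iSup₂_of_le (f := fun _ _ => coeffMass f U / volume U)
          hU hUt le_rfl)
    -- B and E have measure at most |U|/4 each, so their masses together cost at most b|U|/2; as b
    -- is finite, this is absorbed.
    have hb2 : b ≤ L * A ^ 2 + b / 2 := by
      refine iSup_le fun U => iSup₂_le fun hU hUt => ENNReal.div_le_of_le_mul ?_
      obtain ⟨B, E, hB, hE, hBE⟩ := h f F hfF A hA0 hAt (hA.mono hp (truncate_sq_le g F)) z U hU hUt
      refine hBE.trans ?_
      rw [add_mul]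
      gcongr
      calc coeffMass f B + coeffMass f E ≤ b * (4⁻¹ * volume U) + b * (4⁻¹ * volume U) := by
            gcongr
            · exact (hb B).trans (by gcongr)
            · exact (hb E).trans (by gcongr)
        _ = b * (2 * 4⁻¹) * volume U := by ring
        _ = b / 2 * volume U := by
            rw [ENNReal.div_eq_inv_mul, mul_comm b]
            congr 2
            rw [show (4 : ℝ≥0∞) = 2 * 2 by norm_num, ENNReal.mul_inv (by simp) (by simp),
              ← mul_assoc, ENNReal.mul_inv_cancel (by simp) (by simp), one_mul]
    have hb3 : b ≤ 2 * (L * A ^ 2) := by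
      have h2t : b / 2 ≠ ∞ := ENNReal.div_ne_top hbt (by simp)
      have h4 : b / 2 ≤ L * A ^ 2 := by
        have : b / 2 + b / 2 ≤ L * A ^ 2 + b / 2 := by rwa [ENNReal.add_halves]
        exact (ENNReal.add_le_add_iff_right h2t).1 this
      rw [← ENNReal.add_halves b, two_mul]
      gcongr
    exact fun U => (hb U).trans (by gcongr)
  unfold bmoNorm
  refine iSup_le fun U => iSup_le fun _ => iSup₂_le fun h0 ht => ?_
  have h1 : coeffMass g U / volume U ≤ 2 * L * A ^ 2 := by
    refine ENNReal.div_le_of_le_mul ((coeffMass_eq_iSup_truncate g U).trans (iSup_le fun F => ?_))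
    rw [mul_assoc 2]; exact key F U
  calc _ ≤ (2 * L * A ^ 2) ^ (1 / 2 : ℝ) := ENNReal.rpow_le_rpow h1 (by norm_num)
    _ = (2 * L) ^ (1 / 2 : ℝ) * A := by
        rw [ENNReal.mul_rpow_of_nonneg _ _ (by norm_num), ← ENNReal.rpow_natCast,
          ← ENNReal.rpow_mul]
        norm_num
    _ ≤ A * ((2 * L) ^ (1 / 2 : ℝ) + 1) := by rw [mul_comm]; gcongr; exact le_self_add

/-! ### The lower bound by the norm of the square function -/

lemma rectSum_rpow_eq (g : DyadicDistribution) (s : ℝ) (x : ℝ × ℝ) :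
    rectSum (fun R => ENNReal.ofReal (g R ^ 2)) x ^ s = squareFn g x ^ (2 * s) := by
  rw [squareFn_rpow]; congr 1; ring

lemma squareFn_ne_top {g : DyadicDistribution} {F : Finset DyadicRect} (hgF : ∀ R ∉ F, g R = 0)
    (x : ℝ × ℝ) : squareFn g x ≠ ∞ :=
  ENNReal.rpow_ne_top_of_nonneg (by norm_num)
    (rectSum_ne_top (F := F) (fun R hR => by simp [hgF R hR]) (by simp) x)

lemma squareFn_eq_zero {g : DyadicDistribution} {F : Finset DyadicRect} (hgF : ∀ R ∉ F, g R = 0)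
    {x : ℝ × ℝ} (hx : x ∉ ⋃ R ∈ F, rect R) : squareFn g x = 0 := by
  rw [squareFn_eq, rectSum_eq_zero, ENNReal.zero_rpow_of_pos (by norm_num)]
  intro R hR
  by_cases hF : R ∈ F
  · exact absurd (Set.mem_biUnion (t := fun R => rect R) hF hR) hx
  · simp [hgF R hF]

lemma lintegral_squareFn_rpow_ne_top {g : DyadicDistribution} {F : Finset DyadicRect}
    (hgF : ∀ R ∉ F, g R = 0) {r : ℝ} (hr : 0 < r) : ∫⁻ x, squareFn g x ^ r ≠ ∞ := by
  have hUm : MeasurableSet (⋃ R ∈ F, rect R) :=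
    Finset.measurableSet_biUnion _ fun R _ => measurableSet_rect R
  set M := ∑ R ∈ F, ENNReal.ofReal (g R ^ 2) / volume (rect R)
  have hM : M ≠ ∞ := ENNReal.sum_ne_top.2 fun R _ =>
    ENNReal.div_ne_top (by simp) (volume_rect_ne_zero R)
  refine ne_top_of_le_ne_top (b := M ^ (r / 2) * volume (⋃ R ∈ F, rect R)) (ENNReal.mul_ne_top
    (ENNReal.rpow_ne_top_of_nonneg (by positivity) hM) (volume_biUnion_rect_ne_top F)) ?_
  rw [← lintegral_indicator_const hUm]
  refine lintegral_mono fun x => ?_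
  by_cases hx : x ∈ ⋃ R ∈ F, rect R
  · rw [Set.indicator_of_mem hx, squareFn_rpow]
    gcongr
    unfold rectSum
    rw [tsum_eq_sum (s := F) fun R hR => by simp [hgF R hR]]
    exact Finset.sum_le_sum fun R _ => Set.indicator_le_self' (fun _ _ => zero_le) x
  · rw [squareFn_eq_zero hgF hx, ENNReal.zero_rpow_of_pos hr]
    exact zero_le

lemma isCellUnion_lt_squareFn {g : DyadicDistribution} {F : Finset DyadicRect}
    (hgF : ∀ R ∉ F, g R = 0) {z : ℤ} (hz : ∀ R ∈ F, z ≤ R.1.1 ∧ z ≤ R.2.1) (y : ℝ≥0∞) :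
    IsCellUnion z {x | y < squareFn g x} := by
  refine isCellUnion_of_iff fun k l x x' hx hx' h => ?_
  have : squareFn g x' = squareFn g x := by
    rw [squareFn_eq, squareFn_eq, rectSum_eq_of_cell (F := F) (fun R hR => by simp [hgF R hR])
        hz hx' hx]
  rw [Set.mem_ofPred_eq] at h ⊢
  rwa [this]

lemma volume_lt_squareFn_ne_top {g : DyadicDistribution} {F : Finset DyadicRect}
    (hgF : ∀ R ∉ F, g R = 0) (y : ℝ≥0∞) : volume {x | y < squareFn g x} ≠ ∞ := by
  refine ne_top_of_le_ne_top (volume_biUnion_rect_ne_top F) (measure_mono fun x hx => ?_)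
  by_contra h
  rw [Set.mem_ofPred_eq, squareFn_eq_zero hgF h] at hx
  exact not_lt_zero hx

/-- The parts of the square function carried by rectangles which are mostly outside of the level
set at a much lower height are small. -/
lemma tsum_level_outside_le {r : ℝ} (hr : 0 < r) :
    ∃ D : ℝ≥0∞, D ≠ ∞ ∧ ∀ (g : DyadicDistribution) (F : Finset DyadicRect), (∀ R ∉ F, g R = 0) →
      ∀ (m : ℝ) (c : ℤ → DyadicRect → ℝ≥0∞), (∀ k R, c k R ≤ ENNReal.ofReal (g R ^ 2)) →
      (∀ k R, c k R ≠ 0 → density {x | (2 : ℝ≥0∞) ^ (k : ℝ) < squareFn g x} R ≤ 1 / 2) →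
      ∑' k : ℤ, 2 ^ (((k : ℝ) + m) * r) *
        volume {x | (2 : ℝ≥0∞) ^ (2 * ((k : ℝ) + m) - 1) < rectSum (c k) x} ≤
        D * 2 ^ (-(m * (r + 2))) * ∫⁻ x, squareFn g x ^ r := by
  -- Duality requires σ > 1, and summing over the levels requires 2σ > r; with σ = r + 1 the decay
  -- exponent 2σ - r is r + 2.
  set σ := r + 1
  have hσ : 1 < σ := by simp only [σ]; linarith
  have hd : 0 < r + 2 := by linarith
  obtain ⟨D, hD, h⟩ := lintegral_rectSum_rpow_le_compl hσ
  refine ⟨2 ^ σ * D * geoConst (r + 2), ENNReal.mul_ne_top (ENNReal.mul_ne_top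
    (two_rpow_ne_top _) hD) (geoConst_ne_top hd), fun g F hgF m c hc hdens => ?_⟩
  have hSm : Measurable (squareFn g) := measurable_squareFn g
  have hcoef : ∀ k : ℝ, (2 : ℝ≥0∞) ^ ((k + m) * r) * ((2 ^ (2 * (k + m) - 1)) ^ σ)⁻¹ =
      2 ^ σ * 2 ^ (-(m * (r + 2))) * 2 ^ (-(k * (r + 2))) := fun k => by
    rw [← ENNReal.rpow_mul, ← ENNReal.rpow_neg, ← two_rpow_add, ← two_rpow_add, ← two_rpow_add]
    congr 1; simp only [σ]; ring
  have hif : ∀ (k : ℤ) x, (rectSum (fun R => ENNReal.ofReal (g R ^ 2)) x *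
      {x | (2 : ℝ≥0∞) ^ (k : ℝ) < squareFn g x}ᶜ.indicator 1 x) ^ σ =
      if squareFn g x ≤ 2 ^ (k : ℝ) then squareFn g x ^ (2 * σ) else 0 := fun k x => by
    split_ifs with hx
    · rw [Set.indicator_of_mem (by simpa using hx), Pi.one_apply, mul_one, rectSum_rpow_eq]
    · rw [Set.indicator_of_notMem (by simpa using hx), mul_zero,
        ENNReal.zero_rpow_of_pos (by linarith)]
  have hmeas : ∀ k : ℤ, Measurable fun x =>
      if squareFn g x ≤ 2 ^ (k : ℝ) then squareFn g x ^ (2 * σ) else 0 := fun k =>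
    Measurable.ite (measurableSet_le hSm measurable_const) (hSm.pow_const _) measurable_const
  calc _ ≤ ∑' k : ℤ, (2 : ℝ≥0∞) ^ (((k : ℝ) + m) * r) * (((2 ^ (2 * ((k : ℝ) + m) - 1)) ^ σ)⁻¹ *
        (D * ∫⁻ x, if squareFn g x ≤ 2 ^ (k : ℝ) then squareFn g x ^ (2 * σ) else 0)) := by
        gcongr with k
        refine (volume_le_of_le_rpow (measurable_rectSum (c k)) (two_rpow_ne_zero _)
          (two_rpow_ne_top _) (zero_lt_one.trans hσ) fun x hx => le_of_lt hx).trans ?_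
        refine mul_le_mul_right ?_ _
        refine (h _ _ _ (measurableSet_lt measurable_const hSm) (hc k) (hdens k)).trans
            (le_of_eq ?_)
        simp_rw [hif k]
    _ = ∑' k : ℤ, 2 ^ σ * 2 ^ (-(m * (r + 2))) * D * ∫⁻ x, 2 ^ (-((k : ℝ) * (r + 2))) *
          if squareFn g x ≤ 2 ^ (k : ℝ) then squareFn g x ^ (2 * σ) else 0 := by
        congr 1; ext k
        rw [lintegral_const_mul _ (hmeas k), ← mul_assoc, hcoef]
        ring
    _ = 2 ^ σ * 2 ^ (-(m * (r + 2))) * D * ∫⁻ x, ∑' k : ℤ, 2 ^ (-((k : ℝ) * (r + 2))) *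
          if squareFn g x ≤ 2 ^ (k : ℝ) then squareFn g x ^ (2 * σ) else 0 := by
        rw [ENNReal.tsum_mul_left, lintegral_tsum fun k => ((hmeas k).const_mul _).aemeasurable]
    -- At each point only the levels with 2^k ≥ S contribute; their sum is of order S^{-(r+2)}, and
    -- 2σ - (r+2) = r.
    _ ≤ 2 ^ σ * 2 ^ (-(m * (r + 2))) * D * ∫⁻ x, geoConst (r + 2) * squareFn g x ^ r := by
        gcongr with x
        calc _ = squareFn g x ^ (2 * σ) * ∑' k : ℤ, (if squareFn g x ≤ (2 : ℝ≥0∞) ^ (k : ℝ) then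
              (2 : ℝ≥0∞) ^ (-((k : ℝ) * (r + 2))) else 0) := by
              rw [← ENNReal.tsum_mul_left]
              congr 1; ext k
              split_ifs
              · exact mul_comm _ _
              · simp
          _ ≤ squareFn g x ^ (2 * σ) * (geoConst (r + 2) * squareFn g x ^ (-(r + 2))) := by
              gcongr; exact tsum_le_level_le _ hd
          _ ≤ _ := by
              by_cases h0 : squareFn g x = 0
              · rw [h0, ENNReal.zero_rpow_of_pos (by linarith), zero_mul]; exact zero_le
              rw [mul_left_comm, ← ENNReal.rpow_add _ _ h0 (squareFn_ne_top hgF x)]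
              refine le_of_eq ?_
              congr 2; simp only [σ]; ring
    _ = _ := by
        rw [lintegral_const_mul _ (hSm.pow_const _)]; ring

/-- The norm of the paraproduct bounds the `L^r` norm of the square function of its symbol. -/
lemma dotHardyNorm_le_paraproductNorm {p q r : ℝ} (hp : 0 < p) (hq : 0 < q) (hr : 0 < r)
    (hpqr : 1 / q = 1 / p + 1 / r) :
    ∃ C : ℝ≥0∞, C ≠ ∞ ∧ ∀ g, dotHardyNorm r g ≤ C * paraproductNorm p q g := by
  classical
  obtain ⟨D, hD, hout⟩ := tsum_level_outside_le hr
  have ht1 : r / p + 1 = r / q := by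
    have := congrArg (r * ·) hpqr
    simp only [mul_add] at this
    rw [mul_one_div, mul_one_div, mul_one_div, div_self hr.ne'] at this
    exact this.symm
  have hqp : 1 - q / p = q / r := by
    have := congrArg (q * ·) hpqr
    simp only [mul_add] at this
    rw [mul_one_div, mul_one_div, mul_one_div, div_self hq.ne'] at this
    linarith
  -- The gap m between tested and estimated levels makes the contribution of rectangles mostly
  -- outside Ω_k at most T/4; the factor 2^r comes from comparing the integral of S^r with T.
  obtain ⟨m, hm⟩ : ∃ m : ℤ, D * 2 ^ (-((m : ℝ) * (r + 2))) * 2 ^ r ≤ 4⁻¹ := by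
    have hX : D * 2 ^ r * 4 ≠ ∞ :=
      ENNReal.mul_ne_top (ENNReal.mul_ne_top hD (two_rpow_ne_top r)) (by simp)
    obtain ⟨n, hn⟩ := ENNReal.exists_nat_gt hX
    refine ⟨n, ?_⟩
    have h1 : D * 2 ^ r * 4 ≤ 2 ^ (n : ℝ) := by
      refine hn.le.trans ?_
      rw [ENNReal.rpow_natCast]
      exact_mod_cast Nat.lt_two_pow_self.le
    have h2 : (2 : ℝ≥0∞) ^ (-(((n : ℤ) : ℝ) * (r + 2))) ≤ 2 ^ (-(n : ℝ)) := by
      refine two_rpow_le ?_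
      have : (0 : ℝ) ≤ n := n.cast_nonneg
      push_cast
      nlinarith
    rw [← ENNReal.div_eq_inv_mul.trans (mul_one _), ENNReal.le_div_iff_mul_le (by simp) (by simp)]
    calc _ ≤ D * 2 ^ (-(n : ℝ)) * 2 ^ r * 4 := by gcongr
      _ = D * 2 ^ r * 4 * 2 ^ (-(n : ℝ)) := by ring
      _ ≤ 2 ^ (n : ℝ) * 2 ^ (-(n : ℝ)) := by gcongr
      _ = 1 := by rw [← two_rpow_add, add_neg_cancel, ENNReal.rpow_zero]
  -- The choice η = 2^{-mr-2} compensates for the shift by m: Σ 2^{(k+m)r}|B_k| ≤ T/4.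
  obtain ⟨C, hC, hw⟩ := exists_weights hp hq hr (η := 2 ^ (-((m : ℝ) * r) - 2)) (two_rpow_ne_zero _)
  set t := r / p
  set G : ℝ≥0∞ := 2 * (geoConst r * ((2 ^ (5 + 2 * (m : ℝ) * t)) ^ (q / 2) * C))
  have hG : G ≠ ∞ := ENNReal.mul_ne_top (by simp) (ENNReal.mul_ne_top (geoConst_ne_top hr)
    (ENNReal.mul_ne_top (ENNReal.rpow_ne_top_of_nonneg (by positivity) (two_rpow_ne_top _)) hC))
  have hCt : 2 * G ^ (1 / q) + 1 ≠ ∞ := ENNReal.add_ne_top.2 ⟨ENNReal.mul_ne_top (by simp)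
    (ENNReal.rpow_ne_top_of_nonneg (by positivity) hG), by simp⟩
  refine ⟨2 * G ^ (1 / q) + 1, hCt, fun g => ?_⟩
  have hC0 : 2 * G ^ (1 / q) + 1 ≠ 0 := by simp
  rw [mul_comm, ← ENNReal.div_le_iff hC0 hCt]
  refine le_paraproductNorm fun A hA0 hAt hA => ?_
  rw [ENNReal.div_le_iff hC0 hCt]
  refine dotHardyNorm_le_of_truncate hr fun F => ?_
  set f := truncate g F
  have hfF : ∀ R ∉ F, f R = 0 := fun R hR => truncate_of_notMem g hR
  obtain ⟨z, hz⟩ := exists_scale_le F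
  set Ω : ℤ → Set (ℝ × ℝ) := fun k => {x | (2 : ℝ≥0∞) ^ (k : ℝ) < squareFn f x}
  set T : ℝ≥0∞ := ∑' k : ℤ, 2 ^ ((k : ℝ) * r) * volume (Ω k)
  have hSm : Measurable (squareFn f) := measurable_squareFn f
  have hT : T ≠ ∞ := ne_top_of_le_ne_top (ENNReal.mul_ne_top (geoConst_ne_top hr)
    (lintegral_squareFn_rpow_ne_top hfF hr)) (tsum_level_measure_le hSm hr)
  have hST : ∫⁻ x, squareFn f x ^ r ≤ 2 ^ r * T := lintegral_rpow_le_tsum hSm hr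
  have hshift : ∑' k : ℤ, (2 : ℝ≥0∞) ^ ((((k + m : ℤ)) : ℝ) * r) * volume (Ω (k + m)) = T :=
    (Equiv.addRight m).tsum_eq fun k : ℤ => (2 : ℝ≥0∞) ^ ((k : ℝ) * r) * volume (Ω k)
  have hfin : ∀ W : Finset ℤ, ∑ k ∈ W, (2 : ℝ≥0∞) ^ ((((k + m : ℤ)) : ℝ) * r) * volume (Ω (k + m)) ≤
      T / 2 + G / 2 * A ^ q * T ^ (q / p) := by
    intro W
    obtain ⟨b, B, hB, hbB, hint⟩ := hw f F hfF A (hA.mono hq (truncate_sq_le g F)) z W Ω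
      (fun k => isCellUnion_lt_squareFn hfF hz _) fun k => volume_lt_squareFn_ne_top hfF _
    set V := rectSum fun R => ENNReal.ofReal ((f R * b R) ^ 2)
    have hVm : Measurable V := measurable_rectSum _
    set c : ℤ → DyadicRect → ℝ≥0∞ := fun k R =>
      if density (Ω k) R ≤ 1 / 2 then ENNReal.ofReal (f R ^ 2) else 0
    -- Normalised so that, since r/p + 1 = r/q, the inequality y ≤ 2^{k+m} says exactly 2^{4-2kt} V
    -- ≤ 2^{2(k+m)-1}, for every k at once; moreover y^r is a constant times V^{q/2}.
    set y : ℝ × ℝ → ℝ≥0∞ := fun x => (2 ^ (5 + 2 * (m : ℝ) * t) * V x) ^ (q / (2 * r))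
    have hym : Measurable y := (hVm.const_mul _).pow_const _
    -- Off B_k, each rectangle through x is either mostly outside Ω_k, hence counted in `c k`, or
    -- has b_R ≥ 2^{kt}/4, hence f_R² ≤ 2^{4-2kt}(f_R b_R)². If both parts of S² were at most
    -- 2^{2(k+m)-1}, then S ≤ 2^{k+m}, contrary to x ∈ Ω_{k+m}.
    have hcover : ∀ k ∈ W, Ω (k + m) ⊆ B k ∪
        ({x | (2 : ℝ≥0∞) ^ (2 * ((k : ℝ) + m) - 1) < rectSum (c k) x} ∪
          {x | (2 : ℝ≥0∞) ^ (((k + m : ℤ)) : ℝ) < y x}) := by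
      intro k hk x hx
      by_contra hcon
      simp only [Set.mem_union, not_or, Set.mem_ofPred_eq, not_lt] at hcon
      obtain ⟨hxB, h1, h2⟩ := hcon
      have h3 : 2 ^ (4 - 2 * (k : ℝ) * t) * V x ≤ 2 ^ (2 * ((k : ℝ) + m) - 1) := by
        have h3 := ENNReal.rpow_le_rpow h2 (show 0 ≤ 2 * (t + 1) by rw [ht1]; positivity)
        simp only [y] at h3
        rw [← ENNReal.rpow_mul, show q / (2 * r) * (2 * (t + 1)) = 1 by rw [ht1]; field_simp,
          ENNReal.rpow_one, ← ENNReal.rpow_mul] at h3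
        calc 2 ^ (4 - 2 * (k : ℝ) * t) * V x
            = 2 ^ (-1 - 2 * ((k : ℝ) + m) * t) * (2 ^ (5 + 2 * (m : ℝ) * t) * V x) := by
              rw [← mul_assoc, ← two_rpow_add]; congr 2; ring
          _ ≤ 2 ^ (-1 - 2 * ((k : ℝ) + m) * t) * 2 ^ (((k + m : ℤ) : ℝ) * (2 * (t + 1))) := by
              gcongr
          _ = _ := by rw [← two_rpow_add]; congr 1; push_cast; ring
      have h4 : rectSum (fun R => ENNReal.ofReal (f R ^ 2)) x ≤
          rectSum (c k) x + 2 ^ (4 - 2 * (k : ℝ) * t) * V x := by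
        rw [← rectSum_const_mul, ← rectSum_add]
        refine rectSum_le_of_mem fun R hR => ?_
        simp only [c]
        split_ifs with hd
        · exact le_self_add
        · have h5 := (hbB k hk R (not_le.1 hd)).resolve_right fun h => hxB (h hR)
          rw [zero_add, ← ofReal_two_rpow, ← ENNReal.ofReal_mul (by positivity)]
          refine ENNReal.ofReal_le_ofReal ?_
          have h6 : (1 : ℝ) ≤ 2 ^ (4 - 2 * (k : ℝ) * t) * b R ^ 2 := by
            calc (1 : ℝ) = 2 ^ (4 - 2 * (k : ℝ) * t) * (2 ^ ((k : ℝ) * t) / 4) ^ 2 := by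
                  rw [div_pow, ← Real.rpow_natCast (2 ^ _), ← Real.rpow_mul two_pos.le,
                    mul_div_assoc', ← Real.rpow_add two_pos, Nat.cast_ofNat,
                    show (4 : ℝ) - 2 * k * t + k * t * 2 = (4 : ℕ) by push_cast; ring,
                    Real.rpow_natCast]
                  norm_num
              _ ≤ _ := by gcongr
          nlinarith [mul_le_mul_of_nonneg_left h6 (sq_nonneg (f R))]
      have h5 : squareFn f x ^ (2 : ℝ) ≤ 2 ^ (2 * ((k : ℝ) + m)) := by
        rw [squareFn_rpow, div_self two_ne_zero, ENNReal.rpow_one]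
        refine (h4.trans (add_le_add h1 h3)).trans (le_of_eq ?_)
        calc _ = (2 : ℝ≥0∞) ^ (1 : ℝ) * 2 ^ (2 * ((k : ℝ) + m) - 1) := by
              rw [ENNReal.rpow_one]; exact (two_mul _).symm
          _ = _ := by rw [← two_rpow_add]; congr 1; ring
      have h6 := ENNReal.rpow_lt_rpow hx two_pos
      rw [← ENNReal.rpow_mul] at h6
      refine absurd (h6.trans_le h5) (not_lt.2 (two_rpow_le ?_))
      push_cast; linarith
    calc _ ≤ ∑ k ∈ W, ((2 : ℝ≥0∞) ^ ((((k + m : ℤ)) : ℝ) * r) * volume (B k) +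
          (2 ^ (((k : ℝ) + m) * r) *
            volume {x | (2 : ℝ≥0∞) ^ (2 * ((k : ℝ) + m) - 1) < rectSum (c k) x} +
          2 ^ ((((k + m : ℤ)) : ℝ) * r) *
              volume {x | (2 : ℝ≥0∞) ^ (((k + m : ℤ)) : ℝ) < y x})) := by
          refine Finset.sum_le_sum fun k hk => ?_
          rw [show ((k : ℝ) + m) * r = ((k + m : ℤ) : ℝ) * r by push_cast; ring,
              ← mul_add, ← mul_add]
          gcongr
          exact (measure_mono (hcover k hk)).trans ((measure_union_le _ _).trans
            (add_le_add le_rfl (measure_union_le _ _)))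
      _ ≤ 4⁻¹ * T + (4⁻¹ * T + G / 2 * A ^ q * T ^ (q / p)) := by
          rw [Finset.sum_add_distrib, Finset.sum_add_distrib]
          refine add_le_add ?_ (add_le_add ?_ ?_)
          · calc _ ≤ ∑ k ∈ W, 4⁻¹ * (2 ^ ((k : ℝ) * r) * volume (Ω k)) := by
                  refine Finset.sum_le_sum fun k _ => ?_
                  refine (mul_le_mul_right (hB k) _).trans (le_of_eq ?_)
                  have h4 : (4⁻¹ : ℝ≥0∞) = 2 ^ (-2 : ℝ) := by rw [ENNReal.rpow_neg]; norm_num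
                  rw [h4, ← mul_assoc, ← mul_assoc, ← two_rpow_add, ← two_rpow_add]
                  congr 2; push_cast; ring
              _ ≤ _ := by
                  rw [← Finset.mul_sum]
                  gcongr
                  exact ENNReal.sum_le_tsum W
          · refine (ENNReal.sum_le_tsum W).trans ((hout f F hfF m c (fun k R => ?_)
              fun k R h => ?_).trans ?_)
            · simp only [c]; split_ifs
              · exact le_rfl
              · exact zero_le
            · by_contra hd
              exact h (if_neg hd)
            · calc _ ≤ D * 2 ^ (-((m : ℝ) * (r + 2))) * (2 ^ r * T) := by gcongr
                _ = D * 2 ^ (-((m : ℝ) * (r + 2))) * 2 ^ r * T := by ring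
                _ ≤ _ := by gcongr
          · calc _ ≤ ∑' k : ℤ, 2 ^ ((((k + m : ℤ)) : ℝ) * r) *
                    volume {x | (2 : ℝ≥0∞) ^ (((k + m : ℤ)) : ℝ) < y x} := ENNReal.sum_le_tsum W
              _ = ∑' k : ℤ, 2 ^ ((k : ℝ) * r) * volume {x | (2 : ℝ≥0∞) ^ (k : ℝ) < y x} :=
                  (Equiv.addRight m).tsum_eq fun k : ℤ =>
                    (2 : ℝ≥0∞) ^ ((k : ℝ) * r) * volume {x | (2 : ℝ≥0∞) ^ (k : ℝ) < y x}
              _ ≤ geoConst r * ∫⁻ x, y x ^ r := tsum_level_measure_le hym hr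
              _ = geoConst r * ((2 ^ (5 + 2 * (m : ℝ) * t)) ^ (q / 2) * ∫⁻ x, V x ^ (q / 2)) := by
                  rw [← lintegral_const_mul _ (hVm.pow_const _)]
                  congr 2; ext x
                  simp only [y]
                  rw [← ENNReal.rpow_mul, show q / (2 * r) * r = q / 2 by field_simp,
                    ENNReal.mul_rpow_of_nonneg _ _ (by positivity)]
              _ ≤ geoConst r * ((2 ^ (5 + 2 * (m : ℝ) * t)) ^ (q / 2) *
                    (C * A ^ q * T ^ (q / p))) := by
                  gcongr
                  refine hint.trans ?_
                  gcongr
                  exact ENNReal.sum_le_tsum W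
              _ = _ := by
                  simp only [G]
                  rw [mul_comm (2 : ℝ≥0∞), ENNReal.mul_div_cancel_right (by simp) (by simp)]
                  ring
      _ = _ := by
          rw [← add_assoc, ← two_mul, ← mul_assoc, show (4 : ℝ≥0∞) = 2 * 2 by norm_num,
            ENNReal.mul_inv (by simp) (by simp), ← mul_assoc, ENNReal.mul_inv_cancel (by simp)
            (by simp), one_mul, ENNReal.div_eq_inv_mul, ENNReal.div_eq_inv_mul]
  have hT2 : T ≤ G * A ^ q * T ^ (q / p) := by
    have h1 : T ≤ T / 2 + G / 2 * A ^ q * T ^ (q / p) := by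
      conv_lhs => rw [← hshift, ENNReal.tsum_eq_iSup_sum]
      exact iSup_le hfin
    have h2 : T / 2 ≤ G / 2 * A ^ q * T ^ (q / p) := by
      have : T / 2 + T / 2 ≤ T / 2 + G / 2 * A ^ q * T ^ (q / p) := by rwa [ENNReal.add_halves]
      exact (ENNReal.add_le_add_iff_left (ENNReal.div_ne_top hT (by simp))).1 this
    calc T = 2 * (T / 2) := (ENNReal.mul_div_cancel (by simp) (by simp)).symm
      _ ≤ 2 * (G / 2 * A ^ q * T ^ (q / p)) := by gcongr
      _ = 2 * (G / 2) * A ^ q * T ^ (q / p) := by ring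
      _ = _ := by rw [ENNReal.mul_div_cancel (by simp) (by simp)]
  -- Dividing by T^{q/p} leaves T^{q/r}, since 1 - q/p = q/r; the case T = 0 is separate.
  have hT3 : T ^ (1 / r) ≤ G ^ (1 / q) * A := by
    by_cases h0 : T = 0
    · rw [h0, ENNReal.zero_rpow_of_pos (by positivity)]; exact zero_le
    have h1 : T ^ (q / r) ≤ G * A ^ q := by
      rw [← hqp, ENNReal.rpow_sub _ _ h0 hT, ENNReal.rpow_one]
      exact ENNReal.div_le_of_le_mul hT2
    have h2 := ENNReal.rpow_le_rpow h1 (show 0 ≤ 1 / q by positivity)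
    rwa [← ENNReal.rpow_mul, ENNReal.mul_rpow_of_nonneg _ _ (by positivity), ← ENNReal.rpow_mul,
      mul_one_div_cancel hq.ne', ENNReal.rpow_one,
      show q / r * (1 / q) = 1 / r by field_simp] at h2
  rw [dotHardyNorm, eLpNorm_eq_lintegral hr]
  calc _ ≤ (2 ^ r * T) ^ (1 / r) := by gcongr
    _ = 2 * T ^ (1 / r) := by
        rw [ENNReal.mul_rpow_of_nonneg _ _ (by positivity), ← ENNReal.rpow_mul,
          mul_one_div_cancel hr.ne', ENNReal.rpow_one]
    _ ≤ 2 * (G ^ (1 / q) * A) := by gcongr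
    _ = A * (2 * G ^ (1 / q)) := by ring
    _ ≤ _ := by gcongr; exact le_self_add

/-- Adding 1 to the constants keeps them positive and invertible without assuming that they are
nonzero. -/
lemma exists_two_sided {ι : Type*} {X Y : ι → ℝ≥0∞} {C D : ℝ≥0∞} (hC : C ≠ ∞) (hD : D ≠ ∞)
    (h1 : ∀ g, X g ≤ C * Y g) (h2 : ∀ g, Y g ≤ D * X g) :
    ∃ c C : ℝ≥0, 0 < c ∧ 0 < C ∧ ∀ g, (c : ℝ≥0∞) * X g ≤ Y g ∧ Y g ≤ (C : ℝ≥0∞) * X g := by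
  lift C to ℝ≥0 using hC
  lift D to ℝ≥0 using hD
  have hC : C + 1 ≠ 0 := by positivity
  refine ⟨(C + 1)⁻¹, D + 1, by positivity, by positivity, fun g => ⟨?_, (h2 g).trans ?_⟩⟩
  · rw [ENNReal.coe_inv hC, ← ENNReal.div_eq_inv_mul]
    refine ENNReal.div_le_of_le_mul ((h1 g).trans ?_)
    rw [mul_comm (Y g)]
    gcongr
    exact le_self_add
  · gcongr
    exact le_self_add

end BiDyadic

end

theorem theorem1 :
    (∀ p q r : ℝ, 0 < p → 0 < q → 0 < r → 1 / q = 1 / p + 1 / r →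
      ∃ c C : ℝ≥0, 0 < c ∧ 0 < C ∧ ∀ g : BiDyadic.DyadicDistribution,
        (c : ℝ≥0∞) * BiDyadic.dotHardyNorm r g ≤ BiDyadic.paraproductNorm p q g ∧
        BiDyadic.paraproductNorm p q g ≤ (C : ℝ≥0∞) * BiDyadic.dotHardyNorm r g) ∧
    (∀ p : ℝ, 0 < p →
      ∃ c C : ℝ≥0, 0 < c ∧ 0 < C ∧ ∀ g : BiDyadic.DyadicDistribution,
        (c : ℝ≥0∞) * BiDyadic.bmoNorm g ≤ BiDyadic.paraproductNorm p p g ∧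
        BiDyadic.paraproductNorm p p g ≤ (C : ℝ≥0∞) * BiDyadic.bmoNorm g) := by
  refine ⟨fun p q r hp hq hr h => ?_, fun p hp => ?_⟩
  · obtain ⟨C, hC, hle⟩ := BiDyadic.dotHardyNorm_le_paraproductNorm hp hq hr h
    refine BiDyadic.exists_two_sided hC ENNReal.one_ne_top hle fun g => ?_
    rw [one_mul]
    exact BiDyadic.paraproductNorm_le (BiDyadic.dotHardyNorm_paraproduct_le hp hq hr h g)
  · obtain ⟨C, hC, hle⟩ := BiDyadic.bmoNorm_le_paraproductNorm hp
    obtain ⟨D, hD, hge⟩ := BiDyadic.paraproductNorm_le_bmoNorm hp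
    exact BiDyadic.exists_two_sided hC hD hle hge
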